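/- **Setting.** Let $\mu,\nu,\rho$ be Borel probability measures on $\mathbb R$ and $P=\mu\otimes\nu\otimes\rho$ on $\mathbb R^3\ni(x,y,z)$. Assume: * $\mu$ and $\nu$ are supported on compact sets, $\nu$ is not a Dirac mass, and $\int x\,d\mu=\int y\,d\nu=0$; * $c:\mathbb R^3\to\mathbb R$ is $C^1$, $|c|$ and $|\nabla c|$ are $P$-essentially bounded, and $dQ=e^{-c}\,dP$ defines a probability measure $Q$; * there is $\bar\pi\in\mathcal M(\mu,\nu)$ with $d\bar\pi/dP=e^{-p}$ and $p\in L^\infty(P)$. Here $\mathcal M(\mu,\nu)$ is the set of probability measures $\pi$ on $\mathbb R^3$ with $x$-marginal $\mu$ and $y$-marginal $\nu$ such that $\int(y-x)\,\pi(dy,dz\,|\,x)=0$ for $\mu$-a.e. $x$ (the $z$-marginal is not constrained); * $f^0,h^0\in L^\infty(\mu)$ and $g^0\in L^\infty(\nu)$. For $f,h\in L^\infty(\mu)$ and $g\in L^\infty(\nu)$ let $\pi(f,g,h)$ be the measure with density $\exp(-c(x,y,z)-f(x)-g(y)-h(x)(y-x))$ with respect to $P$, let $Z(f,g,h)$ be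 its total mass, and put $$\mathcal G(f,g,h)=-Z(f,g,h)-\int f\,d\mu-\int g\,d\nu,\qquad \mathcal G^*=\sup_{f,h\in L^\infty(\mu),\,g\in L^\infty(\nu)}\mathcal G(f,g,h).$$ Let $H(\pi|Q)=\int\log\frac{d\pi}{dQ}\,d\pi$ if $\pi\ll Q$ and $+\infty$ otherwise. **Sinkhorn's algorithm.** Given $(f^n,g^n,h^n)$, for $\mu$-a.e. $x$ let $\tilde h^{n+1}(x)$ be the solution $t$ of $$\int (y-x)\exp\big(-c(x,y,z)-f^n(x)-g^n(y)-t(y-x)\big)\,\nu(dy)\rho(dz)=0,$$ and let $$\tilde f^{n+1}(x)=\log\int \exp\big(-c-g^n(y)-\tilde h^{n+1}(x)(y-x)\big)\,\nu(dy)\rho(dz),$$ $$\tilde g^{n+1}(y)=\log\int \exp\big(-c-\tilde f^{n+1}(x)-\tilde h^{n+1}(x)(y-x)\big)\,\mu(dx)\rho(dz).$$ With $\lambda_g=\int\tilde g^{n+1}d\nu$ and $\lambda_h=\int\tilde h^{n+1}d\mu$, set $$(f^{n+1},g^{n+1},h^{n+1})=\big(\tilde f^{n+1}+\lambda_g-\lambda_h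 x,\ \tilde g^{n+1}-\lambda_g+\lambda_h y,\ \tilde h^{n+1}-\lambda_h\big).$$ **Theorem.** The algorithm is well defined: for every $n\ge0$ the equation for $\tilde h^{n+1}(x)$ has exactly one solution for $\mu$-a.e. $x$, and $f^n,h^n\in L^\infty(\mu)$, $g^n\in L^\infty(\nu)$. There are constants $C_f,C_g,C_h$ with $$|f^n|_{L^\infty(\mu)}\le C_f,\quad |g^n|_{L^\infty(\nu)}\le C_g,\quad |h^n|_{L^\infty(\mu)}\le C_h\qquad\text{for all } n\ge1,$$ and there is a triple $(f^*,g^*,h^*)\in L^\infty(\mu)\times L^\infty(\nu)\times L^\infty(\mu)$ such that the following hold. 1. For any constants $C_f,C_g,C_h$ bounding the iterates as above, there is $\rho_s>0$, depending only on (bounds for) $\operatorname{ess\,sup}_\mu|x|$, $\operatorname{ess\,sup}_\nu|y|$, $|c|_{L^\infty(P)}$, a positive lower bound for $\operatorname{Var}(\nu)$, and $C_f,C_g,C_h$, such that for all $n\ge0$ $$\mathcal G^*-\mathcal G(f^n,g^n,h^n)\le e^{-n\rho_s}\big(\mathcal G^*-\mathcal G(f^0,g^0,h^0)\big).$$ 2.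 $f^n\to f^*$ in $L^\infty(\mu)$, $g^n\to g^*$ in $L^\infty(\nu)$ and $h^n\to h^*$ in $L^\infty(\mu)$. Moreover $\mathcal G^*$ is finite, $\mathcal G(f^*,g^*,h^*)=\mathcal G^*$, and $(f^*,g^*,h^*)$ is (up to a.e. equality) the unique maximizer of $\mathcal G$ with $\int g\,d\nu=\int h\,d\mu=0$. 3. With the same $\rho_s$ as in 1, there is $C_0\ge0$ such that for all $n\ge0$ $$|f^n-f^*|_{L^\infty(\mu)}^2+|g^n-g^*|_{L^\infty(\nu)}^2+|h^n-h^*|_{L^2(\mu)}^2\le C_0e^{-n\rho_s}.$$ 4. $\pi^*=\pi(f^*,g^*,h^*)$ is a probability measure, it belongs to $\mathcal M(\mu,\nu)$, it is the unique minimizer of $H(\cdot|Q)$ over $\mathcal M(\mu,\nu)$, and there is no primal-dual gap: $$\min_{\pi\in\mathcal M(\mu,\nu)}H(\pi|Q)=H(\pi^*|Q)=1+\mathcal G^*,$$ where $1$ is the additive constant left out in the definition of $\mathcal G$ (at $\pi^*$ the mass $Z$ equals $1$, so $1+\mathcal G^*=-\int f^*d\mu-\int g^*d\nu$). -/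

import Mathlib

open MeasureTheory ProbabilityTheory InformationTheory Filter Topology
open scoped ENNReal

noncomputable section

namespace EMOT

/-- A triple of dual potentials `f(x)`, `g(y)`, `h(x)`. -/
structure Potentials where
  f : ℝ → ℝ
  g : ℝ → ℝ
  h : ℝ → ℝ

/-- The base measure `μ ⊗ ν ⊗ ρ` on points `(x, y, z)`. -/
def base (μ ν ρ : Measure ℝ) : Measure (ℝ × ℝ × ℝ) := μ.prod (ν.prod ρ)

/-- The reference measure `Q`, with density `exp (-c)` with respect to `μ ⊗ ν ⊗ ρ`. -/
def reference (μ ν ρ : Measure ℝ) (c : ℝ × ℝ × ℝ → ℝ) : Measure (ℝ × ℝ × ℝ) :=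
  (base μ ν ρ).withDensity fun p => ENNReal.ofReal (Real.exp (-c p))

/-- The induced measure `π(f,g,h)`, with density `exp (-c - f(x) - g(y) - h(x)(y-x))`. -/
def induced (μ ν ρ : Measure ℝ) (c : ℝ × ℝ × ℝ → ℝ) (φ : Potentials) : Measure (ℝ × ℝ × ℝ) :=
  (base μ ν ρ).withDensity fun p =>
    ENNReal.ofReal (Real.exp (-c p - φ.f p.1 - φ.g p.2.1 - φ.h p.1 * (p.2.1 - p.1)))

/-- The martingale couplings: laws of `(x, y, z)` with `x`-marginal `μ`, `y`-marginal `ν`, free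
`z`-marginal, and `∫ (y - x) π(dy, dz | x) = 0` for `μ`-almost every `x`. -/
def martingaleCouplings (μ ν : Measure ℝ) : Set (ProbabilityMeasure (ℝ × ℝ × ℝ)) :=
  {π | (π : Measure (ℝ × ℝ × ℝ)).map (fun p => p.1) = μ ∧
       (π : Measure (ℝ × ℝ × ℝ)).map (fun p => p.2.1) = ν ∧
       ∀ᵐ x ∂μ, ∫ q, (q.1 - x) ∂((π : Measure (ℝ × ℝ × ℝ)).condKernel x) = 0}

/-- The value `inf H(π | Q)` over martingale couplings. On probability measures
`klDiv` is the relative entropy (and `∞` where it is infinite). -/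
def primalValue (μ ν ρ : Measure ℝ) (c : ℝ × ℝ × ℝ → ℝ) : ℝ≥0∞ :=
  ⨅ π ∈ martingaleCouplings μ ν, klDiv (π : Measure (ℝ × ℝ × ℝ)) (reference μ ν ρ c)

/-- `f ∈ L^∞(μ)`, `g ∈ L^∞(ν)`, `h ∈ L^∞(μ)`. -/
def Potentials.Bounded (φ : Potentials) (μ ν : Measure ℝ) : Prop :=
  MemLp φ.f ∞ μ ∧ MemLp φ.g ∞ ν ∧ MemLp φ.h ∞ μ

/-- `∫ g dν = ∫ h dμ = 0`. -/
def Potentials.Normalized (φ : Potentials) (μ ν : Measure ℝ) : Prop :=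
  ∫ y, φ.g y ∂ν = 0 ∧ ∫ x, φ.h x ∂μ = 0

/-- Equality of triples in `L^∞(μ) × L^∞(ν) × L^∞(μ)`. -/
def Potentials.AEEq (φ ψ : Potentials) (μ ν : Measure ℝ) : Prop :=
  φ.f =ᵐ[μ] ψ.f ∧ φ.g =ᵐ[ν] ψ.g ∧ φ.h =ᵐ[μ] ψ.h

/-- The dual functional `G(f,g,h) = - Z(f,g,h) - ∫ f dμ - ∫ g dν`, where `Z(f,g,h)` is the total
mass of the induced measure. -/
def dual (μ ν ρ : Measure ℝ) (c : ℝ × ℝ × ℝ → ℝ) (φ : Potentials) : ℝ :=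
  -(induced μ ν ρ c φ).real Set.univ - ∫ x, φ.f x ∂μ - ∫ y, φ.g y ∂ν

/-- The set of values of the dual functional on bounded triples. -/
def dualValues (μ ν ρ : Measure ℝ) (c : ℝ × ℝ × ℝ → ℝ) : Set ℝ :=
  dual μ ν ρ c '' {φ | φ.Bounded μ ν}

/-- The dual value `G*`. -/
def dualSup (μ ν ρ : Measure ℝ) (c : ℝ × ℝ × ℝ → ℝ) : ℝ :=
  sSup (dualValues μ ν ρ c)

/-- The equation that the updated value `t = h̃(x)` has to solve. -/
def IsRoot (ν ρ : Measure ℝ) (c : ℝ × ℝ × ℝ → ℝ) (φ : Potentials) (x t : ℝ) : Prop :=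
  ∫ q : ℝ × ℝ, (q.1 - x) * Real.exp (-c (x, q.1, q.2) - φ.f x - φ.g q.1 - t * (q.1 - x))
    ∂(ν.prod ρ) = 0

/-- First half-step: `h̃(x)` is a solution of the root equation (some solution, if there is one). -/
def hUpdate (ν ρ : Measure ℝ) (c : ℝ × ℝ × ℝ → ℝ) (φ : Potentials) (x : ℝ) : ℝ :=
  Classical.epsilon fun t => IsRoot ν ρ c φ x t

/-- `f̃`, computed from `g` and `h̃`. -/
def fUpdate (ν ρ : Measure ℝ) (c : ℝ × ℝ × ℝ → ℝ) (g h : ℝ → ℝ) (x : ℝ) : ℝ :=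
  Real.log (∫ q : ℝ × ℝ, Real.exp (-c (x, q.1, q.2) - g q.1 - h x * (q.1 - x)) ∂(ν.prod ρ))

/-- `g̃`, computed from `f̃` and `h̃`. -/
def gUpdate (μ ρ : Measure ℝ) (c : ℝ × ℝ × ℝ → ℝ) (f h : ℝ → ℝ) (y : ℝ) : ℝ :=
  Real.log (∫ q : ℝ × ℝ, Real.exp (-c (q.1, y, q.2) - f q.1 - h q.1 * (y - q.1)) ∂(μ.prod ρ))

/-- The triple `(f̃, g̃, h̃)` obtained from `(f, g, h)`, before normalization. -/
def rawStep (μ ν ρ : Measure ℝ) (c : ℝ × ℝ × ℝ → ℝ) (φ : Potentials) : Potentials where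
  h := hUpdate ν ρ c φ
  f := fUpdate ν ρ c φ.g (hUpdate ν ρ c φ)
  g := gUpdate μ ρ c (fUpdate ν ρ c φ.g (hUpdate ν ρ c φ)) (hUpdate ν ρ c φ)

/-- The normalization
`(f̃ + λ_g - λ_h x, g̃ - λ_g + λ_h y, h̃ - λ_h)` with `λ_g = ∫ g̃ dν`, `λ_h = ∫ h̃ dμ`. -/
def normalize (μ ν : Measure ℝ) (φ : Potentials) : Potentials where
  f x := φ.f x + ∫ t, φ.g t ∂ν - (∫ t, φ.h t ∂μ) * x
  g y := φ.g y - ∫ t, φ.g t ∂ν + (∫ t, φ.h t ∂μ) * y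
  h x := φ.h x - ∫ t, φ.h t ∂μ

/-- The Sinkhorn iterates `(f^n, g^n, h^n)` started from `φ₀ = (f^0, g^0, h^0)`. -/
def sinkhorn (μ ν ρ : Measure ℝ) (c : ℝ × ℝ × ℝ → ℝ) (φ₀ : Potentials) : ℕ → Potentials
  | 0 => φ₀
  | n + 1 => normalize μ ν (rawStep μ ν ρ c (sinkhorn μ ν ρ c φ₀ n))

/-- The standing assumptions. -/
structure Standing (μ ν ρ : Measure ℝ) (c : ℝ × ℝ × ℝ → ℝ) (φ₀ : Potentials) : Prop where
  compact_left : ∃ K : Set ℝ, IsCompact K ∧ μ Kᶜ = 0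
  compact_right : ∃ K : Set ℝ, IsCompact K ∧ ν Kᶜ = 0
  not_dirac : ∀ y₀ : ℝ, ν ≠ Measure.dirac y₀
  mean_left : ∫ x, x ∂μ = 0
  mean_right : ∫ y, y ∂ν = 0
  reference_prob : IsProbabilityMeasure (reference μ ν ρ c)
  cost_smooth : ContDiff ℝ 1 c
  cost_gradient : ∃ L : ℝ, ∀ᵐ p ∂(base μ ν ρ), ‖fderiv ℝ c p‖ ≤ L
  cost_bounded : ∃ K : ℝ, ∀ᵐ p ∂(base μ ν ρ), |c p| ≤ K
  /-- There is a martingale coupling with density `exp (-p)`, `p` essentially bounded. -/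
  equivalent_coupling : ∃ π ∈ martingaleCouplings μ ν, ∃ p : ℝ × ℝ × ℝ → ℝ,
    MemLp p ∞ (base μ ν ρ) ∧
    (π : Measure (ℝ × ℝ × ℝ)) =
      (base μ ν ρ).withDensity fun w => ENNReal.ofReal (Real.exp (-p w))
  initial_bounded : φ₀.Bounded μ ν

/-- `|f^n| ≤ Cf` `μ`-a.e., `|g^n| ≤ Cg` `ν`-a.e. and `|h^n| ≤ Ch` `μ`-a.e. for every `n ≥ 1`. -/
def UniformBound (μ ν : Measure ℝ) (φ : ℕ → Potentials) (Cf Cg Ch : ℝ) : Prop :=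
  ∀ n, 1 ≤ n → (∀ᵐ x ∂μ, |(φ n).f x| ≤ Cf) ∧ (∀ᵐ y ∂ν, |(φ n).g y| ≤ Cg) ∧
    (∀ᵐ x ∂μ, |(φ n).h x| ≤ Ch)

end EMOT

end

open MeasureTheory ProbabilityTheory InformationTheory Filter Topology
open scoped ENNReal

noncomputable section

set_option linter.unusedSectionVars false

namespace EMOT

/-! ### Elementary inequalities -/

/-! Only the coordinates x and y matter: replacing `c` by `flatCost`, minus the logarithm of the
ρ-integral of exp(-c), turns the problem into one on the plane. There the dual functional is
concave, and with W = c + f(x) + g(y) + h(x)(y - x) its first order conditions say that exp(-W) has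
first marginal μ and is a martingale (`XOpt`), and that its second marginal is ν (`YOpt`). A
Sinkhorn step maximizes exactly over (f, h), then over g; the normalization leaves W and the dual
value unchanged.

The rate comes from one inequality, `planarDual_gap_le`. Since the potentials are bounded, the dual
is strongly concave in W, and for normalized triples the L² norm of a difference of W splits
orthogonally into the parts from f - xh, g and h. The linear term at the end of a step would vanish
if exp(-W) still satisfied `XOpt`; the g update spoils this only by the factor exp(-(change of g)),
the density of the second marginal before that update. A Pinsker inequality bounds its L¹ distance
to 1 by the square root of the entropy, which is precisely the gain of the g update. Hence the gap
to any normalized bounded triple is at most a constant times the gain of the step, and the gap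
decays geometrically (`le_exp_mul_of_gap`).

Uniform bounds use the equivalent martingale coupling θ. Since the h term integrates to zero under
θ, the dual value equals -∫ exp(-W) - ∫ W dθ + ∫ c dθ, so it controls the L¹ norm of W
(`integral_abs_energy_le`). As the values increase along the iteration, this gives an L¹ bound and a
pointwise lower bound for g. The coupling also forces ν to have mass on both sides of almost every
x, quantitatively (`exists_twoSided`), which confines the root h(x); bounds for f and the new g
follow.

The same gap inequality, applied between iterates, makes the g potentials Cauchy in L¹(ν). A step is
Lipschitz from L¹(ν) to L^∞ (`step_stable`), so they converge uniformly. A step from the limit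
reaches the supremum, the next one gains nothing, and a step without gain satisfies all optimality
conditions. Strong concavity gives uniqueness, and `step_stable` transfers the rate to the
potentials.

For the primal problem, the induced measure π* of the maximizer is an exponential tilt of Q whose
log density has the same integral under every martingale coupling absolutely continuous with respect
to Q. Thus H(π|Q) = H(π|π*) + constant for couplings of finite entropy, which gives optimality,
uniqueness and the absence of a gap together. -/

theorem exp_mul_one_sub_add_sq_le {t : ℝ} (ht : 0 ≤ t) :
    Real.exp t * (1 - t) + t ^ 2 / 2 ≤ 1 := by
  have hd : ∀ s : ℝ, HasDerivAt (fun s => Real.exp s * (1 - s) + s ^ 2 / 2)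
      (Real.exp s * (1 - s) + Real.exp s * (-1) + s) s := fun s => by
    have h1 := (Real.hasDerivAt_exp s).fun_mul ((hasDerivAt_id' s).const_sub 1)
    have h2 := ((hasDerivAt_id' s).fun_pow 2).div_const 2
    exact (h1.fun_add h2).congr_deriv (by simp)
  -- The derivative simplifies to s(1 - exp s), which is nonpositive for s ≥ 0.
  have hanti : AntitoneOn (fun s => Real.exp s * (1 - s) + s ^ 2 / 2) (Set.Ici 0) := by
    refine antitoneOn_of_deriv_nonpos (convex_Ici 0)
      (fun s _ => (hd s).continuousAt.continuousWithinAt)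
      (fun s _ => (hd s).differentiableAt.differentiableWithinAt) fun s hs => ?_
    rw [interior_Ici] at hs
    rw [(hd s).deriv]
    nlinarith [Real.add_one_le_exp s, Set.mem_Ioi.1 hs]
  have := hanti (Set.mem_Ici.2 le_rfl) (Set.mem_Ici.2 ht) ht
  simpa using this

/-- Second order lower bound for the exponential between two points where it is at least `m`. -/
theorem exp_neg_second_order {m a b : ℝ} (ha : m ≤ Real.exp (-a)) (hb : m ≤ Real.exp (-b)) :
    Real.exp (-a) - Real.exp (-a) * (b - a) + m / 2 * (b - a) ^ 2 ≤ Real.exp (-b) := by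
  rcases le_total b a with h | h
  · have h1 := Real.quadratic_le_exp_of_nonneg (sub_nonneg.2 h)
    have h2 : Real.exp (-b) = Real.exp (-a) * Real.exp (a - b) := by
      rw [← Real.exp_add]; congr 1; ring
    nlinarith [mul_le_mul_of_nonneg_left h1 (Real.exp_pos (-a)).le,
      mul_le_mul_of_nonneg_right ha (sq_nonneg (b - a))]
  -- Here exp(-b) is the smaller of the two values, so the inequality is scaled by exp(-b) instead
  -- of exp(-a).
  · have h1 := exp_mul_one_sub_add_sq_le (sub_nonneg.2 h)
    have h2 : Real.exp (-a) = Real.exp (-b) * Real.exp (b - a) := by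
      rw [← Real.exp_add]; congr 1; ring
    rw [h2]
    nlinarith [mul_le_mul_of_nonneg_left h1 (Real.exp_pos (-b)).le,
      mul_le_mul_of_nonneg_right hb (sq_nonneg (b - a))]

theorem exp_neg_tangent (a b : ℝ) :
    Real.exp (-a) - Real.exp (-a) * (b - a) ≤ Real.exp (-b) := by
  have := exp_neg_second_order (Real.exp_pos (-a)).le (Real.exp_pos (-b)).le
  simpa using this

theorem abs_exp_neg_sub_le {M a b : ℝ} (ha : Real.exp (-a) ≤ M) (hb : Real.exp (-b) ≤ M) :
    |Real.exp (-a) - Real.exp (-b)| ≤ M * |a - b| := by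
  have h1 := exp_neg_tangent a b
  have h2 := exp_neg_tangent b a
  have h3 : Real.exp (-a) * (b - a) ≤ M * |a - b| := by
    rw [abs_sub_comm]
    exact (mul_le_mul_of_nonneg_left (le_abs_self _) (Real.exp_pos _).le).trans
      (mul_le_mul_of_nonneg_right ha (abs_nonneg _))
  have h4 : Real.exp (-b) * (a - b) ≤ M * |a - b| :=
    (mul_le_mul_of_nonneg_left (le_abs_self _) (Real.exp_pos _).le).trans
      (mul_le_mul_of_nonneg_right hb (abs_nonneg _))
  rw [abs_le]
  constructor <;> linarith

/-- Pointwise Pinsker: with r = exp(-u), (1 - r)² ≤ 2 max(1, r) (r - 1 + u), followed by Young's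
inequality with weight ε. The parameter is kept so that it can be optimized after integration. -/
theorem abs_one_sub_exp_neg_le (u : ℝ) {ε : ℝ} (hε : 0 < ε) :
    |1 - Real.exp (-u)| ≤
      ε / 2 * (1 + Real.exp (-u)) + (Real.exp (-u) - 1 + u) / ε := by
  have key : ∀ t m H : ℝ, 1 ≤ m → t ^ 2 ≤ 2 * m * H → t ≤ ε / 2 * m + H / ε := by
    intro t m H hm hH
    rw [← sub_nonneg]
    have : 0 ≤ 2 * ε * m * (ε / 2 * m + H / ε - t) := by
      have : 2 * ε * m * (ε / 2 * m + H / ε - t) = (ε * m - t) ^ 2 + (2 * m * H - t ^ 2) := by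
        field_simp; ring
      rw [this]; nlinarith [sq_nonneg (ε * m - t)]
    exact nonneg_of_mul_nonneg_right this (by positivity)
  -- For u ≥ 0 the quadratic bound comes from the first two terms of the series of -log(1 - x) at x
  -- = 1 - r; for u ≤ 0 it is sinh(-u) ≥ -u in disguise.
  have hr := Real.exp_pos (-u)
  rcases le_total 0 u with h | h
  · have hr1 : Real.exp (-u) ≤ 1 := Real.exp_le_one_iff.2 (by linarith)
    rw [abs_of_nonneg (by linarith)]
    refine (key _ 1 _ le_rfl ?_).trans (by gcongr; linarith)
    set x := 1 - Real.exp (-u) with hx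
    have hx1 : |x| < 1 := by rw [abs_of_nonneg (by linarith)]; linarith
    have hs := Real.hasSum_pow_div_log_of_abs_lt_one hx1
    have := sum_le_hasSum (Finset.range 2) (fun i _ => by
      have : 0 ≤ x := by linarith
      positivity) hs
    have hlog : Real.log (1 - x) = -u := by rw [hx]; simp
    rw [hlog] at this
    simp [Finset.sum_range_succ] at this
    norm_num at this
    nlinarith
  · have hr1 : 1 ≤ Real.exp (-u) := Real.one_le_exp (by linarith)
    rw [abs_sub_comm, abs_of_nonneg (by linarith)]
    refine (key _ (Real.exp (-u)) _ hr1 ?_).trans (by gcongr; linarith)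
    have h1 := Real.self_le_sinh_iff.2 (neg_nonneg.2 h)
    rw [Real.sinh_eq, neg_neg] at h1
    have h2 : Real.exp (-u) * Real.exp u = 1 := by rw [← Real.exp_add]; simp
    nlinarith

/-! ### Essentially bounded functions -/

section EssBdd

variable {α β : Type*} [MeasurableSpace α] [MeasurableSpace β]

/-- Real functions that are measurable and bounded up to null sets. -/
def EssBdd (f : α → ℝ) (μ : Measure α) : Prop :=
  AEStronglyMeasurable f μ ∧ ∃ C, ∀ᵐ x ∂μ, |f x| ≤ C

theorem essBdd_iff {f : α → ℝ} {μ : Measure α} : EssBdd f μ ↔ MemLp f ∞ μ := by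
  constructor
  · rintro ⟨h, C, hC⟩
    exact memLp_top_of_bound h C (by simpa using hC)
  · intro h
    refine ⟨h.1, (eLpNormEssSup f μ).toReal, ?_⟩
    filter_upwards [ae_le_eLpNormEssSup (f := f) (μ := μ)] with x hx
    have h2 : eLpNormEssSup f μ ≠ ∞ := by
      have := h.2; rw [eLpNorm_exponent_top] at this; exact this.ne
    have := ENNReal.toReal_mono h2 hx
    simpa using this

namespace EssBdd

variable {f g : α → ℝ} {μ : Measure α}

theorem exists_nonneg (hf : EssBdd f μ) : ∃ C, 0 ≤ C ∧ ∀ᵐ x ∂μ, |f x| ≤ C := by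
  obtain ⟨C, hC⟩ := hf.2
  exact ⟨max C 0, le_max_right _ _, hC.mono fun x hx => hx.trans (le_max_left _ _)⟩

theorem const (a : ℝ) : EssBdd (fun _ : α => a) μ :=
  ⟨aestronglyMeasurable_const, |a|, ae_of_all _ fun _ => le_rfl⟩

theorem add (hf : EssBdd f μ) (hg : EssBdd g μ) : EssBdd (fun x => f x + g x) μ := by
  obtain ⟨C, hC⟩ := hf.2
  obtain ⟨D, hD⟩ := hg.2
  refine ⟨hf.1.add hg.1, C + D, ?_⟩
  filter_upwards [hC, hD] with x h1 h2
  exact (abs_add_le _ _).trans (add_le_add h1 h2)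

theorem neg (hf : EssBdd f μ) : EssBdd (fun x => -f x) μ := by
  obtain ⟨C, hC⟩ := hf.2
  exact ⟨hf.1.neg, C, by simpa using hC⟩

theorem sub (hf : EssBdd f μ) (hg : EssBdd g μ) : EssBdd (fun x => f x - g x) μ := by
  simpa [sub_eq_add_neg] using hf.add hg.neg

theorem mul (hf : EssBdd f μ) (hg : EssBdd g μ) : EssBdd (fun x => f x * g x) μ := by
  obtain ⟨C, hC⟩ := hf.2
  obtain ⟨D, hD⟩ := hg.2
  refine ⟨hf.1.mul hg.1, C * D, ?_⟩
  filter_upwards [hC, hD] with x h1 h2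
  rw [abs_mul]
  exact mul_le_mul h1 h2 (abs_nonneg _) ((abs_nonneg _).trans h1)

theorem abs (hf : EssBdd f μ) : EssBdd (fun x => |f x|) μ := by
  obtain ⟨C, hC⟩ := hf.2
  exact ⟨by simpa using hf.1.norm, C, by simpa using hC⟩

theorem sq (hf : EssBdd f μ) : EssBdd (fun x => f x ^ 2) μ := by
  simpa [pow_two] using hf.mul hf

theorem exp (hf : EssBdd f μ) : EssBdd (fun x => Real.exp (f x)) μ := by
  obtain ⟨C, hC⟩ := hf.2
  refine ⟨Real.continuous_exp.comp_aestronglyMeasurable hf.1, Real.exp C, ?_⟩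
  filter_upwards [hC] with x hx
  rw [abs_of_pos (Real.exp_pos _)]
  exact Real.exp_le_exp.2 ((le_abs_self _).trans hx)

theorem exp_neg (hf : EssBdd f μ) : EssBdd (fun x => Real.exp (-f x)) μ := hf.neg.exp

theorem congr (hf : EssBdd f μ) (h : f =ᵐ[μ] g) : EssBdd g μ := by
  obtain ⟨C, hC⟩ := hf.2
  refine ⟨hf.1.congr h, C, ?_⟩
  filter_upwards [hC, h] with x h1 h2
  rwa [← h2]

theorem integrable [IsFiniteMeasure μ] (hf : EssBdd f μ) : Integrable f μ := by
  obtain ⟨C, hC⟩ := hf.2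
  exact Integrable.of_bound hf.1 C (by simpa using hC)

theorem comp_quasi {ν : Measure β} {φ : β → α} (hf : EssBdd f μ)
    (hφ : Measure.QuasiMeasurePreserving φ ν μ) : EssBdd (fun x => f (φ x)) ν := by
  obtain ⟨C, hC⟩ := hf.2
  exact ⟨hf.1.comp_quasiMeasurePreserving hφ, C, hφ.ae hC⟩

theorem fst {ν : Measure β} [SFinite ν] [SFinite μ] (hf : EssBdd f μ) :
    EssBdd (fun p : α × β => f p.1) (μ.prod ν) :=
  hf.comp_quasi Measure.quasiMeasurePreserving_fst

theorem snd {ν : Measure β} [SFinite ν] [SFinite μ] (hf : EssBdd f μ) :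
    EssBdd (fun p : β × α => f p.2) (ν.prod μ) :=
  hf.comp_quasi Measure.quasiMeasurePreserving_snd

variable {ν : Measure β} {F : α × β → ℝ}

theorem sect_right [SFinite ν] (hF : EssBdd F (μ.prod ν)) :
    ∀ᵐ x ∂μ, EssBdd (fun y => F (x, y)) ν := by
  obtain ⟨C, hC⟩ := hF.2
  filter_upwards [hF.1.prodMk_left, Measure.ae_ae_of_ae_prod hC] with x h1 h2
  exact ⟨h1, C, h2⟩

theorem swap [SFinite ν] [SFinite μ] (hF : EssBdd F (μ.prod ν)) :
    EssBdd (fun p : β × α => F (p.2, p.1)) (ν.prod μ) :=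
  hF.comp_quasi (φ := Prod.swap) Measure.measurePreserving_swap.quasiMeasurePreserving

theorem sect_left [SFinite ν] [SFinite μ] (hF : EssBdd F (μ.prod ν)) :
    ∀ᵐ y ∂ν, EssBdd (fun x => F (x, y)) μ := hF.swap.sect_right

theorem integral_right [IsProbabilityMeasure ν] (hF : EssBdd F (μ.prod ν)) :
    EssBdd (fun x => ∫ y, F (x, y) ∂ν) μ := by
  obtain ⟨C, hC⟩ := hF.2
  refine ⟨hF.1.integral_prod_right', C, ?_⟩
  filter_upwards [Measure.ae_ae_of_ae_prod hC] with x h2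
  have := norm_integral_le_of_norm_le_const (μ := ν) (f := fun y => F (x, y)) (C := C)
    (by simpa using h2)
  simpa using this

theorem integral_left [IsProbabilityMeasure ν] [IsProbabilityMeasure μ]
    (hF : EssBdd F (μ.prod ν)) : EssBdd (fun y => ∫ x, F (x, y) ∂μ) ν :=
  hF.swap.integral_right

end EssBdd

theorem integral_mono_essBdd {μ : Measure α} [IsFiniteMeasure μ] {f g : α → ℝ}
    (hf : EssBdd f μ) (hg : EssBdd g μ) (h : ∀ᵐ x ∂μ, f x ≤ g x) :
    ∫ x, f x ∂μ ≤ ∫ x, g x ∂μ :=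
  integral_mono_ae hf.integrable hg.integrable h

theorem integral_le_const {μ : Measure α} [IsProbabilityMeasure μ] {f : α → ℝ} {C : ℝ}
    (hf : EssBdd f μ) (h : ∀ᵐ x ∂μ, f x ≤ C) : ∫ x, f x ∂μ ≤ C := by
  simpa using integral_mono_essBdd hf (EssBdd.const C) h

theorem const_le_integral {μ : Measure α} [IsProbabilityMeasure μ] {f : α → ℝ} {C : ℝ}
    (hf : EssBdd f μ) (h : ∀ᵐ x ∂μ, C ≤ f x) : C ≤ ∫ x, f x ∂μ := by
  simpa using integral_mono_essBdd (EssBdd.const C) hf h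

theorem abs_integral_le_const {μ : Measure α} [IsProbabilityMeasure μ] {f : α → ℝ} {C : ℝ}
    (h : ∀ᵐ x ∂μ, |f x| ≤ C) : |∫ x, f x ∂μ| ≤ C := by
  simpa using norm_integral_le_of_norm_le_const (μ := μ) (f := f) (C := C) (by simpa using h)

theorem nonneg_of_ae_abs_le {μ : Measure α} [NeZero μ] {f : α → ℝ} {C : ℝ}
    (h : ∀ᵐ x ∂μ, |f x| ≤ C) : 0 ≤ C := by
  obtain ⟨x, hx⟩ := h.exists
  exact (abs_nonneg _).trans hx

theorem integral_abs_sq_le {μ : Measure α} [IsProbabilityMeasure μ] {f : α → ℝ}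
    (hf : EssBdd f μ) : (∫ x, |f x| ∂μ) ^ 2 ≤ ∫ x, f x ^ 2 ∂μ := by
  set I := ∫ x, |f x| ∂μ
  have h := integral_mono_essBdd ((hf.abs.mul (.const (2 * I))).sub (.const (I ^ 2))) hf.sq
    (ae_of_all _ fun x => by nlinarith [sq_nonneg (|f x| - I), sq_abs (f x)])
  rw [integral_sub (hf.abs.mul (.const _)).integrable (EssBdd.const _).integrable,
    integral_mul_const] at h
  simp at h
  nlinarith

/-- A Pinsker type inequality for a probability density `exp (-u)`. -/
theorem sq_integral_abs_one_sub_exp_neg_le {μ : Measure α} [IsProbabilityMeasure μ] {u : α → ℝ}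
    (hu : EssBdd u μ) (h1 : ∫ x, Real.exp (-u x) ∂μ = 1) :
    (∫ x, |1 - Real.exp (-u x)| ∂μ) ^ 2 ≤ 4 * ∫ x, u x ∂μ := by
  set I := ∫ x, |1 - Real.exp (-u x)| ∂μ
  have hI0 : 0 ≤ I := integral_nonneg fun x => abs_nonneg _
  have key : ∀ ε : ℝ, 0 < ε → I ≤ ε + (∫ x, u x ∂μ) / ε := by
    intro ε hε
    have hA : EssBdd (fun x => ε / 2 * (1 + Real.exp (-u x))) μ :=
      (EssBdd.const _).mul ((EssBdd.const _).add hu.exp_neg)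
    have hB : EssBdd (fun x => Real.exp (-u x) - 1 + u x) μ :=
      (hu.exp_neg.sub (.const 1)).add hu
    have hB' : EssBdd (fun x => (Real.exp (-u x) - 1 + u x) / ε) μ := by
      simpa [div_eq_mul_inv] using hB.mul (.const ε⁻¹)
    have h := integral_mono_essBdd ((EssBdd.const 1).sub hu.exp_neg).abs (hA.add hB')
      (ae_of_all _ fun x => abs_one_sub_exp_neg_le (u x) hε)
    rw [integral_add hA.integrable hB'.integrable, integral_const_mul, integral_div,
      integral_add (EssBdd.const 1).integrable hu.exp_neg.integrable,
      integral_add (hu.exp_neg.sub (.const 1)).integrable hu.integrable,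
      integral_sub hu.exp_neg.integrable (EssBdd.const 1).integrable, h1] at h
    simp at h
    refine h.trans (le_of_eq ?_)
    ring
  rcases hI0.eq_or_lt with h | h
  · have hu0 : 0 ≤ ∫ x, u x ∂μ := by
      have h3 := integral_mono_essBdd ((EssBdd.const 1).sub hu) hu.exp_neg
        (ae_of_all _ fun x => by linarith [Real.add_one_le_exp (-u x)])
      rw [h1, integral_sub (EssBdd.const 1).integrable hu.integrable] at h3
      simp at h3
      linarith
    rw [← h]; simpa using hu0
  -- The choice ε = I/2 leaves I/2 on the left and makes the other term 2∫u / I; it needs I > 0,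
  -- which is why I = 0 is treated apart.
  · have := key (I / 2) (by positivity)
    have h2 : I / 2 ≤ (∫ x, u x ∂μ) / (I / 2) := by linarith
    rw [le_div_iff₀ (by positivity)] at h2
    nlinarith

end EssBdd

/-! ### The energy of a triple of potentials on the plane -/

/-- Standing data in the plane: bounded marginals with mean zero and a bounded cost. -/
structure Setting (μ ν : Measure ℝ) (c : ℝ × ℝ → ℝ) (A B K : ℝ) : Prop where
  left : ∀ᵐ x ∂μ, |x| ≤ A
  right : ∀ᵐ y ∂ν, |y| ≤ B
  meas : AEStronglyMeasurable c (μ.prod ν)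
  cost : ∀ᵐ p ∂(μ.prod ν), |c p| ≤ K
  mean_left : ∫ x, x ∂μ = 0
  mean_right : ∫ y, y ∂ν = 0

/-- The exponent `c + f(x) + g(y) + h(x)(y - x)`. -/
def energy (c : ℝ × ℝ → ℝ) (φ : Potentials) (p : ℝ × ℝ) : ℝ :=
  c p + φ.f p.1 + φ.g p.2 + φ.h p.1 * (p.2 - p.1)

/-- The dual functional in the plane. -/
def planarDual (μ ν : Measure ℝ) (c : ℝ × ℝ → ℝ) (φ : Potentials) : ℝ :=
  -∫ p, Real.exp (-energy c φ p) ∂(μ.prod ν) - ∫ x, φ.f x ∂μ - ∫ y, φ.g y ∂ν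

/-- The induced measure has first marginal `μ` and is a martingale coupling. -/
def XOpt (μ ν : Measure ℝ) (c : ℝ × ℝ → ℝ) (φ : Potentials) : Prop :=
  ∀ᵐ x ∂μ, ∫ y, Real.exp (-energy c φ (x, y)) ∂ν = 1 ∧
    ∫ y, (y - x) * Real.exp (-energy c φ (x, y)) ∂ν = 0

/-- The induced measure has second marginal `ν`. -/
def YOpt (μ ν : Measure ℝ) (c : ℝ × ℝ → ℝ) (φ : Potentials) : Prop :=
  ∀ᵐ y ∂ν, ∫ x, Real.exp (-energy c φ (x, y)) ∂μ = 1

/-- Almost everywhere bounds on the three potentials. -/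
def BoundedBy (μ ν : Measure ℝ) (φ : Potentials) (Cf Cg Ch : ℝ) : Prop :=
  (∀ᵐ x ∂μ, |φ.f x| ≤ Cf) ∧ (∀ᵐ y ∂ν, |φ.g y| ≤ Cg) ∧ (∀ᵐ x ∂μ, |φ.h x| ≤ Ch)

theorem Potentials.bounded_iff {φ : Potentials} {μ ν : Measure ℝ} :
    φ.Bounded μ ν ↔ EssBdd φ.f μ ∧ EssBdd φ.g ν ∧ EssBdd φ.h μ := by
  simp only [Potentials.Bounded, essBdd_iff]

theorem Potentials.Bounded.f_bdd {φ : Potentials} {μ ν : Measure ℝ} (h : φ.Bounded μ ν) :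
    EssBdd φ.f μ := (Potentials.bounded_iff.1 h).1

theorem Potentials.Bounded.g_bdd {φ : Potentials} {μ ν : Measure ℝ} (h : φ.Bounded μ ν) :
    EssBdd φ.g ν := (Potentials.bounded_iff.1 h).2.1

theorem Potentials.Bounded.h_bdd {φ : Potentials} {μ ν : Measure ℝ} (h : φ.Bounded μ ν) :
    EssBdd φ.h μ := (Potentials.bounded_iff.1 h).2.2

theorem Potentials.Bounded.exists_boundedBy {φ : Potentials} {μ ν : Measure ℝ}
    (h : φ.Bounded μ ν) : ∃ C, 0 ≤ C ∧ BoundedBy μ ν φ C C C := by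
  obtain ⟨C1, h1, h1'⟩ := h.f_bdd.exists_nonneg
  obtain ⟨C2, h2, h2'⟩ := h.g_bdd.exists_nonneg
  obtain ⟨C3, h3, h3'⟩ := h.h_bdd.exists_nonneg
  exact ⟨C1 + C2 + C3, by positivity, h1'.mono fun x hx => by linarith,
    h2'.mono fun x hx => by linarith, h3'.mono fun x hx => by linarith⟩

theorem BoundedBy.mono {μ ν : Measure ℝ} {φ : Potentials} {a b d a' b' d' : ℝ}
    (h : BoundedBy μ ν φ a b d) (h1 : a ≤ a') (h2 : b ≤ b') (h3 : d ≤ d') :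
    BoundedBy μ ν φ a' b' d' :=
  ⟨h.1.mono fun _ hx => hx.trans h1, h.2.1.mono fun _ hx => hx.trans h2,
    h.2.2.mono fun _ hx => hx.trans h3⟩

/-! ### Optimality conditions and the gap estimate -/

section Planar

variable {μ ν : Measure ℝ} [IsProbabilityMeasure μ] [IsProbabilityMeasure ν]
  {c : ℝ × ℝ → ℝ} {A B K : ℝ} {φ ψ : Potentials}

theorem ae_prod_of_ae_left {P : ℝ → Prop} (h : ∀ᵐ x ∂μ, P x) :
    ∀ᵐ p : ℝ × ℝ ∂(μ.prod ν), P p.1 := Measure.quasiMeasurePreserving_fst.ae h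

theorem ae_prod_of_ae_right {P : ℝ → Prop} (h : ∀ᵐ y ∂ν, P y) :
    ∀ᵐ p : ℝ × ℝ ∂(μ.prod ν), P p.2 := Measure.quasiMeasurePreserving_snd.ae h

theorem ae_ae_swap {P : ℝ × ℝ → Prop} (h : ∀ᵐ p ∂(μ.prod ν), P p) :
    ∀ᵐ y ∂ν, ∀ᵐ x ∂μ, P (x, y) :=
  Measure.ae_ae_of_ae_prod (Measure.measurePreserving_swap.quasiMeasurePreserving.ae h)

theorem integral_fst_mul_snd (f g : ℝ → ℝ) :
    ∫ p : ℝ × ℝ, f p.1 * g p.2 ∂(μ.prod ν) = (∫ x, f x ∂μ) * ∫ y, g y ∂ν :=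
  integral_prod_mul f g

theorem integral_fst (f : ℝ → ℝ) : ∫ p : ℝ × ℝ, f p.1 ∂(μ.prod ν) = ∫ x, f x ∂μ := by
  simpa using integral_fst_mul_snd (μ := μ) (ν := ν) f (fun _ => 1)

theorem integral_snd (g : ℝ → ℝ) : ∫ p : ℝ × ℝ, g p.2 ∂(μ.prod ν) = ∫ y, g y ∂ν := by
  simpa using integral_fst_mul_snd (μ := μ) (ν := ν) (fun _ => 1) g

namespace Setting

variable (S : Setting μ ν c A B K)
include S

theorem A_nonneg : 0 ≤ A := nonneg_of_ae_abs_le S.left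
theorem B_nonneg : 0 ≤ B := nonneg_of_ae_abs_le S.right
theorem K_nonneg : 0 ≤ K := nonneg_of_ae_abs_le S.cost

theorem id_left : EssBdd (fun x => x) μ := ⟨aestronglyMeasurable_id, A, S.left⟩
theorem id_right : EssBdd (fun y => y) ν := ⟨aestronglyMeasurable_id, B, S.right⟩
theorem cost_bdd : EssBdd c (μ.prod ν) := ⟨S.meas, K, S.cost⟩

theorem diff_bdd : EssBdd (fun p : ℝ × ℝ => p.2 - p.1) (μ.prod ν) :=
  (S.id_right.snd).sub (S.id_left.fst)

theorem diff_le : ∀ᵐ p : ℝ × ℝ ∂(μ.prod ν), |p.2 - p.1| ≤ A + B := by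
  filter_upwards [ae_prod_of_ae_left S.left, ae_prod_of_ae_right S.right] with p h1 h2
  exact (abs_sub _ _).trans (by linarith)

theorem energy_bdd (hφ : φ.Bounded μ ν) : EssBdd (energy c φ) (μ.prod ν) :=
  ((S.cost_bdd.add hφ.f_bdd.fst).add hφ.g_bdd.snd).add (hφ.h_bdd.fst.mul S.diff_bdd)

theorem abs_energy_le {Cf Cg Ch : ℝ} (h : BoundedBy μ ν φ Cf Cg Ch) :
    ∀ᵐ p ∂(μ.prod ν), |energy c φ p| ≤ K + Cf + Cg + Ch * (A + B) := by
  filter_upwards [S.cost, ae_prod_of_ae_left h.1, ae_prod_of_ae_right h.2.1,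
    ae_prod_of_ae_left h.2.2, S.diff_le] with p h1 h2 h3 h4 h5
  have h6 : |φ.h p.1 * (p.2 - p.1)| ≤ Ch * (A + B) := by
    rw [abs_mul]; exact mul_le_mul h4 h5 (abs_nonneg _) ((abs_nonneg _).trans h4)
  unfold energy
  exact (abs_add_le _ _).trans (add_le_add ((abs_add_le _ _).trans
    (add_le_add ((abs_add_le _ _).trans (add_le_add h1 h2)) h3)) h6)

/-- Orthogonality under the product measure: each of the three cross terms contains one of the mean
zero factors γ, η or y. -/
theorem integral_sq_energy_diff {a γ η : ℝ → ℝ} (ha : EssBdd a μ) (hγ : EssBdd γ ν)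
    (hη : EssBdd η μ) (h1 : ∫ y, γ y ∂ν = 0) (h2 : ∫ x, η x ∂μ = 0) :
    ∫ p : ℝ × ℝ, (a p.1 + γ p.2 + η p.1 * p.2) ^ 2 ∂(μ.prod ν) =
      ∫ x, a x ^ 2 ∂μ + ∫ y, γ y ^ 2 ∂ν + (∫ x, η x ^ 2 ∂μ) * ∫ y, y ^ 2 ∂ν := by
  have hy := S.id_right
  have e1 : EssBdd (fun p : ℝ × ℝ => a p.1 ^ 2) (μ.prod ν) := ha.sq.fst
  have e2 : EssBdd (fun p : ℝ × ℝ => γ p.2 ^ 2) (μ.prod ν) := hγ.sq.snd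
  have e3 : EssBdd (fun p : ℝ × ℝ => η p.1 ^ 2 * p.2 ^ 2) (μ.prod ν) := hη.sq.fst.mul hy.sq.snd
  have e4 : EssBdd (fun p : ℝ × ℝ => (2 * a p.1) * γ p.2) (μ.prod ν) :=
    ((EssBdd.const 2).mul ha.fst).mul hγ.snd
  have e5 : EssBdd (fun p : ℝ × ℝ => (2 * a p.1 * η p.1) * p.2) (μ.prod ν) :=
    (((EssBdd.const 2).mul ha.fst).mul hη.fst).mul hy.snd
  have e6 : EssBdd (fun p : ℝ × ℝ => η p.1 * (2 * γ p.2 * p.2)) (μ.prod ν) :=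
    hη.fst.mul (((EssBdd.const 2).mul hγ.snd).mul hy.snd)
  have : (fun p : ℝ × ℝ => (a p.1 + γ p.2 + η p.1 * p.2) ^ 2) = fun p =>
      a p.1 ^ 2 + γ p.2 ^ 2 + η p.1 ^ 2 * p.2 ^ 2 + (2 * a p.1) * γ p.2
        + (2 * a p.1 * η p.1) * p.2 + η p.1 * (2 * γ p.2 * p.2) := by
    ext p; ring
  rw [this, integral_add ((((e1.add e2).add e3).add e4).add e5).integrable e6.integrable,
    integral_add (((e1.add e2).add e3).add e4).integrable e5.integrable,
    integral_add ((e1.add e2).add e3).integrable e4.integrable,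
    integral_add (e1.add e2).integrable e3.integrable,
    integral_add e1.integrable e2.integrable,
    integral_fst (fun x => a x ^ 2), integral_snd (fun y => γ y ^ 2),
    integral_fst_mul_snd (fun x => η x ^ 2) (fun y => y ^ 2),
    integral_fst_mul_snd (fun x => 2 * a x) γ,
    integral_fst_mul_snd (fun x => 2 * a x * η x) (fun y => y),
    integral_fst_mul_snd η (fun y => 2 * γ y * y), h1, h2, S.mean_right]
  ring

/-- Weak form of the first order conditions in (f, h): on each fibre α(x) meets mass one and η(x)
meets the vanishing martingale integral. -/
theorem integral_of_xOpt (hφ : φ.Bounded μ ν) (hx : XOpt μ ν c φ) {α η : ℝ → ℝ}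
    (hα : EssBdd α μ) (hη : EssBdd η μ) :
    ∫ p : ℝ × ℝ, Real.exp (-energy c φ p) * (α p.1 + η p.1 * (p.2 - p.1)) ∂(μ.prod ν) =
      ∫ x, α x ∂μ := by
  have hE := (S.energy_bdd hφ).exp_neg
  have hF := hE.mul (hα.fst.add (hη.fst.mul S.diff_bdd))
  rw [integral_prod _ hF.integrable]
  refine integral_congr_ae ?_
  filter_upwards [hx, hE.sect_right, (S.diff_bdd.mul hE).sect_right] with x h1 h2 h3
  have : (fun y => Real.exp (-energy c φ (x, y)) * (α x + η x * (y - x))) = fun y =>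
      α x * Real.exp (-energy c φ (x, y)) + η x * ((y - x) * Real.exp (-energy c φ (x, y))) := by
    ext y; ring
  simp only [this]
  rw [integral_add (h2.integrable.const_mul _) (h3.integrable.const_mul _), integral_const_mul,
    integral_const_mul, h1.1, h1.2]
  ring

theorem integral_of_yOpt (hφ : φ.Bounded μ ν) (hy : YOpt μ ν c φ) {γ : ℝ → ℝ}
    (hγ : EssBdd γ ν) :
    ∫ p : ℝ × ℝ, Real.exp (-energy c φ p) * γ p.2 ∂(μ.prod ν) = ∫ y, γ y ∂ν := by
  have hE := (S.energy_bdd hφ).exp_neg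
  have hF := hE.mul hγ.snd
  rw [integral_prod_symm _ hF.integrable]
  refine integral_congr_ae ?_
  filter_upwards [hy] with y h1
  rw [integral_mul_const, h1, one_mul]

theorem mass_of_xOpt (hφ : φ.Bounded μ ν) (hx : XOpt μ ν c φ) :
    ∫ p, Real.exp (-energy c φ p) ∂(μ.prod ν) = 1 := by
  simpa using S.integral_of_xOpt hφ hx (EssBdd.const 1) (EssBdd.const 0)

theorem mass_of_yOpt (hφ : φ.Bounded μ ν) (hy : YOpt μ ν c φ) :
    ∫ p, Real.exp (-energy c φ p) ∂(μ.prod ν) = 1 := by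
  simpa using S.integral_of_yOpt hφ hy (EssBdd.const 1)

/-- Concavity of the dual functional: comparison with its linearization at `φ`. -/
theorem planarDual_le_tangent (hφ : φ.Bounded μ ν) (hψ : ψ.Bounded μ ν) :
    planarDual μ ν c ψ ≤ planarDual μ ν c φ +
      (∫ p, Real.exp (-energy c φ p) * (energy c ψ p - energy c φ p) ∂(μ.prod ν)
        - (∫ x, ψ.f x ∂μ - ∫ x, φ.f x ∂μ) - (∫ y, ψ.g y ∂ν - ∫ y, φ.g y ∂ν)) := by
  have h1 := S.energy_bdd hφ
  have h2 := S.energy_bdd hψ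
  have h3 := integral_mono_essBdd (h1.exp_neg.sub (h1.exp_neg.mul (h2.sub h1))) h2.exp_neg
    (ae_of_all _ fun p => exp_neg_tangent (energy c φ p) (energy c ψ p))
  rw [integral_sub h1.exp_neg.integrable (h1.exp_neg.mul (h2.sub h1)).integrable] at h3
  unfold planarDual
  linarith

/-- A triple that is optimal in `(f, h)` given `g`. -/
theorem planarDual_le_of_xOpt (hφ : φ.Bounded μ ν) (hψ : ψ.Bounded μ ν) (hx : XOpt μ ν c φ)
    (hg : ψ.g = φ.g) : planarDual μ ν c ψ ≤ planarDual μ ν c φ := by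
  have h := S.planarDual_le_tangent hφ hψ
  have e : ∀ p : ℝ × ℝ, energy c ψ p - energy c φ p =
      (ψ.f p.1 - φ.f p.1) + (ψ.h p.1 - φ.h p.1) * (p.2 - p.1) := fun p => by
    simp only [energy, hg]; ring
  simp only [e] at h
  rw [S.integral_of_xOpt hφ hx (hψ.f_bdd.sub hφ.f_bdd) (hψ.h_bdd.sub hφ.h_bdd),
    integral_sub hψ.f_bdd.integrable hφ.f_bdd.integrable, hg] at h
  linarith

/-- A triple that is optimal in all variables. -/
theorem planarDual_le_of_opt (hφ : φ.Bounded μ ν) (hψ : ψ.Bounded μ ν) (hx : XOpt μ ν c φ)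
    (hy : YOpt μ ν c φ) : planarDual μ ν c ψ ≤ planarDual μ ν c φ := by
  have h := S.planarDual_le_tangent hφ hψ
  have hE := (S.energy_bdd hφ).exp_neg
  have hα := hψ.f_bdd.sub hφ.f_bdd
  have hη := hψ.h_bdd.sub hφ.h_bdd
  have hγ := hψ.g_bdd.sub hφ.g_bdd
  have e : ∀ p : ℝ × ℝ, Real.exp (-energy c φ p) * (energy c ψ p - energy c φ p) =
      Real.exp (-energy c φ p) *
        ((ψ.f p.1 - φ.f p.1) + (ψ.h p.1 - φ.h p.1) * (p.2 - p.1)) +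
      Real.exp (-energy c φ p) * (ψ.g p.2 - φ.g p.2) := fun p => by
    simp only [energy]; ring
  simp only [e] at h
  rw [integral_add (hE.mul (hα.fst.add (hη.fst.mul S.diff_bdd))).integrable
      (hE.mul hγ.snd).integrable,
    S.integral_of_xOpt hφ hx hα hη, S.integral_of_yOpt hφ hy hγ,
    integral_sub hψ.f_bdd.integrable hφ.f_bdd.integrable,
    integral_sub hψ.g_bdd.integrable hφ.g_bdd.integrable] at h
  linarith

omit S in
theorem energy_withG (φ : Potentials) (g : ℝ → ℝ) (p : ℝ × ℝ) :
    energy c ⟨φ.f, g, φ.h⟩ p = energy c φ p + (g p.2 - φ.g p.2) := by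
  simp only [energy]; ring

omit S in
theorem bounded_withG (hφ : φ.Bounded μ ν) {g : ℝ → ℝ} (hg : EssBdd g ν) :
    (⟨φ.f, g, φ.h⟩ : Potentials).Bounded μ ν :=
  Potentials.bounded_iff.2 ⟨hφ.f_bdd, hg, hφ.h_bdd⟩

/-- Gain of the update of `g`. -/
theorem planarDual_sub_of_yOpt (hφ : φ.Bounded μ ν) {g : ℝ → ℝ} (hg : EssBdd g ν)
    (hy : YOpt μ ν c φ) (hx : XOpt μ ν c ⟨φ.f, g, φ.h⟩) :
    planarDual μ ν c φ - planarDual μ ν c ⟨φ.f, g, φ.h⟩ = ∫ y, (g y - φ.g y) ∂ν := by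
  rw [planarDual, planarDual, S.mass_of_yOpt hφ hy, S.mass_of_xOpt (bounded_withG hφ hg) hx,
    integral_sub hg.integrable hφ.g_bdd.integrable]
  ring

/-- The function exp(-(g - φ.g)) is the density with respect to ν of the second marginal of the
half-step triple, because changing g multiplies exp(-W) by it and `YOpt` makes the second marginal
of φ equal to ν. With `planarDual_sub_of_yOpt`, the gain of the g update is therefore the entropy of
ν relative to that marginal. -/
theorem integral_density_of_opt (hφ : φ.Bounded μ ν) {g : ℝ → ℝ} (hg : EssBdd g ν)
    (hy : YOpt μ ν c φ) (hx : XOpt μ ν c ⟨φ.f, g, φ.h⟩) :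
    ∫ y, Real.exp (-(g y - φ.g y)) ∂ν = 1 := by
  rw [← S.mass_of_xOpt (bounded_withG hφ hg) hx,
    ← S.integral_of_yOpt hφ hy (hg.sub hφ.g_bdd).exp_neg]
  refine integral_congr_ae (ae_of_all _ fun p => ?_)
  dsimp only
  rw [energy_withG φ g p, ← Real.exp_add]; congr 1; ring

/-- Polyak-Łojasiewicz type estimate: after a full step the gap to any normalized triple is
controlled by the gain `∫ (g - φ.g) dν` of the step. -/
theorem planarDual_gap_le (hφ : φ.Bounded μ ν) (hψ : ψ.Bounded μ ν)
    (nφ : φ.Normalized μ ν) (nψ : ψ.Normalized μ ν) {Cf Cg Ch v : ℝ}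
    (bφ : BoundedBy μ ν φ Cf Cg Ch) (bψ : BoundedBy μ ν ψ Cf Cg Ch) (hv : 0 < v)
    (hvar : v ≤ ∫ y, y ^ 2 ∂ν) {g : ℝ → ℝ} (hg : EssBdd g ν)
    (hy : YOpt μ ν c φ) (hx : XOpt μ ν c ⟨φ.f, g, φ.h⟩) {M : ℝ}
    (hM : M = Real.exp (K + Cf + Cg + Ch * (A + B))) :
    planarDual μ ν c ψ - planarDual μ ν c φ + 1 / (4 * M) *
      (∫ x, (ψ.f x - φ.f x - x * (ψ.h x - φ.h x)) ^ 2 ∂μ + ∫ y, (ψ.g y - φ.g y) ^ 2 ∂ν +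
        v * ∫ x, (ψ.h x - φ.h x) ^ 2 ∂μ) ≤
      4 * M ^ 3 * (1 + B ^ 2 / v) * ∫ y, (g y - φ.g y) ∂ν := by
  have hM0 : 0 < M := hM ▸ Real.exp_pos _
  have hMi : M⁻¹ = Real.exp (-(K + Cf + Cg + Ch * (A + B))) := by rw [hM, Real.exp_neg]
  have hW := S.energy_bdd hφ
  have hV := S.energy_bdd hψ
  have hgφ := hg.sub hφ.g_bdd
  set I := ∫ y, |1 - Real.exp (-(g y - φ.g y))| ∂ν with hI
  have hI0 : 0 ≤ I := integral_nonneg fun x => abs_nonneg _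
  have hI2 : I ^ 2 ≤ 4 * ∫ y, (g y - φ.g y) ∂ν :=
    sq_integral_abs_one_sub_exp_neg_le hgφ (S.integral_density_of_opt hφ hg hy hx)
  -- the differences of the potentials
  set α : ℝ → ℝ := fun x => ψ.f x - φ.f x with hα'
  set η : ℝ → ℝ := fun x => ψ.h x - φ.h x with hη'
  set γ : ℝ → ℝ := fun y => ψ.g y - φ.g y with hγ'
  set a : ℝ → ℝ := fun x => α x - x * η x with ha'
  have hα : EssBdd α μ := hψ.f_bdd.sub hφ.f_bdd
  have hη : EssBdd η μ := hψ.h_bdd.sub hφ.h_bdd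
  have hγ : EssBdd γ ν := hψ.g_bdd.sub hφ.g_bdd
  have ha : EssBdd a μ := hα.sub (S.id_left.mul hη)
  have hδ : ∀ p, energy c ψ p - energy c φ p = a p.1 + γ p.2 + η p.1 * p.2 := fun p => by
    simp only [energy, a, α, η, γ]; ring
  have hγ0 : ∫ y, γ y ∂ν = 0 := by
    rw [integral_sub hψ.g_bdd.integrable hφ.g_bdd.integrable, nφ.1, nψ.1, sub_zero]
  have hη0 : ∫ x, η x ∂μ = 0 := by
    rw [integral_sub hψ.h_bdd.integrable hφ.h_bdd.integrable, nφ.2, nψ.2, sub_zero]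
  have hbd : ∀ᵐ p ∂(μ.prod ν), Real.exp (-energy c φ p) ≤ M ∧ M⁻¹ ≤ Real.exp (-energy c φ p) ∧
      M⁻¹ ≤ Real.exp (-energy c ψ p) := by
    filter_upwards [S.abs_energy_le bφ, S.abs_energy_le bψ] with p h1 h2
    rw [hMi, hM]
    rw [abs_le] at h1 h2
    refine ⟨?_, ?_, ?_⟩ <;> apply Real.exp_le_exp.2 <;> linarith
  -- strong concavity
  have hT := integral_mono_essBdd
    ((hW.exp_neg.sub (hW.exp_neg.mul (hV.sub hW))).add ((EssBdd.const (M⁻¹ / 2)).mul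
      (hV.sub hW).sq)) hV.exp_neg
    (hbd.mono fun p hp => exp_neg_second_order hp.2.1 hp.2.2)
  rw [integral_add (hW.exp_neg.sub (hW.exp_neg.mul (hV.sub hW))).integrable
      ((EssBdd.const (M⁻¹ / 2)).mul (hV.sub hW).sq).integrable,
    integral_sub hW.exp_neg.integrable (hW.exp_neg.mul (hV.sub hW)).integrable,
    integral_const_mul] at hT
  have hsq : ∫ p, (energy c ψ p - energy c φ p) ^ 2 ∂(μ.prod ν) =
      ∫ x, a x ^ 2 ∂μ + ∫ y, γ y ^ 2 ∂ν + (∫ x, η x ^ 2 ∂μ) * ∫ y, y ^ 2 ∂ν := by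
    simp only [hδ]
    exact S.integral_sq_energy_diff ha hγ hη hγ0 hη0
  -- the linear term
  have hQ := S.energy_bdd (bounded_withG hφ hg)
  have hL1 : EssBdd (fun p : ℝ × ℝ => α p.1 + η p.1 * (p.2 - p.1)) (μ.prod ν) :=
    hα.fst.add (hη.fst.mul S.diff_bdd)
  -- The g part of the gradient vanishes at φ and the (f, h) part vanishes at the half-step triple,
  -- so apart from the marginal terms only the difference of the two densities is left.
  have hlin : ∫ p, Real.exp (-energy c φ p) * (energy c ψ p - energy c φ p) ∂(μ.prod ν) =
      ∫ p : ℝ × ℝ, (Real.exp (-energy c φ p) - Real.exp (-energy c ⟨φ.f, g, φ.h⟩ p)) *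
        (α p.1 + η p.1 * (p.2 - p.1)) ∂(μ.prod ν) + ∫ x, α x ∂μ + ∫ y, γ y ∂ν := by
    rw [← S.integral_of_yOpt hφ hy hγ,
      ← S.integral_of_xOpt (bounded_withG hφ hg) hx hα hη,
      ← integral_add ((hW.exp_neg.sub hQ.exp_neg).mul hL1).integrable
        (hQ.exp_neg.mul hL1).integrable,
      ← integral_add (((hW.exp_neg.sub hQ.exp_neg).mul hL1).add (hQ.exp_neg.mul hL1)).integrable
        (hW.exp_neg.mul hγ.snd).integrable]
    refine integral_congr_ae (ae_of_all _ fun p => ?_)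
    simp only [hδ, a]
    ring
  -- The bound is a product of a function of x and a function of y, so its integral factors and the
  -- second factor is the L¹ distance I.
  have hbound : ∫ p : ℝ × ℝ, (Real.exp (-energy c φ p) - Real.exp (-energy c ⟨φ.f, g, φ.h⟩ p)) *
        (α p.1 + η p.1 * (p.2 - p.1)) ∂(μ.prod ν) ≤
      ∫ p : ℝ × ℝ, (M * (|a p.1| + B * |η p.1|)) * |1 - Real.exp (-(g p.2 - φ.g p.2))|
        ∂(μ.prod ν) := by
    refine integral_mono_essBdd ((hW.exp_neg.sub hQ.exp_neg).mul hL1)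
      (((EssBdd.const M).mul (ha.abs.fst.add ((EssBdd.const B).mul hη.abs.fst))).mul
        ((EssBdd.const 1).sub hgφ.exp_neg).abs.snd) ?_
    filter_upwards [hbd, ae_prod_of_ae_right S.right] with p h1 h2
    have e1 : Real.exp (-energy c φ p) - Real.exp (-energy c ⟨φ.f, g, φ.h⟩ p) =
        Real.exp (-energy c φ p) * (1 - Real.exp (-(g p.2 - φ.g p.2))) := by
      rw [energy_withG φ g p, mul_sub, ← Real.exp_add, mul_one, ← neg_add]
    have e2 : α p.1 + η p.1 * (p.2 - p.1) = a p.1 + η p.1 * p.2 := by simp only [a]; ring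
    rw [e1, e2]
    refine (le_abs_self _).trans ?_
    rw [abs_mul, abs_mul, abs_of_pos (Real.exp_pos _)]
    have h3 : |a p.1 + η p.1 * p.2| ≤ |a p.1| + B * |η p.1| := by
      refine (abs_add_le _ _).trans ?_
      rw [abs_mul, mul_comm]
      gcongr
    calc _ ≤ M * |1 - Real.exp (-(g p.2 - φ.g p.2))| * (|a p.1| + B * |η p.1|) := by
          gcongr; exact h1.1
      _ = _ := by ring
  rw [integral_fst_mul_snd (fun x => M * (|a x| + B * |η x|))
    (fun y => |1 - Real.exp (-(g y - φ.g y))|), ← hI, ← integral_mul_const] at hbound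
  -- The weights 1/(4M) and v/(4M) use up half of the strong concavity constant 1/(2M); the other
  -- half stays as the squared distance in the conclusion.
  have hyoung : ∫ x, M * (|a x| + B * |η x|) * I ∂μ ≤
      ∫ x, (1 / (4 * M) * a x ^ 2 + v / (4 * M) * η x ^ 2 + M ^ 3 * (1 + B ^ 2 / v) * I ^ 2) ∂μ := by
    refine integral_mono_essBdd (((EssBdd.const M).mul
      (ha.abs.add ((EssBdd.const B).mul hη.abs))).mul (EssBdd.const I))
      ((((EssBdd.const _).mul ha.sq).add ((EssBdd.const _).mul hη.sq)).add (EssBdd.const _))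
      (ae_of_all _ fun x => ?_)
    rw [← sub_nonneg]
    have : 1 / (4 * M) * a x ^ 2 + v / (4 * M) * η x ^ 2 + M ^ 3 * (1 + B ^ 2 / v) * I ^ 2 -
        M * (|a x| + B * |η x|) * I =
        1 / (4 * M) * (|a x| - 2 * M ^ 2 * I) ^ 2 +
          v / (4 * M) * (|η x| - 2 * M ^ 2 * B * I / v) ^ 2 := by
      rw [← sq_abs (a x), ← sq_abs (η x)]
      field_simp
      ring
    rw [this]
    positivity
  rw [integral_add (((EssBdd.const _).mul ha.sq).add ((EssBdd.const _).mul hη.sq)).integrable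
      (EssBdd.const _).integrable, integral_add ((EssBdd.const _).mul ha.sq).integrable
      ((EssBdd.const _).mul hη.sq).integrable, integral_const_mul, integral_const_mul] at hyoung
  simp only [integral_const, probReal_univ, smul_eq_mul, one_mul] at hyoung
  have hA0 : 0 ≤ ∫ x, a x ^ 2 ∂μ := integral_nonneg fun x => sq_nonneg _
  have hH0 : 0 ≤ ∫ x, η x ^ 2 ∂μ := integral_nonneg fun x => sq_nonneg _
  have hG0 : 0 ≤ ∫ x, γ x ^ 2 ∂ν := integral_nonneg fun x => sq_nonneg _
  have hfin : M ^ 3 * (1 + B ^ 2 / v) * I ^ 2 ≤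
      4 * M ^ 3 * (1 + B ^ 2 / v) * ∫ y, (g y - φ.g y) ∂ν := by
    calc _ ≤ M ^ 3 * (1 + B ^ 2 / v) * (4 * ∫ y, (g y - φ.g y) ∂ν) := by gcongr
      _ = _ := by ring
  have e3 : ∫ x, ψ.f x ∂μ - ∫ x, φ.f x ∂μ = ∫ x, α x ∂μ :=
    (integral_sub hψ.f_bdd.integrable hφ.f_bdd.integrable).symm
  have e4 : ∫ x, ψ.g x ∂ν - ∫ x, φ.g x ∂ν = ∫ x, γ x ∂ν :=
    (integral_sub hψ.g_bdd.integrable hφ.g_bdd.integrable).symm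
  have e5 : M⁻¹ / 2 = 2 * (1 / (4 * M)) := by field_simp; norm_num
  have e6 : v / (4 * M) = 1 / (4 * M) * v := by ring
  rw [hsq, hlin, e5] at hT
  rw [e6] at hyoung
  have hk : 0 ≤ 1 / (4 * M) := by positivity
  have q1 : 1 / (4 * M) * v * ∫ x, η x ^ 2 ∂μ ≤
      1 / (4 * M) * ((∫ x, η x ^ 2 ∂μ) * ∫ y, y ^ 2 ∂ν) := by
    rw [mul_assoc, mul_comm v]; gcongr
  have q2 : 0 ≤ 1 / (4 * M) * ((∫ x, η x ^ 2 ∂μ) * ∫ y, y ^ 2 ∂ν) :=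
    mul_nonneg hk (mul_nonneg hH0 (hv.le.trans hvar))
  have q3 := mul_nonneg hk hA0
  have q4 := mul_nonneg hk hG0
  have goal_eq : planarDual μ ν c ψ - planarDual μ ν c φ =
      -(∫ p, Real.exp (-energy c ψ p) ∂(μ.prod ν) - ∫ p, Real.exp (-energy c φ p) ∂(μ.prod ν))
        - ∫ x, α x ∂μ - ∫ x, γ x ∂ν := by
    rw [← e3, ← e4]; unfold planarDual; ring
  rw [goal_eq]
  change _ + 1 / (4 * M) * (∫ x, a x ^ 2 ∂μ + ∫ y, γ y ^ 2 ∂ν + v * ∫ x, η x ^ 2 ∂μ) ≤ _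
  rw [mul_add, mul_add, ← mul_assoc]
  rw [mul_add, mul_add, mul_assoc 2, mul_assoc 2, mul_assoc 2] at hT
  linarith

end Setting

end Planar

/-! ### Normalization and the Sinkhorn step -/

/-- `χ` is the result of one step, before normalization, started from the potential `g`. -/
structure IsRawStep (μ ν : Measure ℝ) (c : ℝ × ℝ → ℝ) (g : ℝ → ℝ) (χ : Potentials) : Prop where
  bounded : χ.Bounded μ ν
  xOpt : XOpt μ ν c ⟨χ.f, g, χ.h⟩
  yOpt : YOpt μ ν c χ

section Step

variable {μ ν : Measure ℝ} [IsProbabilityMeasure μ] [IsProbabilityMeasure ν]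
  {c : ℝ × ℝ → ℝ} {A B K : ℝ} {φ ψ χ : Potentials}

theorem energy_normalize (φ : Potentials) : energy c (normalize μ ν φ) = energy c φ := by
  ext p
  simp only [energy, normalize]
  ring

theorem yOpt_normalize (h : YOpt μ ν c φ) : YOpt μ ν c (normalize μ ν φ) := by
  unfold YOpt
  rw [energy_normalize]
  exact h

namespace Setting

variable (S : Setting μ ν c A B K)
include S

theorem bounded_normalize (hφ : φ.Bounded μ ν) : (normalize μ ν φ).Bounded μ ν :=
  Potentials.bounded_iff.2
    ⟨(hφ.f_bdd.add (.const _)).sub ((EssBdd.const _).mul S.id_left),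
      (hφ.g_bdd.sub (.const _)).add ((EssBdd.const _).mul S.id_right), hφ.h_bdd.sub (.const _)⟩

theorem normalized_normalize (hφ : φ.Bounded μ ν) : (normalize μ ν φ).Normalized μ ν := by
  constructor
  · simp only [normalize]
    rw [integral_add (hφ.g_bdd.sub (.const _)).integrable
        ((EssBdd.const _).mul S.id_right).integrable,
      integral_sub hφ.g_bdd.integrable (EssBdd.const _).integrable, integral_const_mul,
      S.mean_right]
    simp
  · simp only [normalize]
    rw [integral_sub hφ.h_bdd.integrable (EssBdd.const _).integrable]
    simp

theorem planarDual_normalize (hφ : φ.Bounded μ ν) :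
    planarDual μ ν c (normalize μ ν φ) = planarDual μ ν c φ := by
  have h1 := (S.normalized_normalize hφ).1
  unfold planarDual
  rw [energy_normalize, h1]
  simp only [normalize]
  rw [integral_sub (hφ.f_bdd.add (.const _)).integrable
      ((EssBdd.const _).mul S.id_left).integrable,
    integral_add hφ.f_bdd.integrable (EssBdd.const _).integrable, integral_const_mul, S.mean_left]
  simp
  ring

/-- The potential `g` of the half-step that corresponds to the normalized triple. -/
def halfG (μ ν : Measure ℝ) (χ : Potentials) (g : ℝ → ℝ) (y : ℝ) : ℝ :=
  g y - ∫ t, χ.g t ∂ν + (∫ t, χ.h t ∂μ) * y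

theorem halfG_bdd {g : ℝ → ℝ} (hg : EssBdd g ν) : EssBdd (halfG μ ν χ g) ν :=
  (hg.sub (.const _)).add ((EssBdd.const _).mul S.id_right)

omit S in
theorem xOpt_normalize {g : ℝ → ℝ} (h : XOpt μ ν c ⟨χ.f, g, χ.h⟩) :
    XOpt μ ν c ⟨(normalize μ ν χ).f, halfG μ ν χ g, (normalize μ ν χ).h⟩ := by
  have : energy c ⟨(normalize μ ν χ).f, halfG μ ν χ g, (normalize μ ν χ).h⟩ =
      energy c ⟨χ.f, g, χ.h⟩ := by
    ext p
    simp only [energy, normalize, halfG]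
    ring
  unfold XOpt
  rw [this]
  exact h

/-- Gain of a full step. -/
theorem planarDual_step_gain {g : ℝ → ℝ} (hg : EssBdd g ν) (hχ : IsRawStep μ ν c g χ) :
    planarDual μ ν c (normalize μ ν χ) - planarDual μ ν c ⟨χ.f, g, χ.h⟩ =
      ∫ y, (halfG μ ν χ g y - (normalize μ ν χ).g y) ∂ν := by
  rw [S.planarDual_normalize hχ.bounded,
    S.planarDual_sub_of_yOpt hχ.bounded hg hχ.yOpt hχ.xOpt]
  refine integral_congr_ae (ae_of_all _ fun y => ?_)
  simp only [halfG, normalize]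
  ring

/-- Gain of a full step compared to the triple from which it starts. -/
theorem gain_le (hφ : φ.Bounded μ ν) (hχ : IsRawStep μ ν c φ.g χ) :
    ∫ y, (halfG μ ν χ φ.g y - (normalize μ ν χ).g y) ∂ν ≤
      planarDual μ ν c (normalize μ ν χ) - planarDual μ ν c φ := by
  rw [← S.planarDual_step_gain hφ.g_bdd hχ]
  have := S.planarDual_le_of_xOpt (bounded_withG hχ.bounded hφ.g_bdd) hφ hχ.xOpt rfl
  linarith

theorem gain_nonneg {g : ℝ → ℝ} (hg : EssBdd g ν) (hχ : IsRawStep μ ν c g χ) :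
    0 ≤ ∫ y, (halfG μ ν χ g y - (normalize μ ν χ).g y) ∂ν := by
  have h := sq_integral_abs_one_sub_exp_neg_le
    ((S.halfG_bdd hg).sub (S.bounded_normalize hχ.bounded).g_bdd)
    (S.integral_density_of_opt (S.bounded_normalize hχ.bounded) (S.halfG_bdd hg)
      (yOpt_normalize hχ.yOpt) (xOpt_normalize hχ.xOpt))
  nlinarith [sq_nonneg (∫ y, |1 - Real.exp (-(halfG μ ν χ g y - (normalize μ ν χ).g y))| ∂ν)]

/-! ### Bounds for one step -/

/-- The martingale equation at `t` has the strict sign of `-t` for large `|t|`. -/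
theorem mul_integral_root_le {x t C₁ N b : ℝ} {g : ℝ → ℝ} (hx : |x| ≤ A)
    (hc : EssBdd (fun y => c (x, y)) ν) (hcK : ∀ᵐ y ∂ν, |c (x, y)| ≤ K) (hg : EssBdd g ν)
    (hg1 : ∀ᵐ y ∂ν, -C₁ ≤ g y) (hgN : ∫ y, |g y| ∂ν ≤ N)
    (hb1 : b ≤ ∫ y, min (y - x) 0 ^ 2 ∂ν) (hb2 : b ≤ ∫ y, max (y - x) 0 ^ 2 ∂ν) :
    t * ∫ y, (y - x) * Real.exp (-(c (x, y) + g y + t * (y - x))) ∂ν ≤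
      Real.exp (K + C₁) + |t| * (A + B) * (K + N) - b * t ^ 2 := by
  have hK := S.K_nonneg
  have hd : EssBdd (fun y => y - x) ν := S.id_right.sub (.const x)
  have hmin : EssBdd (fun y => min (y - x) 0) ν := by
    have : (fun y => min (y - x) 0) = fun y => ((y - x) - |y - x|) * (1 / 2) := by
      ext y
      rcases le_total (y - x) 0 with h | h
      · rw [min_eq_left h, abs_of_nonpos h]; ring
      · rw [min_eq_right h, abs_of_nonneg h]; ring
    rw [this]; exact (hd.sub hd.abs).mul (.const _)
  have hmax : EssBdd (fun y => max (y - x) 0) ν := by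
    have : (fun y => max (y - x) 0) = fun y => ((y - x) + |y - x|) * (1 / 2) := by
      ext y
      rcases le_total (y - x) 0 with h | h
      · rw [max_eq_right h, abs_of_nonpos h]; ring
      · rw [max_eq_left h, abs_of_nonneg h]; ring
    rw [this]; exact (hd.add hd.abs).mul (.const _)
  -- The quadratic decay in t comes from the points with t(y - x) < 0: those left of x when t is
  -- positive, right of x when t is negative. This is why mass is required on both sides.
  have hsc : (fun y => min (t * (y - x)) 0 ^ 2) =
      fun y => t ^ 2 * (if 0 ≤ t then min (y - x) 0 else max (y - x) 0) ^ 2 := by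
    ext y
    split_ifs with ht
    · rw [← mul_pow, mul_min_of_nonneg _ _ ht, mul_zero]
    · push Not at ht
      rw [← mul_pow]
      rcases le_total (y - x) 0 with h | h
      · rw [max_eq_right h, min_eq_right (mul_nonneg_of_nonpos_of_nonpos ht.le h), mul_zero]
      · rw [max_eq_left h, min_eq_left (mul_nonpos_of_nonpos_of_nonneg ht.le h)]
  have hneg : EssBdd (fun y => min (t * (y - x)) 0 ^ 2) ν := by
    rw [hsc]
    split_ifs
    · exact (EssBdd.const _).mul hmin.sq
    · exact (EssBdd.const _).mul hmax.sq
  have hbt : b * t ^ 2 ≤ ∫ y, min (t * (y - x)) 0 ^ 2 ∂ν := by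
    rw [hsc]
    split_ifs
    · rw [integral_const_mul, mul_comm]; gcongr
    · rw [integral_const_mul, mul_comm]; gcongr
  have hE : EssBdd (fun y => (y - x) * Real.exp (-(c (x, y) + g y + t * (y - x)))) ν :=
    hd.mul ((hc.add hg).add ((EssBdd.const t).mul hd)).exp_neg
  have hR : EssBdd (fun y => |t| * (A + B) * (K + |g y|)) ν :=
    (EssBdd.const _).mul ((EssBdd.const _).add hg.abs)
  have key := integral_mono_essBdd ((EssBdd.const t).mul hE)
    (((EssBdd.const (Real.exp (K + C₁))).add hR).sub hneg) (by
      filter_upwards [hcK, hg1, S.right] with y h1 h2 h3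
      have hdist : |y - x| ≤ A + B := (abs_sub _ _).trans (by linarith)
      have hts : |t * (y - x)| ≤ |t| * (A + B) := by rw [abs_mul]; gcongr
      have hr : 0 ≤ |t| * (A + B) * (K + |g y|) :=
        mul_nonneg ((abs_nonneg _).trans hts) (by positivity)
      rw [abs_le] at h1
      set s := t * (y - x) with hs
      have e0 : t * ((y - x) * Real.exp (-(c (x, y) + g y + s))) =
          s * Real.exp (-(c (x, y) + g y + s)) := by rw [hs]; ring
      rw [e0]
      -- For s ≥ 0, s exp(-s) ≤ 1 and only the lower bound of g enters. For s ≤ 0, exp u ≥ u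
      -- produces the term -s² and an error linear in |g|, so an L¹ bound of g suffices after
      -- integration.
      rcases le_total 0 s with h | h
      · rw [min_eq_right h]
        have e1 : s * Real.exp (-(c (x, y) + g y + s)) =
            Real.exp (-(c (x, y) + g y)) * (s * Real.exp (-s)) := by
          rw [neg_add, Real.exp_add]; ring
        have e2 : s * Real.exp (-s) ≤ 1 := by
          have := Real.add_one_le_exp s
          calc s * Real.exp (-s) ≤ Real.exp s * Real.exp (-s) := by gcongr; linarith
            _ = 1 := by rw [← Real.exp_add]; simp
        have e3 : Real.exp (-(c (x, y) + g y)) ≤ Real.exp (K + C₁) :=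
          Real.exp_le_exp.2 (by linarith)
        have e4 : Real.exp (-(c (x, y) + g y)) * (s * Real.exp (-s)) ≤
            Real.exp (-(c (x, y) + g y)) * 1 := by gcongr
        rw [e1]
        linarith
      · rw [min_eq_left h]
        have e1 := Real.add_one_le_exp (-(c (x, y) + g y + s))
        have e2 : s * Real.exp (-(c (x, y) + g y + s)) ≤ s * -(c (x, y) + g y + s) :=
          mul_le_mul_of_nonpos_left (by linarith) h
        have e3 : s * -(c (x, y) + g y) ≤ |t| * (A + B) * (K + |g y|) := by
          refine (le_abs_self _).trans ?_
          rw [abs_mul, abs_neg]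
          have : |c (x, y) + g y| ≤ K + |g y| :=
            (abs_add_le _ _).trans (by gcongr; exact abs_le.2 h1)
          exact mul_le_mul hts this (abs_nonneg _) ((abs_nonneg _).trans hts)
        have := Real.exp_pos (K + C₁)
        nlinarith)
  rw [integral_const_mul, integral_sub ((EssBdd.const _).add hR).integrable hneg.integrable,
    integral_add (EssBdd.const _).integrable hR.integrable, integral_const_mul,
    integral_add (EssBdd.const _).integrable hg.abs.integrable] at key
  simp only [integral_const, probReal_univ, smul_eq_mul, one_mul] at key
  have : |t| * (A + B) * (K + ∫ y, |g y| ∂ν) ≤ |t| * (A + B) * (K + N) := by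
    have := S.A_nonneg
    have := S.B_nonneg
    gcongr
  linarith

/-- The bound for the roots of the martingale equation. -/
def rootBound (A B K b C₁ N : ℝ) : ℝ := (Real.exp (K + C₁) + (A + B) * (K + N)) / b + 1

theorem one_le_rootBound {b C₁ N : ℝ} (hb : 0 < b) (hN : 0 ≤ N) :
    1 ≤ rootBound A B K b C₁ N := by
  have := S.A_nonneg
  have := S.B_nonneg
  have := S.K_nonneg
  have : 0 ≤ (Real.exp (K + C₁) + (A + B) * (K + N)) / b := by positivity
  unfold rootBound; linarith

/-- The summand 1 in `rootBound` gives |t| ≥ 1, so the constant exponential term is absorbed by a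
multiple of |t|; it also leaves -b|t|, which makes the inequality strict. -/
theorem root_sign_aux {t b C₁ N : ℝ} (hb : 0 < b) (hN : 0 ≤ N)
    (ht : rootBound A B K b C₁ N ≤ |t|) :
    Real.exp (K + C₁) + |t| * (A + B) * (K + N) - b * t ^ 2 < 0 := by
  have h1 := S.one_le_rootBound (C₁ := C₁) hb hN
  have h2 : b * rootBound A B K b C₁ N = Real.exp (K + C₁) + (A + B) * (K + N) + b := by
    unfold rootBound; field_simp
  have h3 : b * rootBound A B K b C₁ N * |t| ≤ b * |t| * |t| := by
    rw [mul_right_comm]; gcongr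
  rw [h2] at h3
  have h4 := Real.exp_pos (K + C₁)
  have h5 : 1 ≤ |t| := h1.trans ht
  have h6 : b * |t| * |t| = b * t ^ 2 := by rw [mul_assoc, ← pow_two, sq_abs]
  nlinarith

/-- Lower bounds for the second moments of the two sides of `ν` seen from `x`. -/
def TwoSided (μ ν : Measure ℝ) (b : ℝ) : Prop :=
  ∀ᵐ x ∂μ, b ≤ ∫ y, min (y - x) 0 ^ 2 ∂ν ∧ b ≤ ∫ y, max (y - x) 0 ^ 2 ∂ν

/-- From the previous g only a pointwise lower bound and an L¹ bound are used, as these are what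
coercivity provides. A root h(x) beyond `rootBound` would contradict the sign of the martingale
integral; unit mass on each x fibre then bounds f, and unit mass on each y fibre bounds the new g.
-/
theorem rawStep_boundedBy {b C₁ N : ℝ} (hb : 0 < b) (hN : 0 ≤ N) (hC : 0 ≤ C₁)
    (hbb : TwoSided μ ν b) {g : ℝ → ℝ} (hg : EssBdd g ν)
    (hg1 : ∀ᵐ y ∂ν, -C₁ ≤ g y) (hgN : ∫ y, |g y| ∂ν ≤ N) (hχ : IsRawStep μ ν c g χ) :
    ∃ T F G, T = rootBound A B K b C₁ N ∧ F = K + C₁ + N + T * (A + B) ∧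
      G = K + F + T * (A + B) ∧ BoundedBy μ ν χ F G T := by
  refine ⟨_, _, _, rfl, rfl, rfl, ?_⟩
  set T := rootBound A B K b C₁ N with hT
  set F := K + C₁ + N + T * (A + B) with hF
  have hK := S.K_nonneg
  have hT1 := S.one_le_rootBound (C₁ := C₁) hb hN
  have hh : ∀ᵐ x ∂μ, |χ.h x| ≤ T := by
    filter_upwards [S.left, S.cost_bdd.sect_right, Measure.ae_ae_of_ae_prod S.cost, hbb, hχ.xOpt]
      with x h1 h2 h3 h4 h5
    by_contra! hcon
    have h6 := S.mul_integral_root_le (t := χ.h x) h1 h2 h3 hg hg1 hgN h4.1 h4.2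
    have h7 : ∫ y, (y - x) * Real.exp (-(c (x, y) + g y + χ.h x * (y - x))) ∂ν = 0 := by
      have : ∀ y, (y - x) * Real.exp (-(c (x, y) + g y + χ.h x * (y - x))) =
          Real.exp (χ.f x) * ((y - x) * Real.exp (-energy c ⟨χ.f, g, χ.h⟩ (x, y))) := fun y => by
        rw [mul_left_comm, ← Real.exp_add]
        simp only [energy]
        ring_nf
      simp only [this]
      rw [integral_const_mul, h5.2, mul_zero]
    rw [h7, mul_zero] at h6
    exact absurd (S.root_sign_aux hb hN hcon.le) (not_lt.2 h6)
  have hhd : ∀ᵐ p ∂(μ.prod ν), |χ.h p.1 * (p.2 - p.1)| ≤ T * (A + B) := by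
    filter_upwards [ae_prod_of_ae_left hh, S.diff_le] with p h1 h2
    rw [abs_mul]; gcongr
  have hf : ∀ᵐ x ∂μ, |χ.f x| ≤ F := by
    filter_upwards [Measure.ae_ae_of_ae_prod hhd, Measure.ae_ae_of_ae_prod S.cost,
      (S.energy_bdd (bounded_withG hχ.bounded hg)).sect_right, hχ.xOpt] with x h1 h2 h3 h4
    -- The tangent line of the exponential is used here in place of a pointwise bound, since g has
    -- no pointwise upper bound yet.
    have hlow := integral_mono_essBdd
      ((EssBdd.const (1 - K - χ.f x - T * (A + B))).sub hg.abs) h3.exp_neg (by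
        filter_upwards [h1, h2] with y h5 h6
        refine le_trans ?_ (Real.add_one_le_exp _)
        rw [abs_le] at h5 h6
        simp only [energy]
        have := le_abs_self (g y)
        linarith)
    have hup := integral_le_const (C := Real.exp (K + C₁ + T * (A + B) - χ.f x)) h3.exp_neg (by
        filter_upwards [h1, h2, hg1] with y h5 h6 h7
        rw [abs_le] at h5 h6
        simp only [energy]
        apply Real.exp_le_exp.2
        linarith)
    rw [h4.1] at hlow hup
    rw [integral_sub (EssBdd.const _).integrable hg.abs.integrable] at hlow
    simp only [integral_const, probReal_univ, smul_eq_mul, one_mul] at hlow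
    rw [← Real.exp_zero, Real.exp_le_exp] at hup
    rw [abs_le]
    constructor <;> linarith
  refine ⟨hf, ?_, hh⟩
  have hE := S.energy_bdd hχ.bounded
  filter_upwards [ae_ae_swap hhd, ae_ae_swap S.cost, hE.sect_left, hχ.yOpt] with y h1 h2 h3 h4
  have hlow := const_le_integral (C := Real.exp (-(K + F + T * (A + B)) - χ.g y)) h3.exp_neg (by
        filter_upwards [h1, h2, hf] with y h5 h6 h7
        rw [abs_le] at h5 h6 h7
        simp only [energy]
        apply Real.exp_le_exp.2
        linarith)
  have hup := integral_le_const (C := Real.exp ((K + F + T * (A + B)) - χ.g y)) h3.exp_neg (by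
        filter_upwards [h1, h2, hf] with y h5 h6 h7
        rw [abs_le] at h5 h6 h7
        simp only [energy]
        apply Real.exp_le_exp.2
        linarith)
  rw [h4] at hlow hup
  rw [← Real.exp_zero, Real.exp_le_exp] at hlow hup
  rw [abs_le]
  constructor <;> linarith

theorem boundedBy_normalize {Cf Cg Ch : ℝ} (h : BoundedBy μ ν χ Cf Cg Ch) :
    BoundedBy μ ν (normalize μ ν χ) (Cf + Cg + Ch * A) (Cg + Cg + Ch * B) (Ch + Ch) := by
  have h1 := abs_le.1 (abs_integral_le_const h.2.1)
  have h2 := abs_integral_le_const h.2.2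
  refine ⟨?_, ?_, ?_⟩
  · filter_upwards [h.1, S.left] with x h3 h4
    have h5 : |(∫ t, χ.h t ∂μ) * x| ≤ Ch * A := by
      rw [abs_mul]; exact mul_le_mul h2 h4 (abs_nonneg _) ((abs_nonneg _).trans h2)
    rw [abs_le] at h3 h5
    simp only [normalize]
    rw [abs_le]; constructor <;> linarith
  · filter_upwards [h.2.1, S.right] with y h3 h4
    have h5 : |(∫ t, χ.h t ∂μ) * y| ≤ Ch * B := by
      rw [abs_mul]; exact mul_le_mul h2 h4 (abs_nonneg _) ((abs_nonneg _).trans h2)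
    rw [abs_le] at h3 h5
    simp only [normalize]
    rw [abs_le]; constructor <;> linarith
  · filter_upwards [h.2.2] with x h3
    rw [abs_le] at h3 h2
    simp only [normalize]
    rw [abs_le]; constructor <;> linarith

end Setting

end Step

/-! ### Stability of the step -/

/-- The difference of two triples. -/
def Potentials.diff (φ ψ : Potentials) : Potentials where
  f x := φ.f x - ψ.f x
  g y := φ.g y - ψ.g y
  h x := φ.h x - ψ.h x

/-- The quadratic estimate behind the stability of the step. -/
theorem affine_bound {p q v B M J V I : ℝ} (hv : 0 < v) (hB : 0 ≤ B) (hM0 : 0 < M)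
    (hJ0 : 0 ≤ J) (hvar : v ≤ V) (hmono : M⁻¹ * (p ^ 2 + q ^ 2 * V) ≤ I)
    (hpert : I ≤ M * (|p| + B * |q|) * J) :
    |p| + |q| ≤ 2 * (1 + 1 / v) * (1 + B) * M ^ 2 * J := by
  have hquad : p ^ 2 + v * q ^ 2 ≤ M ^ 2 * ((|p| + B * |q|) * J) := by
    have h1 : M⁻¹ * (p ^ 2 + q ^ 2 * V) ≤ M * (|p| + B * |q|) * J := hmono.trans hpert
    have h2 : p ^ 2 + q ^ 2 * V ≤ M * (M * (|p| + B * |q|) * J) := by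
      rwa [inv_mul_le_iff₀ hM0] at h1
    have h3 : v * q ^ 2 ≤ q ^ 2 * V := by rw [mul_comm]; gcongr
    rw [pow_two M]
    linarith
  set N := |p| + |q| with hN
  have hN0 : 0 ≤ N := by positivity
  have hN1 : |p| + B * |q| ≤ (1 + B) * N := by
    have := mul_nonneg hB (abs_nonneg p)
    have := abs_nonneg q
    rw [hN]; nlinarith
  have hN2 : N ^ 2 ≤ 2 * (1 + 1 / v) * (p ^ 2 + v * q ^ 2) := by
    have e : 2 * (1 + 1 / v) * (p ^ 2 + v * q ^ 2) =
        2 * (|p| ^ 2 + |q| ^ 2) + 2 * (p ^ 2 / v + v * q ^ 2) := by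
      rw [sq_abs, sq_abs]; field_simp; ring
    rw [e, hN]
    have : 0 ≤ p ^ 2 / v + v * q ^ 2 := by positivity
    nlinarith [sq_nonneg (|p| - |q|)]
  have hN3 : N ^ 2 ≤ 2 * (1 + 1 / v) * (1 + B) * M ^ 2 * J * N := by
    calc N ^ 2 ≤ 2 * (1 + 1 / v) * (M ^ 2 * ((1 + B) * N * J)) := by
          refine hN2.trans ?_
          have : p ^ 2 + v * q ^ 2 ≤ M ^ 2 * ((1 + B) * N * J) := hquad.trans (by gcongr)
          gcongr
      _ = _ := by ring
  rcases hN0.eq_or_lt with h0 | h0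
  · rw [← h0]; positivity
  · rw [pow_two] at hN3
    exact le_of_mul_le_mul_right hN3 h0

section Stability

variable {μ ν : Measure ℝ} [IsProbabilityMeasure μ] [IsProbabilityMeasure ν]
  {c : ℝ × ℝ → ℝ} {A B K : ℝ} {φ ψ χ χ₁ χ₂ : Potentials}

theorem normalize_diff (h₁ : χ₁.Bounded μ ν) (h₂ : χ₂.Bounded μ ν) :
    normalize μ ν (χ₁.diff χ₂) = (normalize μ ν χ₁).diff (normalize μ ν χ₂) := by
  have e1 := integral_sub h₁.g_bdd.integrable h₂.g_bdd.integrable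
  have e2 := integral_sub h₁.h_bdd.integrable h₂.h_bdd.integrable
  simp only [normalize, Potentials.diff, e1, e2]
  congr 1 <;> ext x <;> ring

theorem boundedBy_diff_symm {a b d : ℝ} (h : BoundedBy μ ν (φ.diff ψ) a b d) :
    BoundedBy μ ν (ψ.diff φ) a b d := by
  simp only [BoundedBy, Potentials.diff] at h ⊢
  simpa only [abs_sub_comm] using h

namespace Setting

variable (S : Setting μ ν c A B K)
include S

theorem integral_sq_affine (p q : ℝ) :
    ∫ y, (p + q * y) ^ 2 ∂ν = p ^ 2 + q ^ 2 * ∫ y, y ^ 2 ∂ν := by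
  have hy := S.id_right
  have : (fun y : ℝ => (p + q * y) ^ 2) = fun y => p ^ 2 + (2 * p * q) * y + q ^ 2 * y ^ 2 := by
    ext y; ring
  rw [this, integral_add ((EssBdd.const _).add ((EssBdd.const _).mul hy)).integrable
      ((EssBdd.const _).mul hy.sq).integrable,
    integral_add (EssBdd.const _).integrable ((EssBdd.const _).mul hy).integrable,
    integral_const_mul, integral_const_mul, S.mean_right]
  simp

/-- The `f` and `h` updates depend on `g` in a Lipschitz way. -/
theorem rawStep_fh_stable {Cf Cg Ch v M J : ℝ} (hv : 0 < v) (hvar : v ≤ ∫ y, y ^ 2 ∂ν)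
    (hM : M = Real.exp (K + Cf + Cg + Ch * (A + B))) {g₁ g₂ : ℝ → ℝ}
    (hg₁ : EssBdd g₁ ν) (hg₂ : EssBdd g₂ ν)
    (bg₁ : ∀ᵐ y ∂ν, |g₁ y| ≤ Cg) (bg₂ : ∀ᵐ y ∂ν, |g₂ y| ≤ Cg)
    (h₁ : IsRawStep μ ν c g₁ χ₁) (h₂ : IsRawStep μ ν c g₂ χ₂)
    (b₁ : BoundedBy μ ν χ₁ Cf Cg Ch) (b₂ : BoundedBy μ ν χ₂ Cf Cg Ch)
    (hJ : J = ∫ y, |g₁ y - g₂ y| ∂ν) :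
    ∀ᵐ x ∂μ, |(χ₁.f x - χ₂.f x) - x * (χ₁.h x - χ₂.h x)| + |χ₁.h x - χ₂.h x| ≤
      2 * (1 + 1 / v) * (1 + B) * M ^ 2 * J := by
  have hB := S.B_nonneg
  have hM0 : 0 < M := hM ▸ Real.exp_pos _
  have hMi : M⁻¹ = Real.exp (-(K + Cf + Cg + Ch * (A + B))) := by rw [hM, Real.exp_neg]
  have w₁ := bounded_withG h₁.bounded hg₁
  have w₂ := bounded_withG h₂.bounded hg₂
  -- The mixed triple has the (f, h) of the first step and the g of the second: it differs from the
  -- second triple only in (f, h), where strong monotonicity applies, and from the first only in g,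
  -- where the difference is small.
  have w₃ := bounded_withG h₁.bounded hg₂
  have a₁ := S.abs_energy_le (φ := ⟨χ₁.f, g₁, χ₁.h⟩) ⟨b₁.1, bg₁, b₁.2.2⟩
  have a₂ := S.abs_energy_le (φ := ⟨χ₂.f, g₂, χ₂.h⟩) ⟨b₂.1, bg₂, b₂.2.2⟩
  have a₃ := S.abs_energy_le (φ := ⟨χ₁.f, g₂, χ₁.h⟩) ⟨b₁.1, bg₂, b₁.2.2⟩
  have hdJ : EssBdd (fun y => |g₁ y - g₂ y|) ν := (hg₁.sub hg₂).abs
  filter_upwards [h₁.xOpt, h₂.xOpt, Measure.ae_ae_of_ae_prod a₁, Measure.ae_ae_of_ae_prod a₂,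
    Measure.ae_ae_of_ae_prod a₃, (S.energy_bdd w₁).sect_right, (S.energy_bdd w₂).sect_right,
    (S.energy_bdd w₃).sect_right, S.left] with x x₁ x₂ l₁ l₂ l₃ e₁ e₂ e₃ hx
  set q := χ₁.h x - χ₂.h x with hq
  set p := (χ₁.f x - χ₂.f x) - x * q with hp
  have hδ : ∀ y, energy c ⟨χ₁.f, g₂, χ₁.h⟩ (x, y) - energy c ⟨χ₂.f, g₂, χ₂.h⟩ (x, y) =
      p + q * y := fun y => by simp only [energy, hp, hq]; ring
  have hk : EssBdd (fun y => p + q * y) ν := (EssBdd.const _).add ((EssBdd.const _).mul S.id_right)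
  have hd : EssBdd (fun y => y - x) ν := S.id_right.sub (.const x)
  -- both optimality conditions tested with the difference
  have test : ∀ {w : ℝ → ℝ}, EssBdd w ν → ∫ y, Real.exp (-w y) ∂ν = 1 →
      ∫ y, (y - x) * Real.exp (-w y) ∂ν = 0 →
      ∫ y, Real.exp (-w y) * (p + q * y) ∂ν = p + q * x := by
    intro w hw i1 i2
    have : (fun y => Real.exp (-w y) * (p + q * y)) = fun y =>
        (p + q * x) * Real.exp (-w y) + q * ((y - x) * Real.exp (-w y)) := by ext y; ring
    rw [this, integral_add ((EssBdd.const _).mul hw.exp_neg).integrable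
      ((EssBdd.const _).mul (hd.mul hw.exp_neg)).integrable, integral_const_mul,
      integral_const_mul, i1, i2]
    ring
  -- Both tests have the same value p + qx, so the monotonicity estimate and the perturbation
  -- estimate below concern the same number.
  have t₁ := test e₁ x₁.1 x₁.2
  have t₂ := test e₂ x₂.1 x₂.2
  have hmono := integral_mono_essBdd ((EssBdd.const M⁻¹).mul hk.sq)
    ((e₂.exp_neg.mul hk).sub (e₃.exp_neg.mul hk)) (by
      filter_upwards [l₂, l₃] with y m₂ m₃
      have n₂ : M⁻¹ ≤ Real.exp (-energy c ⟨χ₂.f, g₂, χ₂.h⟩ (x, y)) := by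
        rw [hMi]; apply Real.exp_le_exp.2; linarith [(abs_le.1 m₂).2]
      have n₃ : M⁻¹ ≤ Real.exp (-energy c ⟨χ₁.f, g₂, χ₁.h⟩ (x, y)) := by
        rw [hMi]; apply Real.exp_le_exp.2; linarith [(abs_le.1 m₃).2]
      have u := exp_neg_second_order n₂ n₃
      have u' := exp_neg_second_order n₃ n₂
      rw [hδ] at u
      rw [← neg_sub (energy c ⟨χ₁.f, g₂, χ₁.h⟩ (x, y)), hδ] at u'
      nlinarith)
  have hpert := integral_mono_essBdd ((e₁.exp_neg.mul hk).sub (e₃.exp_neg.mul hk))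
    ((EssBdd.const (M * (|p| + B * |q|))).mul hdJ) (by
      filter_upwards [l₁, l₃, S.right] with y m₁ m₃ hy
      have n₁ : Real.exp (-energy c ⟨χ₁.f, g₁, χ₁.h⟩ (x, y)) ≤ M := by
        rw [hM]; apply Real.exp_le_exp.2; linarith [(abs_le.1 m₁).1]
      have n₃ : Real.exp (-energy c ⟨χ₁.f, g₂, χ₁.h⟩ (x, y)) ≤ M := by
        rw [hM]; apply Real.exp_le_exp.2; linarith [(abs_le.1 m₃).1]
      have u := abs_exp_neg_sub_le n₁ n₃
      have e0 : energy c ⟨χ₁.f, g₁, χ₁.h⟩ (x, y) - energy c ⟨χ₁.f, g₂, χ₁.h⟩ (x, y) =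
        g₁ y - g₂ y := by simp only [energy]; ring
      rw [e0] at u
      have u2 : |p + q * y| ≤ |p| + B * |q| := by
        refine (abs_add_le _ _).trans ?_
        rw [abs_mul, mul_comm]
        gcongr
      rw [← sub_mul]
      refine (le_abs_self _).trans ?_
      rw [abs_mul]
      calc _ ≤ M * |g₁ y - g₂ y| * (|p| + B * |q|) := by gcongr
        _ = _ := by ring)
  rw [integral_sub (e₂.exp_neg.mul hk).integrable (e₃.exp_neg.mul hk).integrable,
    integral_const_mul, S.integral_sq_affine, t₂] at hmono
  rw [integral_sub (e₁.exp_neg.mul hk).integrable (e₃.exp_neg.mul hk).integrable, t₁,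
    integral_const_mul, ← hJ] at hpert
  have hJ0 : 0 ≤ J := hJ ▸ integral_nonneg fun y => abs_nonneg _
  exact affine_bound hv hB hM0 hJ0 hvar hmono hpert

/-- The map from an exponent to the logarithm of its integrated exponential is nonexpansive in the
sup norm: shifting the exponent by at most ε changes the fibre mass by a factor between exp(-ε) and
exp(ε), and both masses are one. -/
theorem yOpt_g_le {ε : ℝ} (h₁ : χ₁.Bounded μ ν) (h₂ : χ₂.Bounded μ ν)
    (y₁ : YOpt μ ν c χ₁) (y₂ : YOpt μ ν c χ₂)
    (hε : ∀ᵐ p : ℝ × ℝ ∂(μ.prod ν),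
      |(χ₁.f p.1 - χ₂.f p.1) + (χ₁.h p.1 - χ₂.h p.1) * (p.2 - p.1)| ≤ ε) :
    ∀ᵐ y ∂ν, |χ₁.g y - χ₂.g y| ≤ ε := by
  filter_upwards [y₁, y₂, (S.energy_bdd h₁).sect_left, (S.energy_bdd h₂).sect_left,
    ae_ae_swap hε] with y i₁ i₂ e₁ e₂ hp
  have k1 := integral_mono_essBdd e₁.exp_neg
    ((EssBdd.const (Real.exp (ε - (χ₁.g y - χ₂.g y)))).mul e₂.exp_neg) (by
      filter_upwards [hp] with x hx
      rw [← Real.exp_add]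
      apply Real.exp_le_exp.2
      rw [abs_le] at hx
      simp only [energy]
      linarith)
  have k2 := integral_mono_essBdd e₂.exp_neg
    ((EssBdd.const (Real.exp (ε + (χ₁.g y - χ₂.g y)))).mul e₁.exp_neg) (by
      filter_upwards [hp] with x hx
      rw [← Real.exp_add]
      apply Real.exp_le_exp.2
      rw [abs_le] at hx
      simp only [energy]
      linarith)
  rw [integral_const_mul, i₁, i₂, mul_one, ← Real.exp_zero, Real.exp_le_exp] at k1 k2
  rw [abs_le]
  constructor <;> linarith

/-- Lipschitz dependence of the normalized step on `g`, from `L¹(ν)` to `L^∞`. -/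
theorem step_stable (v : ℝ) (hv : 0 < v) (hvar : v ≤ ∫ y, y ^ 2 ∂ν) (C : ℝ) :
    ∃ L, 0 ≤ L ∧ ∀ {g₁ g₂ : ℝ → ℝ} {χ₁ χ₂ : Potentials}, EssBdd g₁ ν → EssBdd g₂ ν →
      (∀ᵐ y ∂ν, |g₁ y| ≤ C) → (∀ᵐ y ∂ν, |g₂ y| ≤ C) →
      IsRawStep μ ν c g₁ χ₁ → IsRawStep μ ν c g₂ χ₂ →
      BoundedBy μ ν χ₁ C C C → BoundedBy μ ν χ₂ C C C →
      BoundedBy μ ν ((normalize μ ν χ₁).diff (normalize μ ν χ₂))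
        (L * ∫ y, |g₁ y - g₂ y| ∂ν) (L * ∫ y, |g₁ y - g₂ y| ∂ν) (L * ∫ y, |g₁ y - g₂ y| ∂ν) := by
  have hA := S.A_nonneg
  have hB := S.B_nonneg
  set M := Real.exp (K + C + C + C * (A + B)) with hM
  set L₀ := 2 * (1 + 1 / v) * (1 + B) * M ^ 2 with hL₀
  have hL₀0 : 0 ≤ L₀ := by positivity
  set L₁ := L₀ * (1 + A + B) with hL₁
  refine ⟨2 * (L₁ * (1 + A + B)), by positivity, ?_⟩
  intro g₁ g₂ χ₁ χ₂ hg₁ hg₂ bg₁ bg₂ h₁ h₂ b₁ b₂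
  set J := ∫ y, |g₁ y - g₂ y| ∂ν with hJ
  have hJ0 : 0 ≤ J := integral_nonneg fun y => abs_nonneg _
  have hst := S.rawStep_fh_stable hv hvar hM hg₁ hg₂ bg₁ bg₂ h₁ h₂ b₁ b₂ hJ
  have hh : ∀ᵐ x ∂μ, |χ₁.h x - χ₂.h x| ≤ L₀ * J := by
    filter_upwards [hst] with x hx
    linarith [abs_nonneg ((χ₁.f x - χ₂.f x) - x * (χ₁.h x - χ₂.h x))]
  have hfh : ∀ᵐ p : ℝ × ℝ ∂(μ.prod ν),
      |(χ₁.f p.1 - χ₂.f p.1) + (χ₁.h p.1 - χ₂.h p.1) * (p.2 - p.1)| ≤ L₁ * J := by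
    filter_upwards [ae_prod_of_ae_left hst, ae_prod_of_ae_right S.right] with p h3 h4
    have e : (χ₁.f p.1 - χ₂.f p.1) + (χ₁.h p.1 - χ₂.h p.1) * (p.2 - p.1) =
      ((χ₁.f p.1 - χ₂.f p.1) - p.1 * (χ₁.h p.1 - χ₂.h p.1)) +
        (χ₁.h p.1 - χ₂.h p.1) * p.2 := by ring
    rw [e]
    refine (abs_add_le _ _).trans ?_
    set P := |(χ₁.f p.1 - χ₂.f p.1) - p.1 * (χ₁.h p.1 - χ₂.h p.1)| with hP
    have hP0 : 0 ≤ P := abs_nonneg _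
    set Q := |χ₁.h p.1 - χ₂.h p.1| with hQ
    have hQ0 : 0 ≤ Q := abs_nonneg _
    have h5 : |(χ₁.h p.1 - χ₂.h p.1) * p.2| ≤ Q * B := by
      rw [abs_mul]
      gcongr
    have h6 : P + Q * B ≤ (P + Q) * (1 + A + B) := by
      nlinarith [mul_nonneg hP0 hA, mul_nonneg hP0 hB, mul_nonneg hQ0 hA]
    calc P + |(χ₁.h p.1 - χ₂.h p.1) * p.2| ≤ (P + Q) * (1 + A + B) := by linarith
      _ ≤ L₀ * J * (1 + A + B) := by gcongr
      _ = L₁ * J := by rw [hL₁]; ring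
  -- The g update does not see the old g directly, so the (f, h) estimate alone controls it.
  have hgd := S.yOpt_g_le h₁.bounded h₂.bounded h₁.yOpt h₂.yOpt hfh
  have hf : ∀ᵐ x ∂μ, |χ₁.f x - χ₂.f x| ≤ L₁ * J := by
    filter_upwards [hst, S.left] with x h3 h4
    have h5 : |x * (χ₁.h x - χ₂.h x)| ≤ A * |χ₁.h x - χ₂.h x| := by rw [abs_mul]; gcongr
    set P := |(χ₁.f x - χ₂.f x) - x * (χ₁.h x - χ₂.h x)| with hP
    have hP0 : 0 ≤ P := abs_nonneg _
    set Q := |χ₁.h x - χ₂.h x| with hQ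
    have hQ0 : 0 ≤ Q := abs_nonneg _
    have e : χ₁.f x - χ₂.f x = ((χ₁.f x - χ₂.f x) - x * (χ₁.h x - χ₂.h x)) +
      x * (χ₁.h x - χ₂.h x) := by ring
    calc |χ₁.f x - χ₂.f x| ≤ P + A * Q := by rw [e]; exact (abs_add_le _ _).trans (by linarith)
      _ ≤ (P + Q) * (1 + A + B) := by
          nlinarith [mul_nonneg hP0 hA, mul_nonneg hP0 hB, mul_nonneg hQ0 hB]
      _ ≤ L₀ * J * (1 + A + B) := by gcongr
      _ = L₁ * J := by rw [hL₁]; ring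
  have hL₀₁ : L₀ * J ≤ L₁ * J := by
    have : L₀ * 1 ≤ L₁ := by rw [hL₁]; gcongr; linarith
    rw [mul_one] at this
    gcongr
  have hraw : BoundedBy μ ν (χ₁.diff χ₂) (L₁ * J) (L₁ * J) (L₁ * J) :=
    ⟨hf, hgd, hh.mono fun x hx => hx.trans hL₀₁⟩
  have hn := S.boundedBy_normalize hraw
  rw [normalize_diff h₁.bounded h₂.bounded] at hn
  have hLJ : 0 ≤ L₁ * J := by positivity
  refine hn.mono ?_ ?_ ?_ <;> nlinarith [mul_nonneg hLJ hA, mul_nonneg hLJ hB]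

end Setting

end Stability

/-! ### Existence and measurability of the step -/

section Existence

variable {μ ν : Measure ℝ} [IsProbabilityMeasure μ] [IsProbabilityMeasure ν]
  {c : ℝ × ℝ → ℝ} {A B K : ℝ} {φ ψ χ : Potentials}

/-- Boundedness of W keeps the integral between exp(-C) and exp C; its positivity is what makes the
logarithm a true inverse of the exponential here. The lemma serves the f update, the g update and
the integration over z. -/
theorem log_integral_exp_neg {α β : Type*} [MeasurableSpace α] [MeasurableSpace β]
    {μ : Measure α} {ν : Measure β} [IsProbabilityMeasure ν] {W : α × β → ℝ}
    (hW : EssBdd W (μ.prod ν)) {C : ℝ} (hC : ∀ᵐ p ∂(μ.prod ν), |W p| ≤ C) :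
    AEStronglyMeasurable (fun x => Real.log (∫ y, Real.exp (-W (x, y)) ∂ν)) μ ∧
      ∀ᵐ x ∂μ, |Real.log (∫ y, Real.exp (-W (x, y)) ∂ν)| ≤ C ∧
        Real.exp (Real.log (∫ y, Real.exp (-W (x, y)) ∂ν)) =
          ∫ y, Real.exp (-W (x, y)) ∂ν := by
  refine ⟨(Real.measurable_log.comp_aemeasurable
      hW.exp_neg.integral_right.1.aemeasurable).aestronglyMeasurable, ?_⟩
  filter_upwards [Measure.ae_ae_of_ae_prod hC, hW.sect_right] with x h1 h2
  have h3 : Real.exp (-C) ≤ ∫ y, Real.exp (-W (x, y)) ∂ν := by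
    refine const_le_integral h2.exp_neg ?_
    filter_upwards [h1] with y hy
    exact Real.exp_le_exp.2 (by linarith [(abs_le.1 hy).2])
  have h4 : ∫ y, Real.exp (-W (x, y)) ∂ν ≤ Real.exp C := by
    refine integral_le_const h2.exp_neg ?_
    filter_upwards [h1] with y hy
    exact Real.exp_le_exp.2 (by linarith [(abs_le.1 hy).1])
  have hpos := (Real.exp_pos (-C)).trans_le h3
  refine ⟨?_, Real.exp_log hpos⟩
  rw [abs_le]
  exact ⟨(Real.le_log_iff_exp_le hpos).2 h3, (Real.log_le_iff_le_exp hpos).2 h4⟩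

/-- The function whose zero is the update of `h` at `x`. -/
def rootFun (ν : Measure ℝ) (c : ℝ × ℝ → ℝ) (g : ℝ → ℝ) (x t : ℝ) : ℝ :=
  ∫ y, (y - x) * Real.exp (-(c (x, y) + g y + t * (y - x))) ∂ν

namespace Setting

variable (S : Setting μ ν c A B K)
include S

theorem sub_bdd (x : ℝ) : EssBdd (fun y => y - x) ν := S.id_right.sub (.const x)

/-- Formally the derivative in t is minus the integral of (y - x)² against a positive density. The
quantitative version adds the second order inequality in both directions; the second moment of ν
about x is x² plus that about 0, hence at least v > 0. -/
theorem rootFun_strictAnti {v x : ℝ} {g : ℝ → ℝ} (hv : 0 < v) (hvar : v ≤ ∫ y, y ^ 2 ∂ν)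
    (hc : EssBdd (fun y => c (x, y)) ν) (hg : EssBdd g ν) : StrictAnti (rootFun ν c g x) := by
  intro s t hst
  have hd := S.sub_bdd x
  have hs : EssBdd (fun y => c (x, y) + g y + s * (y - x)) ν :=
    (hc.add hg).add ((EssBdd.const s).mul hd)
  have ht : EssBdd (fun y => c (x, y) + g y + t * (y - x)) ν :=
    (hc.add hg).add ((EssBdd.const t).mul hd)
  obtain ⟨C, hC⟩ := hs.2
  obtain ⟨C', hC'⟩ := ht.2
  set m := Real.exp (-max C C') with hm
  have key := integral_mono_essBdd ((EssBdd.const (m * (t - s))).mul hd.sq)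
    ((hd.mul hs.exp_neg).sub (hd.mul ht.exp_neg)) (by
      filter_upwards [hC, hC'] with y h1 h2
      have n1 : m ≤ Real.exp (-(c (x, y) + g y + s * (y - x))) :=
        Real.exp_le_exp.2 (neg_le_neg ((le_abs_self _).trans (h1.trans (le_max_left _ _))))
      have n2 : m ≤ Real.exp (-(c (x, y) + g y + t * (y - x))) :=
        Real.exp_le_exp.2 (neg_le_neg ((le_abs_self _).trans (h2.trans (le_max_right _ _))))
      have u1 := exp_neg_second_order n1 n2
      have u2 := exp_neg_second_order n2 n1
      set a := c (x, y) + g y + s * (y - x) with ha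
      set b := c (x, y) + g y + t * (y - x) with hb
      have hab : b - a = (t - s) * (y - x) := by rw [ha, hb]; ring
      have h3 : (t - s) * (m * (t - s) * (y - x) ^ 2) ≤
          (t - s) * ((y - x) * Real.exp (-a) - (y - x) * Real.exp (-b)) := by
        have e1 : (t - s) * (m * (t - s) * (y - x) ^ 2) = m * (b - a) ^ 2 := by rw [hab]; ring
        have e2 : (t - s) * ((y - x) * Real.exp (-a) - (y - x) * Real.exp (-b)) =
          (Real.exp (-a) - Real.exp (-b)) * (b - a) := by rw [hab]; ring
        rw [e1, e2]
        nlinarith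
      exact le_of_mul_le_mul_left h3 (sub_pos.2 hst))
  rw [integral_sub (hd.mul hs.exp_neg).integrable (hd.mul ht.exp_neg).integrable,
    integral_const_mul] at key
  have hsq : ∫ y, (y - x) ^ 2 ∂ν = x ^ 2 + ∫ y, y ^ 2 ∂ν := by
    have := S.integral_sq_affine (-x) 1
    simp only [one_mul, neg_add_eq_sub] at this
    rw [this]; ring
  have hpos : 0 < ∫ y, (y - x) ^ 2 ∂ν := by rw [hsq]; nlinarith [sq_nonneg x]
  have : 0 < m * (t - s) * ∫ y, (y - x) ^ 2 ∂ν :=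
    mul_pos (mul_pos (Real.exp_pos _) (sub_pos.2 hst)) hpos
  simp only [rootFun]
  linarith

theorem rootFun_continuousOn {x T : ℝ} {g : ℝ → ℝ} (hc : EssBdd (fun y => c (x, y)) ν)
    (hg : EssBdd g ν) : ContinuousOn (rootFun ν c g x) (Set.Icc (-T) T) := by
  have hd := S.sub_bdd x
  obtain ⟨C, hC⟩ := (hc.add hg).2
  obtain ⟨D, hD⟩ := hd.2
  refine continuousOn_of_dominated (bound := fun _ => D * Real.exp (C + T * D)) ?_ ?_
    (integrable_const _) ?_
  · intro t _
    exact (hd.mul ((hc.add hg).add ((EssBdd.const t).mul hd)).exp_neg).1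
  · intro t ht
    filter_upwards [hC, hD] with y h1 h2
    have h3 : |t * (y - x)| ≤ T * D := by
      rw [abs_mul]
      exact mul_le_mul (abs_le.2 ht) h2 (abs_nonneg _) ((abs_nonneg _).trans (abs_le.2 ht))
    rw [Real.norm_eq_abs, abs_mul, abs_of_pos (Real.exp_pos _)]
    refine mul_le_mul h2 (Real.exp_le_exp.2 ?_) (Real.exp_pos _).le ((abs_nonneg _).trans h2)
    rw [abs_le] at h1 h3
    linarith
  · exact ae_of_all _ fun y => by fun_prop

/-- The sign estimate at ±T and continuity give a zero in [-T, T]; strict monotonicity on the whole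
line excludes any other. -/
theorem existsUnique_root {v b : ℝ} {g : ℝ → ℝ} (hv : 0 < v) (hvar : v ≤ ∫ y, y ^ 2 ∂ν)
    (hb : 0 < b) (hbb : TwoSided μ ν b) (hg : EssBdd g ν) :
    ∀ᵐ x ∂μ, ∃! t, rootFun ν c g x t = 0 := by
  obtain ⟨C, hC0, hC⟩ := hg.exists_nonneg
  have hgN : ∫ y, |g y| ∂ν ≤ C := integral_le_const hg.abs hC
  have hg1 : ∀ᵐ y ∂ν, -C ≤ g y := hC.mono fun y hy => (abs_le.1 hy).1
  set T := rootBound A B K b C C with hT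
  have hT1 := S.one_le_rootBound (C₁ := C) hb hC0
  filter_upwards [S.left, S.cost_bdd.sect_right, Measure.ae_ae_of_ae_prod S.cost, hbb]
    with x h1 h2 h3 h4
  have hsign : ∀ t, |t| = T → t * rootFun ν c g x t < 0 := fun t ht =>
    (S.mul_integral_root_le h1 h2 h3 hg hg1 hgN h4.1 h4.2).trans_lt
      (S.root_sign_aux hb hC0 ht.ge)
  have hTpos : 0 < T := by linarith
  have s1 := hsign T (abs_of_pos hTpos)
  have s2 := hsign (-T) (by rw [abs_neg, abs_of_pos hTpos])
  have r1 : rootFun ν c g x T ≤ 0 := by nlinarith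
  have r2 : 0 ≤ rootFun ν c g x (-T) := by nlinarith
  obtain ⟨t, -, ht⟩ := intermediate_value_Icc' (by linarith : -T ≤ T)
    (S.rootFun_continuousOn (T := T) h2 hg) ⟨r1, r2⟩
  exact ⟨t, ht, fun s hs => (S.rootFun_strictAnti hv hvar h2 hg).injective (hs.trans ht.symm)⟩

/-- The roots may be chosen pointwise without any measurability. By strict monotonicity, h(x) ≥ t
holds exactly when the root function at (x, t) is nonnegative, and that set is measurable up to null
sets. -/
theorem root_aemeasurable {v : ℝ} {g h : ℝ → ℝ} (hv : 0 < v) (hvar : v ≤ ∫ y, y ^ 2 ∂ν)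
    (hg : EssBdd g ν) (hh : ∀ᵐ x ∂μ, rootFun ν c g x (h x) = 0) : AEMeasurable h μ := by
  have key : ∀ t, NullMeasurableSet (h ⁻¹' Set.Ici t) μ := by
    intro t
    have hF : EssBdd (fun p : ℝ × ℝ =>
        (p.2 - p.1) * Real.exp (-(c p + g p.2 + t * (p.2 - p.1)))) (μ.prod ν) :=
      S.diff_bdd.mul ((S.cost_bdd.add hg.snd).add ((EssBdd.const t).mul S.diff_bdd)).exp_neg
    have hR : AEMeasurable (fun x => rootFun ν c g x t) μ := hF.integral_right.1.aemeasurable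
    have hN : NullMeasurableSet {x | 0 ≤ rootFun ν c g x t} μ :=
      nullMeasurableSet_le aemeasurable_const hR
    refine hN.congr ?_
    filter_upwards [hh, S.cost_bdd.sect_right] with x h1 h2
    have := (S.rootFun_strictAnti hv hvar h2 hg).le_iff_ge (a := h x) (b := t)
    rw [h1] at this
    exact propext this
  have : NullMeasurable h μ := measurable_of_Ici (α := ℝ) (δ := NullMeasurableSpace ℝ μ) key
  exact this.aemeasurable

/-- Any pointwise solution of the update equations is a step. -/
theorem isRawStep_of_root {v b : ℝ} {g : ℝ → ℝ} (hv : 0 < v) (hvar : v ≤ ∫ y, y ^ 2 ∂ν)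
    (hb : 0 < b) (hbb : TwoSided μ ν b) (hg : EssBdd g ν)
    (hh : ∀ᵐ x ∂μ, rootFun ν c g x (χ.h x) = 0)
    (hf : χ.f =ᵐ[μ] fun x =>
      Real.log (∫ y, Real.exp (-(c (x, y) + g y + χ.h x * (y - x))) ∂ν))
    (hG : EssBdd χ.f μ → EssBdd χ.h μ → χ.g =ᵐ[ν] fun y =>
      Real.log (∫ x, Real.exp (-(c (x, y) + χ.f x + χ.h x * (y - x))) ∂μ)) :
    IsRawStep μ ν c g χ := by
  obtain ⟨C, hC0, hC⟩ := hg.exists_nonneg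
  have hgN : ∫ y, |g y| ∂ν ≤ C := integral_le_const hg.abs hC
  have hg1 : ∀ᵐ y ∂ν, -C ≤ g y := hC.mono fun y hy => (abs_le.1 hy).1
  have h_bdd : EssBdd χ.h μ := by
    refine ⟨(S.root_aemeasurable hv hvar hg hh).aestronglyMeasurable,
      rootBound A B K b C C, ?_⟩
    filter_upwards [S.left, S.cost_bdd.sect_right, Measure.ae_ae_of_ae_prod S.cost, hbb, hh]
      with x h1 h2 h3 h4 h5
    by_contra! hcon
    have h6 := S.mul_integral_root_le (t := χ.h x) h1 h2 h3 hg hg1 hgN h4.1 h4.2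
    have h7 : ∫ y, (y - x) * Real.exp (-(c (x, y) + g y + χ.h x * (y - x))) ∂ν = 0 := h5
    rw [h7, mul_zero] at h6
    exact absurd (S.root_sign_aux hb hC0 hcon.le) (not_lt.2 h6)
  have hW : EssBdd (fun p : ℝ × ℝ => c p + g p.2 + χ.h p.1 * (p.2 - p.1)) (μ.prod ν) :=
    (S.cost_bdd.add hg.snd).add (h_bdd.fst.mul S.diff_bdd)
  obtain ⟨C₂, hC₂⟩ := hW.2
  obtain ⟨hlog, hexp⟩ := log_integral_exp_neg hW hC₂
  have f_bdd : EssBdd χ.f μ := EssBdd.congr ⟨hlog, C₂, hexp.mono fun _ h => h.1⟩ hf.symm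
  have hV : EssBdd (fun p : ℝ × ℝ => c p + χ.f p.1 + χ.h p.1 * (p.2 - p.1)) (μ.prod ν) :=
    (S.cost_bdd.add f_bdd.fst).add (h_bdd.fst.mul S.diff_bdd)
  obtain ⟨C₃, hC₃⟩ := hV.swap.2
  obtain ⟨hlog', hexp'⟩ := log_integral_exp_neg hV.swap hC₃
  -- The formula for g involves integrals over x, so it becomes available only now that f and h are
  -- known to be measurable and bounded.
  have hG' := hG f_bdd h_bdd
  refine ⟨Potentials.bounded_iff.2 ⟨f_bdd,
    EssBdd.congr ⟨hlog', C₃, hexp'.mono fun _ h => h.1⟩ hG'.symm, h_bdd⟩, ?_, ?_⟩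
  · filter_upwards [hf, hexp, hh] with x h1 h2 h3
    have e : ∀ y, Real.exp (-energy c ⟨χ.f, g, χ.h⟩ (x, y)) =
        Real.exp (-χ.f x) * Real.exp (-(c (x, y) + g y + χ.h x * (y - x))) := fun y => by
      rw [← Real.exp_add]; simp only [energy]; ring_nf
    constructor
    · simp only [e]
      rw [integral_const_mul, ← h2.2, ← h1, ← Real.exp_add]
      simp
    · have : ∀ y, (y - x) * Real.exp (-energy c ⟨χ.f, g, χ.h⟩ (x, y)) =
          Real.exp (-χ.f x) * ((y - x) * Real.exp (-(c (x, y) + g y + χ.h x * (y - x)))) :=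
        fun y => by rw [e]; ring
      simp only [this]
      rw [integral_const_mul]
      have h7 : ∫ y, (y - x) * Real.exp (-(c (x, y) + g y + χ.h x * (y - x))) ∂ν = 0 := h3
      rw [h7, mul_zero]
  · filter_upwards [hG', hexp'] with y h1 h2
    have e : ∀ x, Real.exp (-energy c χ (x, y)) =
        Real.exp (-χ.g y) * Real.exp (-(c (x, y) + χ.f x + χ.h x * (y - x))) := fun x => by
      rw [← Real.exp_add]; simp only [energy]; ring_nf
    simp only [e]
    rw [integral_const_mul, ← h2.2, ← h1, ← Real.exp_add]
    simp

/-- Every bounded `g` admits a step. -/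
theorem exists_rawStep {v b : ℝ} {g : ℝ → ℝ} (hv : 0 < v) (hvar : v ≤ ∫ y, y ^ 2 ∂ν)
    (hb : 0 < b) (hbb : TwoSided μ ν b) (hg : EssBdd g ν) : ∃ χ, IsRawStep μ ν c g χ := by
  have hroot := S.existsUnique_root hv hvar hb hbb hg
  set h : ℝ → ℝ := fun x => Classical.epsilon fun t => rootFun ν c g x t = 0
  have hh : ∀ᵐ x ∂μ, rootFun ν c g x (h x) = 0 := hroot.mono fun x hx =>
    Classical.epsilon_spec hx.exists
  set f : ℝ → ℝ := fun x => Real.log (∫ y, Real.exp (-(c (x, y) + g y + h x * (y - x))) ∂ν)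
  exact ⟨⟨f, fun y => Real.log (∫ x, Real.exp (-(c (x, y) + f x + h x * (y - x))) ∂μ), h⟩,
    S.isRawStep_of_root hv hvar hb hbb hg hh (ae_eq_refl _) fun _ _ => ae_eq_refl _⟩

end Setting

end Existence

/-! ### Consequences of an equivalent martingale coupling -/

/-- A martingale coupling `θ` of `μ` and `ν` that is equivalent to the product measure, with
density between `1 / κ` and `κ`; the properties are stated for bounded functions. -/
structure EquivCoupling (μ ν : Measure ℝ) (θ : Measure (ℝ × ℝ)) (κ : ℝ) : Prop where
  pos : 0 < κ
  ac : θ ≪ μ.prod ν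
  le : ∀ F : ℝ × ℝ → ℝ, EssBdd F (μ.prod ν) → (∀ p, 0 ≤ F p) →
    ∫ p, F p ∂θ ≤ κ * ∫ p, F p ∂(μ.prod ν)
  ge : ∀ F : ℝ × ℝ → ℝ, EssBdd F (μ.prod ν) → (∀ p, 0 ≤ F p) →
    ∫ p, F p ∂(μ.prod ν) ≤ κ * ∫ p, F p ∂θ
  left : ∀ f : ℝ → ℝ, EssBdd f μ → ∫ p, f p.1 ∂θ = ∫ x, f x ∂μ
  right : ∀ g : ℝ → ℝ, EssBdd g ν → ∫ p, g p.2 ∂θ = ∫ y, g y ∂ν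
  martingale : ∀ h : ℝ → ℝ, EssBdd h μ → ∫ p, h p.1 * (p.2 - p.1) ∂θ = 0

section Coupling

variable {μ ν : Measure ℝ} [IsProbabilityMeasure μ] [IsProbabilityMeasure ν]
  {c : ℝ × ℝ → ℝ} {A B K : ℝ} {φ ψ χ : Potentials} {θ : Measure (ℝ × ℝ)}
  [IsProbabilityMeasure θ] {κ : ℝ}

theorem essBdd_indicator_one {s : Set ℝ} (hs : MeasurableSet s) :
    EssBdd (s.indicator (1 : ℝ → ℝ)) μ := by
  refine ⟨(stronglyMeasurable_one.indicator hs).aestronglyMeasurable, 1, ae_of_all _ fun x => ?_⟩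
  by_cases hx : x ∈ s <;> simp [hx]

theorem EssBdd.of_ac {α : Type*} [MeasurableSpace α] {P R : Measure α} {F : α → ℝ}
    (hF : EssBdd F P) (h : R ≪ P) : EssBdd F R := by
  obtain ⟨C, hC⟩ := hF.2
  exact ⟨hF.1.mono_ac h, C, h.ae_le hC⟩

namespace Setting

variable (S : Setting μ ν c A B K) (E : EquivCoupling μ ν θ κ)
include S E

/-- Under θ the conditional mean of y - x is zero, so its positive and negative parts have equal
integrals, each half of the integral of |y - x|. Comparing θ with the product measure in both
directions transfers this to ν, whose first absolute moment about x is bounded below by means of the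
variance. -/
theorem exists_twoSided {v : ℝ} (hv : 0 < v) (hvar : v ≤ ∫ y, y ^ 2 ∂ν) :
    ∃ b, 0 < b ∧ TwoSided μ ν b := by
  have hκ := E.pos
  have hA := S.A_nonneg
  have hB := S.B_nonneg
  have hdp : EssBdd (fun p : ℝ × ℝ => max (p.2 - p.1) 0) (μ.prod ν) := by
    have : (fun p : ℝ × ℝ => max (p.2 - p.1) 0) =
        fun p : ℝ × ℝ => ((p.2 - p.1) + |p.2 - p.1|) * (1 / 2) := by
      ext p
      rcases le_total (p.2 - p.1) 0 with h | h
      · rw [max_eq_right h, abs_of_nonpos h]; ring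
      · rw [max_eq_left h, abs_of_nonneg h]; ring
    rw [this]; exact (S.diff_bdd.add S.diff_bdd.abs).mul (.const _)
  have hdm : EssBdd (fun p : ℝ × ℝ => -min (p.2 - p.1) 0) (μ.prod ν) := by
    have : (fun p : ℝ × ℝ => -min (p.2 - p.1) 0) =
        fun p : ℝ × ℝ => max (p.2 - p.1) 0 - (p.2 - p.1) := by
      ext p
      rcases le_total (p.2 - p.1) 0 with h | h
      · rw [max_eq_right h, min_eq_left h]; ring
      · rw [max_eq_left h, min_eq_right h]; ring
    rw [this]; exact hdp.sub S.diff_bdd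
  -- The summand 1 only ensures that the divisor D is positive.
  set D := A + B + 1 with hD
  have hD0 : 0 < D := by positivity
  -- lower bound of the first absolute moment
  have hmom : ∀ᵐ x ∂μ, v / D ≤ ∫ y, |y - x| ∂ν := by
    filter_upwards [S.left] with x hx
    have hd := S.sub_bdd x
    have h1 := integral_mono_essBdd hd.sq ((EssBdd.const D).mul hd.abs) (by
      filter_upwards [S.right] with y hy
      have : |y - x| ≤ D := (abs_sub _ _).trans (by linarith)
      rw [← sq_abs, pow_two]
      gcongr)
    have h2 := S.integral_sq_affine (-x) 1
    simp only [one_mul, neg_add_eq_sub] at h2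
    rw [integral_const_mul, h2] at h1
    rw [div_le_iff₀ hD0]
    nlinarith [sq_nonneg x]
  -- One factor κ for each of the two changes of measure, and a factor 2 because each side carries
  -- half of the absolute moment.
  set δ := (v / D) / (2 * κ ^ 2) with hδ
  have hδ0 : 0 < δ := by positivity
  -- testing with indicators
  have test : ∀ s : Set ℝ, MeasurableSet s → ∀ F : ℝ × ℝ → ℝ, EssBdd F (μ.prod ν) →
      (∀ p, 0 ≤ F p) → (∫ p, s.indicator 1 p.1 * |p.2 - p.1| ∂θ =
        2 * ∫ p, s.indicator 1 p.1 * F p ∂θ) →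
      ∫ x in s, δ ∂μ ≤ ∫ x in s, ∫ y, F (x, y) ∂ν ∂μ := by
    intro s hs F hF hF0 hFθ
    have hi0 : ∀ x, 0 ≤ s.indicator (1 : ℝ → ℝ) x := fun x =>
      Set.indicator_nonneg (fun _ _ => zero_le_one) x
    have hi := essBdd_indicator_one (μ := μ) hs
    have conv : ∀ u : ℝ → ℝ, ∫ x in s, u x ∂μ = ∫ x, s.indicator 1 x * u x ∂μ := fun u => by
      rw [← integral_indicator hs]
      congr 1; ext x
      by_cases hx : x ∈ s <;> simp [hx]
    have h1 := E.ge _ (hi.fst.mul S.diff_bdd.abs) fun p => mul_nonneg (hi0 _) (abs_nonneg _)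
    have h2 := E.le _ (hi.fst.mul hF) fun p => mul_nonneg (hi0 _) (hF0 p)
    rw [hFθ] at h1
    rw [integral_prod _ (hi.fst.mul S.diff_bdd.abs).integrable] at h1
    rw [integral_prod _ (hi.fst.mul hF).integrable] at h2
    simp only [integral_const_mul] at h1 h2
    have h3 := integral_mono_essBdd (hi.mul (EssBdd.const (v / D)))
      (hi.mul S.diff_bdd.abs.integral_right) (hmom.mono fun x hx => by
        have := hi0 x
        gcongr)
    rw [conv, conv]
    rw [integral_mul_const] at h3 ⊢
    have h4 : (∫ x, s.indicator 1 x ∂μ) * (v / D) ≤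
        2 * κ ^ 2 * ∫ x, s.indicator 1 x * ∫ y, F (x, y) ∂ν ∂μ := by nlinarith
    rw [hδ, ← mul_div_assoc, div_le_iff₀ (by positivity)]
    linarith
  have hθ : ∀ s : Set ℝ, MeasurableSet s →
      ∫ p, s.indicator 1 p.1 * |p.2 - p.1| ∂θ =
        2 * ∫ p, s.indicator 1 p.1 * max (p.2 - p.1) 0 ∂θ ∧
      ∫ p, s.indicator 1 p.1 * |p.2 - p.1| ∂θ =
        2 * ∫ p, s.indicator 1 p.1 * -min (p.2 - p.1) 0 ∂θ := by
    intro s hs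
    have hi := essBdd_indicator_one (μ := μ) hs
    have h0 := E.martingale _ hi
    have i1 := ((hi.fst.mul hdp).of_ac E.ac).integrable
    have i2 := ((hi.fst.mul hdm).of_ac E.ac).integrable
    have e1 : ∫ p, s.indicator 1 p.1 * |p.2 - p.1| ∂θ =
        ∫ p, s.indicator 1 p.1 * max (p.2 - p.1) 0 ∂θ +
          ∫ p, s.indicator 1 p.1 * -min (p.2 - p.1) 0 ∂θ := by
      rw [← integral_add i1 i2]
      congr 1; ext p
      rcases le_total (p.2 - p.1) 0 with h | h
      · rw [max_eq_right h, min_eq_left h, abs_of_nonpos h]; ring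
      · rw [max_eq_left h, min_eq_right h, abs_of_nonneg h]; ring
    have e2 : ∫ p, s.indicator 1 p.1 * (p.2 - p.1) ∂θ =
        ∫ p, s.indicator 1 p.1 * max (p.2 - p.1) 0 ∂θ -
          ∫ p, s.indicator 1 p.1 * -min (p.2 - p.1) 0 ∂θ := by
      rw [← integral_sub i1 i2]
      congr 1; ext p
      rcases le_total (p.2 - p.1) 0 with h | h
      · rw [max_eq_right h, min_eq_left h]; ring
      · rw [max_eq_left h, min_eq_right h]; ring
    rw [h0] at e2
    constructor <;> linarith
  have l1 : (fun _ => δ) ≤ᵐ[μ] fun x => ∫ y, max (y - x) 0 ∂ν :=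
    ae_le_of_forall_setIntegral_le (integrable_const _) hdp.integral_right.integrable
      fun s hs _ => test s hs _ hdp (fun p => le_max_right _ _) (hθ s hs).1
  have l2 : (fun _ => δ) ≤ᵐ[μ] fun x => ∫ y, -min (y - x) 0 ∂ν :=
    ae_le_of_forall_setIntegral_le (integrable_const _) hdm.integral_right.integrable
      fun s hs _ => test s hs _ hdm (fun p => neg_nonneg.2 (min_le_right _ _)) (hθ s hs).2
  -- Cauchy–Schwarz turns the lower bound δ on the one-sided first moments into δ² on the second
  -- moments.
  refine ⟨δ ^ 2, by positivity, ?_⟩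
  filter_upwards [l1, l2, hdp.sect_right, hdm.sect_right] with x h1 h2 h3 h4
  constructor
  · have h5 := integral_abs_sq_le h4
    have h6 : ∀ y, |-min (y - x) 0| = -min (y - x) 0 := fun y =>
      abs_of_nonneg (neg_nonneg.2 (min_le_right _ _))
    simp only [h6, neg_sq] at h5
    refine le_trans ?_ h5
    gcongr
  · have h5 := integral_abs_sq_le h3
    have h6 : ∀ y, |max (y - x) 0| = max (y - x) 0 := fun y => abs_of_nonneg (le_max_right _ _)
    simp only [h6] at h5
    refine le_trans ?_ h5
    gcongr

/-- Coercivity of the dual functional. -/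
theorem integral_abs_energy_le (hφ : φ.Bounded μ ν) :
    ∫ p, |energy c φ p| ∂(μ.prod ν) ≤
      κ * (K - planarDual μ ν c φ + (κ + κ⁻¹) ^ 2 / 2) := by
  have hκ := E.pos
  have hW := S.energy_bdd hφ
  have hWp : EssBdd (fun p => max (energy c φ p) 0) (μ.prod ν) := by
    have : (fun p => max (energy c φ p) 0) =
        fun p => (energy c φ p + |energy c φ p|) * (1 / 2) := by
      ext p
      rcases le_total (energy c φ p) 0 with h | h
      · rw [max_eq_right h, abs_of_nonpos h]; ring
      · rw [max_eq_left h, abs_of_nonneg h]; ring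
    rw [this]; exact (hW.add hW.abs).mul (.const _)
  have hWm : EssBdd (fun p => max (energy c φ p) 0 - energy c φ p) (μ.prod ν) := hWp.sub hW
  -- The term with h drops out by the martingale property, so the linear part of the dual becomes an
  -- integral of W against θ.
  have hθ : ∫ p, energy c φ p ∂θ = ∫ p, c p ∂θ + ∫ x, φ.f x ∂μ + ∫ y, φ.g y ∂ν := by
    have i1 := S.cost_bdd.of_ac E.ac
    have i2 := (hφ.f_bdd.fst (ν := ν)).of_ac E.ac
    have i3 := (hφ.g_bdd.snd (ν := μ)).of_ac E.ac
    have i4 := (hφ.h_bdd.fst.mul S.diff_bdd).of_ac E.ac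
    simp only [energy]
    rw [integral_add ((i1.add i2).add i3).integrable i4.integrable,
      integral_add (i1.add i2).integrable i3.integrable,
      integral_add i1.integrable i2.integrable,
      E.left _ hφ.f_bdd, E.right _ hφ.g_bdd, E.martingale _ hφ.h_bdd, add_zero]
  have hc : ∫ p, c p ∂θ ≤ K := by
    refine integral_le_const (S.cost_bdd.of_ac E.ac) (E.ac.ae_le ?_)
    exact S.cost.mono fun p hp => (abs_le.1 hp).2
  have h1 := E.ge _ hWp fun p => le_max_right _ _
  have h2 := E.le _ hWm fun p => sub_nonneg.2 (le_max_left _ _)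
  rw [integral_sub (hWp.of_ac E.ac).integrable (hW.of_ac E.ac).integrable] at h2
  -- Where W is negative, the sign of the linear term is wrong by (κ + κ⁻¹)|W|; the quadratic growth
  -- of exp(-W) absorbs it by Young's inequality, at the cost of (κ + κ⁻¹)²/2.
  have h3 := integral_mono_essBdd ((EssBdd.const κ⁻¹).mul hW.abs)
    (((hW.exp_neg.add ((EssBdd.const κ⁻¹).mul hWp)).sub ((EssBdd.const κ).mul hWm)).add
      (EssBdd.const ((κ + κ⁻¹) ^ 2 / 2))) (ae_of_all _ fun p => by
        have hexp := Real.exp_pos (-energy c φ p)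
        rcases le_total 0 (energy c φ p) with h | h
        · rw [max_eq_left h, abs_of_nonneg h]
          have : 0 ≤ (κ + κ⁻¹) ^ 2 / 2 := by positivity
          linarith
        · rw [max_eq_right h, abs_of_nonpos h]
          have := Real.quadratic_le_exp_of_nonneg (neg_nonneg.2 h)
          nlinarith [sq_nonneg (-energy c φ p - (κ + κ⁻¹))])
  rw [integral_const_mul, integral_add (((hW.exp_neg.add ((EssBdd.const κ⁻¹).mul hWp)).sub
      ((EssBdd.const κ).mul hWm))).integrable (EssBdd.const _).integrable,
    integral_sub (hW.exp_neg.add ((EssBdd.const κ⁻¹).mul hWp)).integrable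
      ((EssBdd.const κ).mul hWm).integrable,
    integral_add hW.exp_neg.integrable ((EssBdd.const κ⁻¹).mul hWp).integrable,
    integral_const_mul, integral_const_mul] at h3
  simp only [integral_const, probReal_univ, smul_eq_mul, one_mul] at h3
  have h4 : κ⁻¹ * ∫ p, max (energy c φ p) 0 ∂(μ.prod ν) ≤ ∫ p, max (energy c φ p) 0 ∂θ := by
    rw [inv_mul_le_iff₀ hκ]; exact h1
  have h5 : planarDual μ ν c φ = -∫ p, Real.exp (-energy c φ p) ∂(μ.prod ν) -
      (∫ p, energy c φ p ∂θ - ∫ p, c p ∂θ) := by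
    rw [hθ]; unfold planarDual; ring
  rw [inv_mul_le_iff₀ hκ] at h3
  exact h3.trans (mul_le_mul_of_nonneg_left (by linarith) hκ.le)

/-- Bounds for `g` from a lower bound for the dual functional. -/
theorem exists_g_bound (G₀ : ℝ) : ∃ C, 0 ≤ C ∧ ∀ φ : Potentials, φ.Bounded μ ν →
    φ.Normalized μ ν → YOpt μ ν c φ → G₀ ≤ planarDual μ ν c φ →
    (∀ᵐ y ∂ν, -C ≤ φ.g y) ∧ ∫ y, |φ.g y| ∂ν ≤ C := by
  have hκ := E.pos
  have hK := S.K_nonneg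
  set R := κ * (K - G₀ + (κ + κ⁻¹) ^ 2 / 2) + K with hR
  -- The absolute value keeps the constant nonnegative: R is seen to be nonnegative only once a
  -- triple as described is given.
  refine ⟨|2 * R| + K, by positivity, fun φ hφ nφ yφ hG => ?_⟩
  have hW := S.energy_bdd hφ
  have h1 : ∫ p, |energy c φ p - c p| ∂(μ.prod ν) ≤ R := by
    have h2 := S.integral_abs_energy_le E hφ
    have h3 := integral_mono_essBdd (hW.sub S.cost_bdd).abs (hW.abs.add (EssBdd.const K)) (by
      filter_upwards [S.cost] with p hp
      exact (abs_sub _ _).trans (by gcongr))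
    rw [integral_add hW.abs.integrable (EssBdd.const _).integrable] at h3
    simp only [integral_const, probReal_univ, smul_eq_mul, one_mul] at h3
    have h4 : κ * (K - planarDual μ ν c φ + (κ + κ⁻¹) ^ 2 / 2) ≤
      κ * (K - G₀ + (κ + κ⁻¹) ^ 2 / 2) := by gcongr
    linarith
  -- Averaging W - c over x leaves g(y) plus this constant, because h has mean zero; and since g has
  -- mean zero, k is itself an average of g + k.
  set k := ∫ x, φ.f x ∂μ - ∫ x, φ.h x * x ∂μ with hk
  have hD : ∀ y, ∫ x, (energy c φ (x, y) - c (x, y)) ∂μ = φ.g y + k := by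
    intro y
    have : (fun x => energy c φ (x, y) - c (x, y)) =
        fun x => φ.f x + φ.g y + (φ.h x * y - φ.h x * x) := by
      ext x; simp only [energy]; ring
    have i1 := hφ.h_bdd.mul (EssBdd.const y)
    have i2 := hφ.h_bdd.mul S.id_left
    rw [this, integral_add (hφ.f_bdd.add (.const _)).integrable (i1.sub i2).integrable,
      integral_add hφ.f_bdd.integrable (EssBdd.const _).integrable,
      integral_sub i1.integrable i2.integrable, integral_mul_const, nφ.2]
    simp [hk]; ring
  have h2 : ∫ y, |φ.g y + k| ∂ν ≤ R := by
    refine le_trans ?_ h1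
    rw [integral_prod_symm _ (hW.sub S.cost_bdd).abs.integrable]
    refine integral_mono_essBdd (hφ.g_bdd.add (.const k)).abs (hW.sub S.cost_bdd).abs.integral_left
      (ae_of_all _ fun y => ?_)
    rw [← hD y]
    exact abs_integral_le_integral_abs
  have hkR : |k| ≤ R := by
    have : k = ∫ y, (φ.g y + k) ∂ν := by
      rw [integral_add hφ.g_bdd.integrable (EssBdd.const _).integrable, nφ.1]; simp
    rw [this]
    exact abs_integral_le_integral_abs.trans h2
  have hR0 : 0 ≤ R := (abs_nonneg _).trans hkR
  rw [abs_of_nonneg (by positivity)]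
  constructor
  · filter_upwards [yφ, hW.sect_left, S.cost_bdd.sect_left, ae_ae_swap S.cost] with y h3 h4 h5 h6
    -- Jensen on the fibre: 1 = ∫ exp(-W) dμ ≥ 1 - ∫ W dμ, so the average of W over x is
    -- nonnegative.
    have h7 := integral_mono_essBdd ((EssBdd.const 1).sub h4) h4.exp_neg
      (ae_of_all _ fun x => by
        have := Real.add_one_le_exp (-energy c φ (x, y))
        linarith)
    rw [h3, integral_sub (EssBdd.const _).integrable h4.integrable] at h7
    have h8 := hD y
    rw [integral_sub h4.integrable h5.integrable] at h8
    have h9 := integral_le_const h5 (h6.mono fun x hx => (abs_le.1 hx).2)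
    have h10 := const_le_integral h5 (h6.mono fun x hx => (abs_le.1 hx).1)
    simp at h7
    rw [abs_le] at hkR
    linarith
  · have h3 := integral_mono_essBdd hφ.g_bdd.abs
      ((hφ.g_bdd.add (.const k)).abs.add (EssBdd.const |k|)) (ae_of_all _ fun y => by
        have := abs_sub (φ.g y + k) k
        simpa using this)
    rw [integral_add (hφ.g_bdd.add (.const k)).abs.integrable (EssBdd.const _).integrable] at h3
    simp only [integral_const, probReal_univ, smul_eq_mul, one_mul] at h3
    linarith

end Setting

end Coupling

/-! ### Convergence of the iteration -/

/-- The constant of the gap estimate. -/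
def gapConst (A B K v Cf Cg Ch : ℝ) : ℝ :=
  4 * Real.exp (K + Cf + Cg + Ch * (A + B)) ^ 3 * (1 + B ^ 2 / v)

/-- The exponential rate of convergence. -/
def sinkhornRate (A B K v Cf Cg Ch : ℝ) : ℝ := Real.log (1 + 1 / gapConst A B K v Cf Cg Ch)

theorem gapConst_pos {A B K v Cf Cg Ch : ℝ} (hv : 0 < v) : 0 < gapConst A B K v Cf Cg Ch := by
  unfold gapConst
  have := Real.exp_pos (K + Cf + Cg + Ch * (A + B))
  positivity

theorem sinkhornRate_pos {A B K v Cf Cg Ch : ℝ} (hv : 0 < v) :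
    0 < sinkhornRate A B K v Cf Cg Ch := by
  have := gapConst_pos (A := A) (B := B) (K := K) (Cf := Cf) (Cg := Cg) (Ch := Ch) hv
  refine Real.log_pos ?_
  have : 0 < 1 / gapConst A B K v Cf Cg Ch := by positivity
  linarith

/-- The hypothesis rearranges to a contraction by κ/(κ + 1), which is exp(-log(1 + 1/κ)). -/
theorem le_exp_mul_of_gap {Δ : ℕ → ℝ} {κ : ℝ} (hκ : 0 < κ)
    (h : ∀ n, Δ (n + 1) ≤ κ * (Δ n - Δ (n + 1))) (n : ℕ) :
    Δ n ≤ Real.exp (-(n : ℝ) * Real.log (1 + 1 / κ)) * Δ 0 := by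
  have hq : Real.exp (-Real.log (1 + 1 / κ)) = κ / (κ + 1) := by
    rw [Real.exp_neg, Real.exp_log (by positivity)]
    field_simp
  induction n with
  | zero => simp
  | succ n ih =>
    have h1 : Δ (n + 1) ≤ κ / (κ + 1) * Δ n := by
      rw [div_mul_eq_mul_div, le_div_iff₀ (by positivity)]
      linarith [h n]
    have h2 : Real.exp (-((n + 1 : ℕ) : ℝ) * Real.log (1 + 1 / κ)) =
        κ / (κ + 1) * Real.exp (-(n : ℝ) * Real.log (1 + 1 / κ)) := by
      rw [← hq, ← Real.exp_add]; push_cast; ring_nf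
    rw [h2, mul_assoc]
    exact h1.trans (by gcongr)

theorem exists_ae_limit {ν : Measure ℝ} {F : ℕ → ℝ → ℝ} {β : ℕ → ℝ}
    (hF : ∀ n, AEStronglyMeasurable (F n) ν) (hβ : Tendsto β atTop (𝓝 0))
    (h : ∀ n m, n ≤ m → ∀ᵐ y ∂ν, |F m y - F n y| ≤ β n) :
    ∃ G, AEStronglyMeasurable G ν ∧ ∀ n, ∀ᵐ y ∂ν, |G y - F n y| ≤ β n := by
  have hall : ∀ᵐ y ∂ν, ∀ n m, n ≤ m → |F m y - F n y| ≤ β n := by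
    simpa only [ae_all_iff] using h
  obtain ⟨G, hG, hlim⟩ := exists_stronglyMeasurable_limit_of_tendsto_ae (f := F) hF (by
    filter_upwards [hall] with y hy
    refine cauchySeq_tendsto_of_complete (cauchySeq_of_le_tendsto_0' β (fun n m hnm => ?_) hβ)
    rw [Real.dist_eq, abs_sub_comm]
    exact hy n m hnm)
  refine ⟨G, hG.aestronglyMeasurable, fun n => ?_⟩
  filter_upwards [hall, hlim] with y h1 h2
  exact le_of_tendsto ((h2.sub_const (F n y)).abs)
    (eventually_atTop.2 ⟨n, fun m hm => h1 n m hm⟩)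

/-- A sequence of triples in which each arises from the previous one by a step. -/
structure IsSinkhornSeq (μ ν : Measure ℝ) (c : ℝ × ℝ → ℝ) (φ : ℕ → Potentials) : Prop where
  zero : (φ 0).Bounded μ ν
  step : ∀ n, ∃ χ, IsRawStep μ ν c (φ n).g χ ∧ φ (n + 1) = normalize μ ν χ

section Sequence

variable {μ ν : Measure ℝ} [IsProbabilityMeasure μ] [IsProbabilityMeasure ν]
  {c : ℝ × ℝ → ℝ} {A B K : ℝ} {ψ χ Φ : Potentials}

theorem normalize_eq_self (h : ψ.Normalized μ ν) : normalize μ ν ψ = ψ := by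
  simp [normalize, h.1, h.2]

namespace Setting

variable (S : Setting μ ν c A B K)
include S

theorem gap_of_rawStep {φ : Potentials} (hφ : φ.Bounded μ ν) (hχ : IsRawStep μ ν c φ.g χ)
    (hψ : ψ.Bounded μ ν) (nψ : ψ.Normalized μ ν) {Cf Cg Ch v : ℝ}
    (bφ : BoundedBy μ ν (normalize μ ν χ) Cf Cg Ch) (bψ : BoundedBy μ ν ψ Cf Cg Ch) (hv : 0 < v)
    (hvar : v ≤ ∫ y, y ^ 2 ∂ν) :
    planarDual μ ν c ψ - planarDual μ ν c (normalize μ ν χ) +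
      1 / (4 * Real.exp (K + Cf + Cg + Ch * (A + B))) *
      (∫ x, (ψ.f x - (normalize μ ν χ).f x - x * (ψ.h x - (normalize μ ν χ).h x)) ^ 2 ∂μ +
        ∫ y, (ψ.g y - (normalize μ ν χ).g y) ^ 2 ∂ν +
        v * ∫ x, (ψ.h x - (normalize μ ν χ).h x) ^ 2 ∂μ) ≤
      gapConst A B K v Cf Cg Ch *
        (planarDual μ ν c (normalize μ ν χ) - planarDual μ ν c φ) :=
  (S.planarDual_gap_le (S.bounded_normalize hχ.bounded) hψ (S.normalized_normalize hχ.bounded)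
    nψ bφ bψ hv hvar (S.halfG_bdd hφ.g_bdd) (yOpt_normalize hχ.yOpt) (xOpt_normalize hχ.xOpt)
    rfl).trans (mul_le_mul_of_nonneg_left (S.gain_le hφ hχ) (gapConst_pos hv).le)

theorem sq_dist_nonneg (φ ψ : Potentials) {v : ℝ} (hv : 0 < v) :
    ∫ y, (ψ.g y - φ.g y) ^ 2 ∂ν ≤
      ∫ x, (ψ.f x - φ.f x - x * (ψ.h x - φ.h x)) ^ 2 ∂μ + ∫ y, (ψ.g y - φ.g y) ^ 2 ∂ν +
        v * ∫ x, (ψ.h x - φ.h x) ^ 2 ∂μ := by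
  have h1 : 0 ≤ ∫ x, (ψ.f x - φ.f x - x * (ψ.h x - φ.h x)) ^ 2 ∂μ :=
    integral_nonneg fun x => sq_nonneg _
  have h2 : 0 ≤ v * ∫ x, (ψ.h x - φ.h x) ^ 2 ∂μ :=
    mul_nonneg hv.le (integral_nonneg fun x => sq_nonneg _)
  linarith

/-- The `g` part of the gap estimate. -/
theorem gap_g_of_rawStep {φ : Potentials} (hφ : φ.Bounded μ ν) (hχ : IsRawStep μ ν c φ.g χ)
    (hψ : ψ.Bounded μ ν) (nψ : ψ.Normalized μ ν) {Cf Cg Ch v : ℝ}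
    (bφ : BoundedBy μ ν (normalize μ ν χ) Cf Cg Ch) (bψ : BoundedBy μ ν ψ Cf Cg Ch) (hv : 0 < v)
    (hvar : v ≤ ∫ y, y ^ 2 ∂ν) :
    planarDual μ ν c ψ - planarDual μ ν c (normalize μ ν χ) +
      1 / (4 * Real.exp (K + Cf + Cg + Ch * (A + B))) *
        (∫ y, |(normalize μ ν χ).g y - ψ.g y| ∂ν) ^ 2 ≤
      gapConst A B K v Cf Cg Ch *
        (planarDual μ ν c (normalize μ ν χ) - planarDual μ ν c φ) := by
  refine le_trans ?_ (S.gap_of_rawStep hφ hχ hψ nψ bφ bψ hv hvar)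
  have h1 := S.sq_dist_nonneg (normalize μ ν χ) ψ hv
  have h2 := integral_abs_sq_le (hψ.g_bdd.sub (S.bounded_normalize hχ.bounded).g_bdd)
  simp only [abs_sub_comm (ψ.g _)] at h2
  gcongr
  exact h2.trans h1

/-- Uniqueness of the normalized maximizer. -/
theorem aeEq_of_planarDual_le (hΦ : Φ.Bounded μ ν) (nΦ : Φ.Normalized μ ν)
    (hs : IsRawStep μ ν c Φ.g Φ) (hψ : ψ.Bounded μ ν) (nψ : ψ.Normalized μ ν) {v : ℝ}
    (hv : 0 < v) (hvar : v ≤ ∫ y, y ^ 2 ∂ν) (h : planarDual μ ν c Φ ≤ planarDual μ ν c ψ) :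
    ψ.AEEq Φ μ ν := by
  obtain ⟨C1, -, b1⟩ := hΦ.exists_boundedBy
  obtain ⟨C2, -, b2⟩ := hψ.exists_boundedBy
  have hnorm := normalize_eq_self nΦ
  have b1' := b1.mono (le_max_left C1 C2) (le_max_left C1 C2) (le_max_left C1 C2)
  have b2' := b2.mono (le_max_right C1 C2) (le_max_right C1 C2) (le_max_right C1 C2)
  -- A triple that is a step from its own g is a fixed point, so the gain on the right side is zero
  -- and only the squared distance survives.
  have key := S.gap_of_rawStep hΦ hs hψ nψ (by rw [hnorm]; exact b1') b2' hv hvar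
  rw [hnorm, sub_self, mul_zero] at key
  set M := Real.exp (K + max C1 C2 + max C1 C2 + max C1 C2 * (A + B))
  have hM : 0 < 1 / (4 * M) := by have := Real.exp_pos (K + max C1 C2 + max C1 C2 +
                                    max C1 C2 * (A + B)); positivity
  have ia := ((hψ.f_bdd.sub hΦ.f_bdd).sub (S.id_left.mul (hψ.h_bdd.sub hΦ.h_bdd))).sq
  have ig := (hψ.g_bdd.sub hΦ.g_bdd).sq
  have ih := (hψ.h_bdd.sub hΦ.h_bdd).sq
  have n1 : 0 ≤ ∫ x, (ψ.f x - Φ.f x - x * (ψ.h x - Φ.h x)) ^ 2 ∂μ :=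
    integral_nonneg fun x => sq_nonneg _
  have n2 : 0 ≤ ∫ y, (ψ.g y - Φ.g y) ^ 2 ∂ν := integral_nonneg fun x => sq_nonneg _
  have n3 : 0 ≤ ∫ x, (ψ.h x - Φ.h x) ^ 2 ∂μ := integral_nonneg fun x => sq_nonneg _
  have n3' := mul_nonneg hv.le n3
  have hsum : ∫ x, (ψ.f x - Φ.f x - x * (ψ.h x - Φ.h x)) ^ 2 ∂μ + ∫ y, (ψ.g y - Φ.g y) ^ 2 ∂ν +
        v * ∫ x, (ψ.h x - Φ.h x) ^ 2 ∂μ ≤ 0 := by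
    by_contra! hcon
    have := mul_pos hM hcon
    linarith
  have z3 : ∫ x, (ψ.h x - Φ.h x) ^ 2 ∂μ = 0 := by
    by_contra hne
    have := mul_pos hv (lt_of_le_of_ne n3 (Ne.symm hne))
    linarith
  have z1 := (integral_eq_zero_iff_of_nonneg (fun x => sq_nonneg _) ia.integrable).1
    (le_antisymm (by linarith) n1)
  have z2 := (integral_eq_zero_iff_of_nonneg (fun x => sq_nonneg _) ig.integrable).1
    (le_antisymm (by linarith) n2)
  have z3' := (integral_eq_zero_iff_of_nonneg (fun x => sq_nonneg _) ih.integrable).1 z3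
  have hh : ψ.h =ᵐ[μ] Φ.h := by
    filter_upwards [z3'] with x hx
    simp only [Pi.zero_apply, sq_eq_zero_iff] at hx
    linarith
  refine ⟨?_, ?_, hh⟩
  · filter_upwards [z1, hh] with x hx hx'
    simp only [Pi.zero_apply, sq_eq_zero_iff, hx'] at hx
    linarith
  · filter_upwards [z2] with x hx
    simp only [Pi.zero_apply, sq_eq_zero_iff] at hx
    linarith

/-- A step without gain is optimal in all variables. -/
theorem xOpt_of_gain_eq_zero {g : ℝ → ℝ} (hg : EssBdd g ν) (hχ : IsRawStep μ ν c g χ)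
    (h0 : ∫ y, (halfG μ ν χ g y - (normalize μ ν χ).g y) ∂ν ≤ 0) :
    XOpt μ ν c (normalize μ ν χ) := by
  have hn := S.bounded_normalize hχ.bounded
  have hx := xOpt_normalize hχ.xOpt
  have hu := (S.halfG_bdd (χ := χ) hg).sub hn.g_bdd
  -- By Pinsker, zero gain means that the g update changes nothing ν-almost everywhere, so the
  -- condition `XOpt` of the half-step is still valid at the end.
  have h1 := sq_integral_abs_one_sub_exp_neg_le hu
    (S.integral_density_of_opt hn (S.halfG_bdd hg) (yOpt_normalize hχ.yOpt) hx)
  have h2 : ∫ y, |1 - Real.exp (-(halfG μ ν χ g y - (normalize μ ν χ).g y))| ∂ν = 0 := by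
    have := sq_nonneg (∫ y, |1 - Real.exp (-(halfG μ ν χ g y - (normalize μ ν χ).g y))| ∂ν)
    exact pow_eq_zero_iff two_ne_zero |>.1 (le_antisymm (by linarith) this)
  have h3 := (integral_eq_zero_iff_of_nonneg (fun y => abs_nonneg _)
    ((EssBdd.const 1).sub hu.exp_neg).abs.integrable).1 h2
  have h4 : ∀ᵐ y ∂ν, halfG μ ν χ g y = (normalize μ ν χ).g y := by
    filter_upwards [h3] with y hy
    simp only [Pi.zero_apply, abs_eq_zero] at hy
    have : Real.exp (-(halfG μ ν χ g y - (normalize μ ν χ).g y)) = Real.exp 0 := by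
      rw [Real.exp_zero]; linarith
    have := Real.exp_injective this
    linarith
  filter_upwards [hx] with x h5
  have e : ∀ᵐ y ∂ν, energy c ⟨(normalize μ ν χ).f, halfG μ ν χ g, (normalize μ ν χ).h⟩ (x, y) =
      energy c (normalize μ ν χ) (x, y) := by
    filter_upwards [h4] with y hy
    simp only [energy, hy]
  refine ⟨?_, ?_⟩
  · rw [← h5.1]
    refine integral_congr_ae ?_
    filter_upwards [e] with y hy
    rw [hy]
  · rw [← h5.2]
    refine integral_congr_ae ?_
    filter_upwards [e] with y hy
    rw [hy]

/-- The dual is Lipschitz in g for the L¹(ν) norm as long as the potentials stay bounded. This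
allows the limit of the g potentials to be inserted into an iterate at vanishing cost. -/
theorem planarDual_withG_ge {φ : Potentials} (hφ : φ.Bounded μ ν) {C : ℝ}
    (b : BoundedBy μ ν φ C C C) {g : ℝ → ℝ} (hg : EssBdd g ν) (bg : ∀ᵐ y ∂ν, |g y| ≤ C) :
    planarDual μ ν c φ - (Real.exp (K + C + C + C * (A + B)) + 1) * ∫ y, |g y - φ.g y| ∂ν ≤
      planarDual μ ν c ⟨φ.f, g, φ.h⟩ := by
  set M := Real.exp (K + C + C + C * (A + B)) with hM
  have hd := (hg.sub hφ.g_bdd).abs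
  have w := S.energy_bdd (bounded_withG hφ hg)
  have h1 := integral_mono_essBdd w.exp_neg
    ((S.energy_bdd hφ).exp_neg.add ((EssBdd.const M).mul hd.snd)) (by
      filter_upwards [S.abs_energy_le b,
        S.abs_energy_le (φ := ⟨φ.f, g, φ.h⟩) ⟨b.1, bg, b.2.2⟩] with p h2 h3
      have n2 : Real.exp (-energy c φ p) ≤ M := Real.exp_le_exp.2 (by linarith [(abs_le.1 h2).1])
      have n3 : Real.exp (-energy c ⟨φ.f, g, φ.h⟩ p) ≤ M :=
        Real.exp_le_exp.2 (by linarith [(abs_le.1 h3).1])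
      have := abs_exp_neg_sub_le n3 n2
      have e : energy c ⟨φ.f, g, φ.h⟩ p - energy c φ p = g p.2 - φ.g p.2 := by
        simp only [energy]; ring
      rw [e] at this
      linarith [(abs_le.1 this).2])
  rw [integral_add (S.energy_bdd hφ).exp_neg.integrable ((EssBdd.const M).mul hd.snd).integrable,
    integral_const_mul, integral_snd (fun y => |g y - φ.g y|)] at h1
  have h2 : ∫ y, g y ∂ν - ∫ y, φ.g y ∂ν ≤ ∫ y, |g y - φ.g y| ∂ν := by
    rw [← integral_sub hg.integrable hφ.g_bdd.integrable]
    exact (le_abs_self _).trans abs_integral_le_integral_abs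
  unfold planarDual
  dsimp only
  linarith

end Setting

/-! ### Uniform bounds, limit and rate of the iteration -/

namespace IsSinkhornSeq

variable {φ : ℕ → Potentials} (Q : IsSinkhornSeq μ ν c φ) (S : Setting μ ν c A B K)
include Q S

theorem bounded (n : ℕ) : (φ n).Bounded μ ν := by
  cases n with
  | zero => exact Q.zero
  | succ n =>
    obtain ⟨χ, h1, h2⟩ := Q.step n
    rw [h2]; exact S.bounded_normalize h1.bounded

theorem normalized (n : ℕ) : (φ (n + 1)).Normalized μ ν := by
  obtain ⟨χ, h1, h2⟩ := Q.step n
  rw [h2]; exact S.normalized_normalize h1.bounded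

theorem yOpt (n : ℕ) : YOpt μ ν c (φ (n + 1)) := by
  obtain ⟨χ, h1, h2⟩ := Q.step n
  rw [h2]; exact yOpt_normalize h1.yOpt

theorem monotone : Monotone fun n => planarDual μ ν c (φ n) := by
  refine monotone_nat_of_le_succ fun n => ?_
  obtain ⟨χ, h1, h2⟩ := Q.step n
  have h3 := S.gain_le (Q.bounded S n) h1
  have h4 := S.gain_nonneg (Q.bounded S n).g_bdd h1
  rw [h2]
  linarith

variable {θ : Measure (ℝ × ℝ)} [IsProbabilityMeasure θ] {κ : ℝ} (E : EquivCoupling μ ν θ κ)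
  {v : ℝ} (hv : 0 < v) (hvar : v ≤ ∫ y, y ^ 2 ∂ν)
include E hv hvar

/-- Uniform bounds for the iterates. -/
theorem exists_bound : ∃ C, 0 ≤ C ∧ ∀ n, BoundedBy μ ν (φ n) C C C ∧
    ∃ χ, IsRawStep μ ν c (φ n).g χ ∧ φ (n + 1) = normalize μ ν χ ∧ BoundedBy μ ν χ C C C := by
  obtain ⟨b, hb, hbb⟩ := S.exists_twoSided E hv hvar
  obtain ⟨C₁, hC₁, h₁⟩ := S.exists_g_bound E (planarDual μ ν c (φ 0))
  obtain ⟨C₀, hC₀, h₀⟩ := Q.zero.exists_boundedBy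
  -- Monotonicity of the dual values makes the initial value a common lower bound for coercivity.
  -- The index 0 is separate because the starting triple need be neither normalized nor optimal in
  -- g.
  have hg : ∀ n, (∀ᵐ y ∂ν, -(C₀ + C₁) ≤ (φ n).g y) ∧ ∫ y, |(φ n).g y| ∂ν ≤ C₀ + C₁ := by
    intro n
    cases n with
    | zero =>
      refine ⟨h₀.2.1.mono fun y hy => ?_, ?_⟩
      · linarith [(abs_le.1 hy).1]
      · exact (integral_le_const Q.zero.g_bdd.abs h₀.2.1).trans (by linarith)
    | succ n =>
      obtain ⟨h2, h3⟩ := h₁ _ (Q.bounded S (n + 1)) (Q.normalized S n) (Q.yOpt S n)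
        (Q.monotone S (Nat.zero_le _))
      exact ⟨h2.mono fun y hy => by linarith, by linarith⟩
  have hA := S.A_nonneg
  have hB := S.B_nonneg
  have hK := S.K_nonneg
  have hN : 0 ≤ C₀ + C₁ := by positivity
  set T := Setting.rootBound A B K b (C₀ + C₁) (C₀ + C₁) with hT
  have hT0 : 0 ≤ T := zero_le_one.trans (S.one_le_rootBound hb hN)
  set F := K + (C₀ + C₁) + (C₀ + C₁) + T * (A + B) with hF
  set G := K + F + T * (A + B) with hG
  have hF0 : 0 ≤ F := by positivity
  have hG0 : 0 ≤ G := by positivity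
  have hTA : 0 ≤ T * A := by positivity
  have hTB : 0 ≤ T * B := by positivity
  have hstep : ∀ n, ∃ χ, IsRawStep μ ν c (φ n).g χ ∧ φ (n + 1) = normalize μ ν χ ∧
      BoundedBy μ ν χ F G T := by
    intro n
    obtain ⟨χ, h2, h3⟩ := Q.step n
    obtain ⟨T', F', G', rfl, rfl, rfl, h4⟩ := S.rawStep_boundedBy hb hN hN hbb
      (Q.bounded S n).g_bdd (hg n).1 (hg n).2 h2
    exact ⟨χ, h2, h3, h4⟩
  set C := C₀ + F + (G + G) + (T + T) + T * A + T * B with hC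
  refine ⟨C, by positivity, fun n => ⟨?_, ?_⟩⟩
  · cases n with
    | zero => exact h₀.mono (by linarith) (by linarith) (by linarith)
    | succ n =>
      obtain ⟨χ, h2, h3, h4⟩ := hstep n
      rw [h3]
      exact (S.boundedBy_normalize h4).mono (by linarith) (by linarith) (by linarith)
  · obtain ⟨χ, h2, h3, h4⟩ := hstep n
    exact ⟨χ, h2, h3, h4.mono (by linarith) (by linarith) (by linarith)⟩

/-- The limit of the iteration: a normalized triple that solves the optimality conditions. -/
theorem exists_optimal : ∃ Φ : Potentials, Φ.Bounded μ ν ∧ Φ.Normalized μ ν ∧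
    IsRawStep μ ν c Φ.g Φ := by
  obtain ⟨b, hb, hbb⟩ := S.exists_twoSided E hv hvar
  obtain ⟨C, hC, hQ⟩ := Q.exists_bound S E hv hvar
  have hκ := E.pos
  have hA := S.A_nonneg
  have hB := S.B_nonneg
  set G : ℕ → ℝ := fun n => planarDual μ ν c (φ n) with hG
  have hmono : Monotone G := Q.monotone S
  have hbdd : BddAbove (Set.range G) := by
    -- The coercivity estimate has a nonnegative left side, so its right side bounds the dual from
    -- above.
    refine ⟨K + (κ + κ⁻¹) ^ 2 / 2, ?_⟩
    rintro _ ⟨n, rfl⟩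
    have h1 := S.integral_abs_energy_le E (Q.bounded S n)
    have h2 : 0 ≤ ∫ p, |energy c (φ n) p| ∂(μ.prod ν) := integral_nonneg fun p => abs_nonneg _
    have h3 := nonneg_of_mul_nonneg_right (h2.trans h1) hκ
    simp only [hG]
    linarith
  set Gs := ⨆ n, G n with hGs
  have hlim : Tendsto G atTop (𝓝 Gs) := tendsto_atTop_ciSup hmono hbdd
  have hinc : Tendsto (fun n => G (n + 1) - G n) atTop (𝓝 0) := by
    simpa using ((tendsto_add_atTop_iff_nat 1).2 hlim).sub hlim
  -- every bounded triple is below the limit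
  have hsup : ∀ ψ : Potentials, ψ.Bounded μ ν → planarDual μ ν c ψ ≤ Gs := by
    intro ψ hψ
    have hψ' := S.bounded_normalize hψ
    obtain ⟨C', hC', b'⟩ := hψ'.exists_boundedBy
    have hC1 : C ≤ C + C' := by linarith
    have hC2 : C' ≤ C + C' := by linarith
    -- The gap to ψ is bounded by the gain of one step, and the gains tend to zero because the
    -- values converge.
    have hle : ∀ n, planarDual μ ν c ψ ≤
        G (n + 1) + gapConst A B K v (C + C') (C + C') (C + C') * (G (n + 1) - G n) := by
      intro n
      obtain ⟨χ, h1, h2, -⟩ := (hQ n).2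
      have h3 := (hQ (n + 1)).1
      rw [h2] at h3
      have h4 := S.gap_g_of_rawStep (Q.bounded S n) h1 hψ' (S.normalized_normalize hψ)
        (h3.mono hC1 hC1 hC1) (b'.mono hC2 hC2 hC2) hv hvar
      rw [S.planarDual_normalize hψ, ← h2] at h4
      have h5 : 0 ≤ 1 / (4 * Real.exp (K + (C + C') + (C + C') + (C + C') * (A + B))) *
        (∫ y, |(φ (n + 1)).g y - (normalize μ ν ψ).g y| ∂ν) ^ 2 := by positivity
      simp only [hG]
      linarith
    refine ge_of_tendsto' (x := atTop) ?_ hle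
    have := ((tendsto_add_atTop_iff_nat 1).2 hlim).add
      (hinc.const_mul (gapConst A B K v (C + C') (C + C') (C + C')))
    simpa using this
  -- the potentials `g` form a Cauchy sequence
  set M := Real.exp (K + C + C + C * (A + B)) with hM
  have hM0 : 0 < M := Real.exp_pos _
  set γ := gapConst A B K v C C C with hγ
  have hγ0 : 0 < γ := gapConst_pos hv
  have hL1 : ∀ n m, n + 1 ≤ m →
      ∫ y, |(φ (n + 1)).g y - (φ m).g y| ∂ν ≤ Real.sqrt (4 * M * γ * (G (n + 1) - G n)) := by
    intro n m hnm
    obtain ⟨m, rfl⟩ : ∃ k, m = k + 1 := ⟨m - 1, by omega⟩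
    obtain ⟨χ, h1, h2, -⟩ := (hQ n).2
    have h3 := (hQ (n + 1)).1
    rw [h2] at h3
    have h4 := S.gap_g_of_rawStep (Q.bounded S n) h1 (Q.bounded S (m + 1)) (Q.normalized S m)
      h3 (hQ (m + 1)).1 hv hvar
    rw [← h2] at h4
    have h5 : G (n + 1) ≤ G (m + 1) := hmono hnm
    refine Real.le_sqrt_of_sq_le ?_
    have h6 : 1 / (4 * M) * (∫ y, |(φ (n + 1)).g y - (φ (m + 1)).g y| ∂ν) ^ 2 ≤
        γ * (G (n + 1) - G n) := by
      simp only [hG] at h5 ⊢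
      linarith
    rw [one_div, inv_mul_le_iff₀ (by positivity)] at h6
    linarith
  obtain ⟨L, hL, hstab⟩ := S.step_stable v hv hvar C
  -- The gap estimate controls g at index n + 1 in L¹; one further step upgrades this to L^∞, whence
  -- the shift to n + 2.
  have hcauchy : ∀ n m, n ≤ m → ∀ᵐ y ∂ν, |(φ (m + 2)).g y - (φ (n + 2)).g y| ≤
      L * Real.sqrt (4 * M * γ * (G (n + 1) - G n)) := by
    intro n m hnm
    obtain ⟨χ, h1, h2, h3⟩ := (hQ (n + 1)).2
    obtain ⟨χ', h1', h2', h3'⟩ := (hQ (m + 1)).2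
    have h4 := boundedBy_diff_symm (hstab (Q.bounded S _).g_bdd (Q.bounded S _).g_bdd
      (hQ (n + 1)).1.2.1 (hQ (m + 1)).1.2.1 h1 h1' h3 h3')
    rw [← h2, ← h2'] at h4
    filter_upwards [h4.2.1] with y hy
    exact hy.trans (mul_le_mul_of_nonneg_left (hL1 n (m + 1) (by omega)) hL)
  have hβ : Tendsto (fun n => L * Real.sqrt (4 * M * γ * (G (n + 1) - G n))) atTop (𝓝 0) := by
    have h1 := ((hinc.const_mul (4 * M * γ)).sqrt).const_mul L
    simpa using h1
  obtain ⟨g, hgm, hg⟩ := exists_ae_limit (F := fun n => (φ (n + 2)).g)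
    (fun n => (Q.bounded S _).g_bdd.1) hβ hcauchy
  set β : ℕ → ℝ := fun n => L * Real.sqrt (4 * M * γ * (G (n + 1) - G n)) with hβ'
  have hβ0 : 0 ≤ β 0 := by positivity
  have hgC : ∀ᵐ y ∂ν, |g y| ≤ C + β 0 := by
    filter_upwards [hg 0, (hQ 2).1.2.1] with y h1 h2
    have := abs_add_le (g y - (φ (0 + 2)).g y) ((φ (0 + 2)).g y)
    rw [sub_add_cancel] at this
    exact this.trans (by rw [add_comm C]; exact add_le_add h1 h2)
  have g_bdd : EssBdd g ν := ⟨hgm, _, hgC⟩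
  -- two more steps
  obtain ⟨χ, hχ⟩ := S.exists_rawStep hv hvar hb hbb g_bdd
  have hχn := S.bounded_normalize hχ.bounded
  obtain ⟨χ', hχ'⟩ := S.exists_rawStep hv hvar hb hbb hχn.g_bdd
  -- Inserting the limit g into iterate n + 2 costs a multiple of β n, and replacing (f, h) by the
  -- best choice for this g, then updating g, can only increase the value.
  have hge : Gs ≤ planarDual μ ν c (normalize μ ν χ) := by
    set M' := Real.exp (K + (C + β 0) + (C + β 0) + (C + β 0) * (A + B)) with hM'
    have h1 : ∀ n, G (n + 2) - (M' + 1) * β n ≤ planarDual μ ν c (normalize μ ν χ) := by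
      intro n
      have hC1 : C ≤ C + β 0 := by linarith
      have h2 := S.planarDual_withG_ge (Q.bounded S (n + 2))
        ((hQ (n + 2)).1.mono hC1 hC1 hC1) g_bdd hgC
      have h3 := S.gain_nonneg g_bdd hχ
      rw [← S.planarDual_step_gain g_bdd hχ] at h3
      have h4 := S.planarDual_le_of_xOpt (Setting.bounded_withG hχ.bounded g_bdd)
        (Setting.bounded_withG (Q.bounded S (n + 2)) g_bdd) hχ.xOpt rfl
      have h5 : ∫ y, |g y - (φ (n + 2)).g y| ∂ν ≤ β n :=
        integral_le_const (g_bdd.sub (Q.bounded S (n + 2)).g_bdd).abs (hg n)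
      have h6 : (M' + 1) * ∫ y, |g y - (φ (n + 2)).g y| ∂ν ≤ (M' + 1) * β n := by
        have := Real.exp_pos (K + (C + β 0) + (C + β 0) + (C + β 0) * (A + B))
        exact mul_le_mul_of_nonneg_left h5 (by positivity)
      simp only [hG]
      linarith
    refine le_of_tendsto' (x := atTop) ?_ h1
    have := ((tendsto_add_atTop_iff_nat 2).2 hlim).sub (hβ.const_mul (M' + 1))
    simpa using this
  have hgain := S.gain_le hχn hχ'
  have hχn' := S.bounded_normalize hχ'.bounded
  refine ⟨normalize μ ν χ', hχn', S.normalized_normalize hχ'.bounded, hχn', ?_,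
    yOpt_normalize hχ'.yOpt⟩
  -- The second step starts at a value at least `Gs` and cannot end above it, so its gain is zero.
  exact S.xOpt_of_gain_eq_zero hχn.g_bdd hχ' (by linarith [hsup _ hχn'])

/-- Geometric convergence of the dual values and of the potentials. -/
theorem converges (hΦ : Φ.Bounded μ ν) (nΦ : Φ.Normalized μ ν) (hs : IsRawStep μ ν c Φ.g Φ)
    {Cf Cg Ch : ℝ} (hbd : ∀ n, 1 ≤ n → BoundedBy μ ν (φ n) Cf Cg Ch) :
    (∀ n : ℕ, planarDual μ ν c Φ - planarDual μ ν c (φ n) ≤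
      Real.exp (-(n : ℝ) * sinkhornRate A B K v Cf Cg Ch) *
        (planarDual μ ν c Φ - planarDual μ ν c (φ 0))) ∧
    ∃ C₀, 0 ≤ C₀ ∧ ∀ n : ℕ, ∃ β, 0 ≤ β ∧ BoundedBy μ ν ((φ n).diff Φ) β β β ∧
      β ^ 2 ≤ C₀ * Real.exp (-(n : ℝ) * sinkhornRate A B K v Cf Cg Ch) := by
  obtain ⟨C, hC, hQ⟩ := Q.exists_bound S E hv hvar
  obtain ⟨C', hC', bΦ⟩ := hΦ.exists_boundedBy
  set D := C + C' with hD
  have hD1 : C ≤ D := by linarith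
  have hD2 : C' ≤ D := by linarith
  have hD0 : 0 ≤ D := by linarith
  have bΦD := bΦ.mono hD2 hD2 hD2
  set Δ : ℕ → ℝ := fun n => planarDual μ ν c Φ - planarDual μ ν c (φ n) with hΔ
  have hΔ0 : ∀ n, 0 ≤ Δ n := fun n =>
    sub_nonneg.2 (S.planarDual_le_of_opt hΦ (Q.bounded S n) hs.xOpt hs.yOpt)
  set M := Real.exp (K + D + D + D * (A + B)) with hM
  have hM0 : 0 < M := Real.exp_pos _
  set γ := gapConst A B K v D D D with hγ
  have hγ0 : 0 < γ := gapConst_pos hv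
  have hgap : ∀ n, Δ (n + 1) + 1 / (4 * M) * (∫ y, |(φ (n + 1)).g y - Φ.g y| ∂ν) ^ 2 ≤
      γ * (Δ n - Δ (n + 1)) := by
    intro n
    obtain ⟨χ, h1, h2, -⟩ := (hQ n).2
    have h3 := (hQ (n + 1)).1.mono hD1 hD1 hD1
    rw [h2] at h3
    have h4 := S.gap_g_of_rawStep (Q.bounded S n) h1 hΦ nΦ h3 bΦD hv hvar
    rw [← h2] at h4
    refine h4.trans (le_of_eq ?_)
    simp only [hΔ]; ring
  have hgap' : ∀ n, Δ (n + 1) ≤ γ * (Δ n - Δ (n + 1)) := fun n => by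
    have : 0 ≤ 1 / (4 * M) * (∫ y, |(φ (n + 1)).g y - Φ.g y| ∂ν) ^ 2 := by positivity
    linarith [hgap n]
  -- A preliminary rate, with constants that also bound Φ; it is used only to know that the gap
  -- vanishes in the limit.
  have hΔlim : Tendsto Δ atTop (𝓝 0) := by
    refine squeeze_zero hΔ0 (le_exp_mul_of_gap hγ0 hgap') ?_
    have hr : 0 < Real.log (1 + 1 / γ) := sinkhornRate_pos hv
    have h1 : Tendsto (fun n : ℕ => -(n : ℝ) * Real.log (1 + 1 / γ)) atTop atBot :=
      (tendsto_neg_atTop_atBot.comp tendsto_natCast_atTop_atTop).atBot_mul_const hr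
    simpa using (Real.tendsto_exp_atBot.comp h1).mul_const (Δ 0)
  -- The constants Cf, Cg, Ch bound the iterates but are not known to bound Φ. The comparison is
  -- therefore made with later iterates m + 1, and m tends to infinity.
  have hsharp : ∀ n, Δ (n + 1) ≤ gapConst A B K v Cf Cg Ch * (Δ n - Δ (n + 1)) := by
    intro n
    obtain ⟨χ, h1, h2, -⟩ := (hQ n).2
    have h3 := hbd (n + 1) (by omega)
    rw [h2] at h3
    have h4 : ∀ m, Δ (n + 1) - Δ (m + 1) ≤ gapConst A B K v Cf Cg Ch * (Δ n - Δ (n + 1)) := by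
      intro m
      have h5 := S.gap_g_of_rawStep (Q.bounded S n) h1 (Q.bounded S (m + 1)) (Q.normalized S m)
        h3 (hbd (m + 1) (by omega)) hv hvar
      rw [← h2] at h5
      have h6 : 0 ≤ 1 / (4 * Real.exp (K + Cf + Cg + Ch * (A + B))) *
        (∫ y, |(φ (n + 1)).g y - (φ (m + 1)).g y| ∂ν) ^ 2 := by positivity
      have e1 : Δ (n + 1) - Δ (m + 1) = planarDual μ ν c (φ (m + 1)) -
        planarDual μ ν c (φ (n + 1)) := by simp only [hΔ]; ring
      have e2 : Δ n - Δ (n + 1) = planarDual μ ν c (φ (n + 1)) - planarDual μ ν c (φ n) := by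
        simp only [hΔ]; ring
      rw [e1, e2]
      linarith
    refine le_of_tendsto' (x := atTop) ?_ h4
    simpa using ((tendsto_add_atTop_iff_nat 1).2 hΔlim).const_sub (Δ (n + 1))
  have hrate := le_exp_mul_of_gap (gapConst_pos hv) hsharp
  refine ⟨hrate, ?_⟩
  set r := sinkhornRate A B K v Cf Cg Ch with hr
  have hr0 : 0 < r := sinkhornRate_pos hv
  obtain ⟨L, hL, hstab⟩ := S.step_stable v hv hvar D
  set R := 4 * M * γ * Δ 0 with hR
  have hR0 : 0 ≤ R := by have := hΔ0 0; positivity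
  have hJ : ∀ n : ℕ, (∫ y, |(φ (n + 1)).g y - Φ.g y| ∂ν) ^ 2 ≤ R * Real.exp (-(n : ℝ) * r) := by
    intro n
    have h1 := hgap n
    have h2 : 1 / (4 * M) * (∫ y, |(φ (n + 1)).g y - Φ.g y| ∂ν) ^ 2 ≤ γ * Δ n := by
      have := mul_nonneg hγ0.le (hΔ0 (n + 1))
      have := hΔ0 (n + 1)
      nlinarith
    rw [one_div, inv_mul_le_iff₀ (by positivity)] at h2
    have h3 : 4 * M * (γ * Δ n) ≤ 4 * M * (γ * (Real.exp (-(n : ℝ) * r) * Δ 0)) := by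
      exact mul_le_mul_of_nonneg_left (mul_le_mul_of_nonneg_left (hrate n) hγ0.le) (by positivity)
    refine h2.trans (h3.trans (le_of_eq ?_))
    rw [hR]; ring
  have hinit : ∀ n, BoundedBy μ ν ((φ n).diff Φ) (D + D) (D + D) (D + D) := by
    intro n
    have h1 := (hQ n).1.mono hD1 hD1 hD1
    refine ⟨?_, ?_, ?_⟩
    · filter_upwards [h1.1, bΦD.1] with x h2 h3
      exact (abs_sub _ _).trans (add_le_add h2 h3)
    · filter_upwards [h1.2.1, bΦD.2.1] with x h2 h3
      exact (abs_sub _ _).trans (add_le_add h2 h3)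
    · filter_upwards [h1.2.2, bΦD.2.2] with x h2 h3
      exact (abs_sub _ _).trans (add_le_add h2 h3)
  -- The potentials at index m + 2 are controlled by the gap at index m, which costs exp(2r); the
  -- term (D + D)² covers the indices 0 and 1.
  refine ⟨((D + D) ^ 2 + L ^ 2 * R) * Real.exp (2 * r), by positivity, fun n => ?_⟩
  rcases Nat.lt_or_ge n 2 with hn | hn
  · refine ⟨D + D, by positivity, hinit n, ?_⟩
    rw [mul_assoc, ← Real.exp_add]
    have h1 : 1 ≤ Real.exp (2 * r + -(n : ℝ) * r) := by
      refine Real.one_le_exp ?_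
      have : (n : ℝ) ≤ 2 := by exact_mod_cast hn.le
      nlinarith
    have h2 : 0 ≤ (D + D) ^ 2 + L ^ 2 * R := by positivity
    have h3 : 0 ≤ L ^ 2 * R := by positivity
    nlinarith
  · obtain ⟨m, rfl⟩ : ∃ k, n = k + 2 := ⟨n - 2, by omega⟩
    obtain ⟨χ, h1, h2, h3⟩ := (hQ (m + 1)).2
    have h4 := hstab (Q.bounded S (m + 1)).g_bdd hΦ.g_bdd
      ((hQ (m + 1)).1.2.1.mono fun y hy => hy.trans hD1) bΦD.2.1 h1 hs
      (h3.mono hD1 hD1 hD1) bΦD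
    rw [normalize_eq_self nΦ, ← h2] at h4
    refine ⟨_, mul_nonneg hL (integral_nonneg fun y => abs_nonneg _), h4, ?_⟩
    rw [mul_pow, mul_assoc, ← Real.exp_add]
    have e : 2 * r + -((m + 2 : ℕ) : ℝ) * r = -(m : ℝ) * r := by push_cast; ring
    rw [e]
    have h5 := mul_le_mul_of_nonneg_left (hJ m) (sq_nonneg L)
    have h6 : 0 ≤ (D + D) ^ 2 * Real.exp (-(m : ℝ) * r) := by positivity
    linarith

end IsSinkhornSeq

end Sequence

/-! ### Reduction to the plane -/

/-- The cost in the plane, obtained by integrating out the third coordinate. -/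
def flatCost (ρ : Measure ℝ) (c : ℝ × ℝ × ℝ → ℝ) (p : ℝ × ℝ) : ℝ :=
  -Real.log (∫ z, Real.exp (-c (p.1, p.2, z)) ∂ρ)

section Reduction

variable {μ ν ρ : Measure ℝ} [IsProbabilityMeasure μ] [IsProbabilityMeasure ν]
  [IsProbabilityMeasure ρ] {c : ℝ × ℝ × ℝ → ℝ} {φ : Potentials}

instance : IsProbabilityMeasure (base μ ν ρ) := by unfold base; infer_instance

theorem measurePreserving_assoc : MeasurePreserving
    (fun p : (ℝ × ℝ) × ℝ => (p.1.1, p.1.2, p.2)) ((μ.prod ν).prod ρ) (base μ ν ρ) :=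
  measurePreserving_prodAssoc μ ν ρ

theorem measurePreserving_plane : MeasurePreserving
    (fun p : ℝ × ℝ × ℝ => (p.1, p.2.1)) (base μ ν ρ) (μ.prod ν) :=
  measurePreserving_fst.comp ((measurePreserving_prodAssoc μ ν ρ).symm MeasurableEquiv.prodAssoc)

theorem measurePreserving_rotate : MeasurePreserving
    (fun p : ℝ × ℝ × ℝ => (p.2.1, p.1, p.2.2)) (ν.prod (μ.prod ρ)) (base μ ν ρ) :=
  (measurePreserving_assoc (μ := μ) (ν := ν) (ρ := ρ)).comp
    ((Measure.measurePreserving_swap.prod (MeasurePreserving.id ρ)).comp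
      ((measurePreserving_prodAssoc ν μ ρ).symm MeasurableEquiv.prodAssoc))

variable {K : ℝ} (hc : Continuous c) (hK : ∀ᵐ p ∂(base μ ν ρ), |c p| ≤ K)
include hc hK

theorem cost_essBdd : EssBdd c (base μ ν ρ) := ⟨hc.aestronglyMeasurable, K, hK⟩

theorem flatCost_spec : AEStronglyMeasurable (flatCost ρ c) (μ.prod ν) ∧
    ∀ᵐ p ∂(μ.prod ν), |flatCost ρ c p| ≤ K ∧
      Real.exp (-flatCost ρ c p) = ∫ z, Real.exp (-c (p.1, p.2, z)) ∂ρ := by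
  have h1 : EssBdd (fun p : (ℝ × ℝ) × ℝ => c (p.1.1, p.1.2, p.2)) ((μ.prod ν).prod ρ) :=
    (cost_essBdd hc hK).comp_quasi measurePreserving_assoc.quasiMeasurePreserving
  have h2 : ∀ᵐ p : (ℝ × ℝ) × ℝ ∂((μ.prod ν).prod ρ), |c (p.1.1, p.1.2, p.2)| ≤ K :=
    measurePreserving_assoc.quasiMeasurePreserving.ae hK
  obtain ⟨h3, h4⟩ := log_integral_exp_neg h1 h2
  refine ⟨h3.neg, ?_⟩
  filter_upwards [h4] with p h5
  simp only [flatCost, abs_neg, neg_neg]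
  exact h5

/-- Integration of a function of `(x, y)` against `exp (-c)`. -/
theorem integral_base_mul_exp {F : ℝ × ℝ → ℝ} (hF : EssBdd F (μ.prod ν)) :
    ∫ p, F (p.1, p.2.1) * Real.exp (-c p) ∂(base μ ν ρ) =
      ∫ p, F p * Real.exp (-flatCost ρ c p) ∂(μ.prod ν) := by
  have h0 : EssBdd (fun p : ℝ × ℝ × ℝ => F (p.1, p.2.1) * Real.exp (-c p)) (base μ ν ρ) :=
    (hF.comp_quasi measurePreserving_plane.quasiMeasurePreserving).mul (cost_essBdd hc hK).exp_neg
  have h1 : ∫ p, F (p.1, p.2.1) * Real.exp (-c p) ∂(base μ ν ρ) =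
      ∫ p : (ℝ × ℝ) × ℝ, F p.1 * Real.exp (-c (p.1.1, p.1.2, p.2)) ∂((μ.prod ν).prod ρ) := by
    rw [← (measurePreserving_assoc (μ := μ) (ν := ν) (ρ := ρ)).map_eq, integral_map]
    · exact (measurePreserving_assoc (μ := μ) (ν := ν) (ρ := ρ)).measurable.aemeasurable
    · rw [(measurePreserving_assoc (μ := μ) (ν := ν) (ρ := ρ)).map_eq]; exact h0.1
  have h2 : EssBdd (fun p : (ℝ × ℝ) × ℝ => F p.1 * Real.exp (-c (p.1.1, p.1.2, p.2)))
      ((μ.prod ν).prod ρ) :=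
    h0.comp_quasi measurePreserving_assoc.quasiMeasurePreserving
  rw [h1, integral_prod _ h2.integrable]
  refine integral_congr_ae ?_
  filter_upwards [(flatCost_spec hc hK).2] with p h3
  rw [integral_const_mul, h3.2]

/-- The exceptional null set of x does not depend on u, so u may afterwards be chosen depending on x
and on the unknown t of the root equation. -/
theorem integral_section_right : ∀ᵐ x ∂μ, ∀ u : ℝ → ℝ, EssBdd u ν →
    ∫ q : ℝ × ℝ, u q.1 * Real.exp (-c (x, q.1, q.2)) ∂(ν.prod ρ) =
      ∫ y, u y * Real.exp (-flatCost ρ c (x, y)) ∂ν := by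
  have h0 : EssBdd c (μ.prod (ν.prod ρ)) := cost_essBdd hc hK
  filter_upwards [h0.sect_right, Measure.ae_ae_of_ae_prod (flatCost_spec hc hK).2]
    with x h1 h2 u hu
  rw [integral_prod _ (hu.fst.mul h1.exp_neg).integrable]
  refine integral_congr_ae ?_
  filter_upwards [h2] with y h3
  rw [integral_const_mul, h3.2]

theorem integral_section_left : ∀ᵐ y ∂ν, ∀ u : ℝ → ℝ, EssBdd u μ →
    ∫ q : ℝ × ℝ, u q.1 * Real.exp (-c (q.1, y, q.2)) ∂(μ.prod ρ) =
      ∫ x, u x * Real.exp (-flatCost ρ c (x, y)) ∂μ := by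
  have h0 : EssBdd (fun p : ℝ × ℝ × ℝ => c (p.2.1, p.1, p.2.2)) (ν.prod (μ.prod ρ)) :=
    (cost_essBdd hc hK).comp_quasi measurePreserving_rotate.quasiMeasurePreserving
  filter_upwards [h0.sect_right, ae_ae_swap (flatCost_spec hc hK).2] with y h1 h2 u hu
  rw [integral_prod _ (hu.fst.mul h1.exp_neg).integrable]
  refine integral_congr_ae ?_
  filter_upwards [h2] with x h3
  rw [integral_const_mul, h3.2]

variable {A B : ℝ} (S : Setting μ ν (flatCost ρ c) A B K)
include S

theorem isRoot_iff (hg : EssBdd φ.g ν) : ∀ᵐ x ∂μ, ∀ t,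
    IsRoot ν ρ c φ x t ↔ rootFun ν (flatCost ρ c) φ.g x t = 0 := by
  filter_upwards [integral_section_right hc hK] with x h1 t
  have hu : EssBdd (fun y => (y - x) * Real.exp (-(φ.f x + φ.g y + t * (y - x)))) ν :=
    (S.sub_bdd x).mul
      (((EssBdd.const _).add hg).add ((EssBdd.const t).mul (S.sub_bdd x))).exp_neg
  have h2 := h1 _ hu
  have e1 : (fun q : ℝ × ℝ => (q.1 - x) *
      Real.exp (-c (x, q.1, q.2) - φ.f x - φ.g q.1 - t * (q.1 - x))) =
      fun q => (q.1 - x) * Real.exp (-(φ.f x + φ.g q.1 + t * (q.1 - x))) *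
        Real.exp (-c (x, q.1, q.2)) := by
    ext q; rw [mul_assoc, ← Real.exp_add]; ring_nf
  have e2 : (fun y => (y - x) * Real.exp (-(φ.f x + φ.g y + t * (y - x))) *
      Real.exp (-flatCost ρ c (x, y))) = fun y => Real.exp (-φ.f x) *
        ((y - x) * Real.exp (-(flatCost ρ c (x, y) + φ.g y + t * (y - x)))) := by
    ext y; rw [mul_assoc, ← Real.exp_add, mul_left_comm, ← Real.exp_add]; ring_nf
  unfold IsRoot rootFun
  rw [e1, h2, e2, integral_const_mul]
  simp [(Real.exp_pos (-φ.f x)).ne']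

theorem fUpdate_eq {g h : ℝ → ℝ} (hg : EssBdd g ν) : fUpdate ν ρ c g h =ᵐ[μ] fun x =>
    Real.log (∫ y, Real.exp (-(flatCost ρ c (x, y) + g y + h x * (y - x))) ∂ν) := by
  filter_upwards [integral_section_right hc hK] with x h1
  have h2 := h1 _ (hg.add ((EssBdd.const (h x)).mul (S.sub_bdd x))).exp_neg
  unfold fUpdate
  congr 1
  convert h2 using 2
  · ext q; rw [← Real.exp_add]; ring_nf
  · ext y; rw [← Real.exp_add]; ring_nf

theorem gUpdate_eq {f h : ℝ → ℝ} (hf : EssBdd f μ) (hh : EssBdd h μ) :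
    gUpdate μ ρ c f h =ᵐ[ν] fun y =>
      Real.log (∫ x, Real.exp (-(flatCost ρ c (x, y) + f x + h x * (y - x))) ∂μ) := by
  filter_upwards [integral_section_left hc hK] with y h1
  have h2 := h1 _ (hf.add (hh.mul ((EssBdd.const y).sub S.id_left))).exp_neg
  unfold gUpdate
  congr 1
  convert h2 using 2
  · ext q; rw [← Real.exp_add]; ring_nf
  · ext x; rw [← Real.exp_add]; ring_nf

theorem weight_bdd (hφ : φ.Bounded μ ν) : EssBdd (fun p : ℝ × ℝ × ℝ =>
    -c p - φ.f p.1 - φ.g p.2.1 - φ.h p.1 * (p.2.1 - p.1)) (base μ ν ρ) := by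
  have h1 : EssBdd (fun p : ℝ × ℝ => φ.f p.1 + φ.g p.2 + φ.h p.1 * (p.2 - p.1)) (μ.prod ν) :=
    (hφ.f_bdd.fst.add hφ.g_bdd.snd).add (hφ.h_bdd.fst.mul S.diff_bdd)
  have h2 := (cost_essBdd hc hK).neg.sub
    (h1.comp_quasi (measurePreserving_plane (ρ := ρ)).quasiMeasurePreserving)
  refine h2.congr (ae_of_all _ fun p => ?_)
  dsimp only; ring

/-- Integration of a function of `(x, y)` against the induced measure. -/
theorem integral_induced (hφ : φ.Bounded μ ν) {F : ℝ × ℝ → ℝ} (hF : EssBdd F (μ.prod ν)) :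
    ∫ p, F (p.1, p.2.1) ∂(induced μ ν ρ c φ) =
      ∫ p, F p * Real.exp (-energy (flatCost ρ c) φ p) ∂(μ.prod ν) := by
  have hw := weight_bdd hc hK S hφ
  unfold induced
  rw [integral_withDensity_eq_integral_toReal_smul₀ hw.exp.1.aemeasurable.ennreal_ofReal
    (ae_of_all _ fun p => ENNReal.ofReal_lt_top)]
  have h1 : EssBdd (fun p : ℝ × ℝ => φ.f p.1 + φ.g p.2 + φ.h p.1 * (p.2 - p.1)) (μ.prod ν) :=
    (hφ.f_bdd.fst.add hφ.g_bdd.snd).add (hφ.h_bdd.fst.mul S.diff_bdd)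
  have h2 := integral_base_mul_exp hc hK (hF.mul h1.exp_neg)
  convert h2 using 2
  · ext p
    rw [ENNReal.toReal_ofReal (Real.exp_pos _).le, smul_eq_mul, mul_assoc, ← Real.exp_add,
      mul_comm]
    ring_nf
  · ext p
    rw [mul_assoc, ← Real.exp_add]
    simp only [energy]
    ring_nf

theorem isFiniteMeasure_induced (hφ : φ.Bounded μ ν) : IsFiniteMeasure (induced μ ν ρ c φ) :=
  isFiniteMeasure_withDensity_ofReal (weight_bdd hc hK S hφ).exp.integrable.2

theorem dual_eq_planarDual (hφ : φ.Bounded μ ν) :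
    dual μ ν ρ c φ = planarDual μ ν (flatCost ρ c) φ := by
  have := isFiniteMeasure_induced hc hK S hφ
  have h1 := integral_induced hc hK S hφ (EssBdd.const 1)
  simp only [integral_const, smul_eq_mul, mul_one, one_mul] at h1
  unfold dual planarDual
  rw [h1]

end Reduction

/-! ### The equivalent coupling in the plane -/

section Martingale

variable {μ ν : Measure ℝ}

theorem integral_martingale {π : ProbabilityMeasure (ℝ × ℝ × ℝ)}
    (hπ : π ∈ martingaleCouplings μ ν) {h : ℝ → ℝ}
    (hi : Integrable (fun p : ℝ × ℝ × ℝ => h p.1 * (p.2.1 - p.1))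
      (π : Measure (ℝ × ℝ × ℝ))) :
    ∫ p, h p.1 * (p.2.1 - p.1) ∂(π : Measure (ℝ × ℝ × ℝ)) = 0 := by
  rw [← Measure.integral_condKernel hi]
  have h1 : (π : Measure (ℝ × ℝ × ℝ)).fst = μ := hπ.1
  rw [h1]
  refine integral_eq_zero_of_ae ?_
  filter_upwards [hπ.2.2] with x hx
  rw [integral_const_mul, hx]
  simp

/-- The integrals of the conditional mean over measurable sets of x are the integrals tested with
indicators; if all vanish, the conditional mean is zero almost everywhere. -/
theorem ae_martingale {π : Measure (ℝ × ℝ × ℝ)} [IsProbabilityMeasure π]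
    (h1 : π.map (fun p => p.1) = μ) (hi : Integrable (fun p : ℝ × ℝ × ℝ => p.2.1 - p.1) π)
    (h : ∀ s : Set ℝ, MeasurableSet s → ∫ p, s.indicator 1 p.1 * (p.2.1 - p.1) ∂π = 0) :
    ∀ᵐ x ∂μ, ∫ q, (q.1 - x) ∂(π.condKernel x) = 0 := by
  have h2 : π.fst = μ := h1
  rw [← h2]
  refine Integrable.ae_eq_zero_of_forall_setIntegral_eq_zero hi.integral_condKernel
    fun s hs _ => ?_
  rw [Measure.setIntegral_condKernel_univ_right (f := fun p : ℝ × ℝ × ℝ => p.2.1 - p.1) hs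
    hi.integrableOn, ← integral_indicator (hs.prod MeasurableSet.univ), ← h s hs]
  congr 1; ext p
  by_cases hp : p.1 ∈ s <;> simp [Set.indicator, hp]

theorem measurePreserving_left {π : ProbabilityMeasure (ℝ × ℝ × ℝ)}
    (hπ : π ∈ martingaleCouplings μ ν) :
    MeasurePreserving (fun p : ℝ × ℝ × ℝ => p.1) (π : Measure (ℝ × ℝ × ℝ)) μ :=
  ⟨measurable_fst, hπ.1⟩

theorem measurePreserving_right {π : ProbabilityMeasure (ℝ × ℝ × ℝ)}
    (hπ : π ∈ martingaleCouplings μ ν) :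
    MeasurePreserving (fun p : ℝ × ℝ × ℝ => p.2.1) (π : Measure (ℝ × ℝ × ℝ)) ν :=
  ⟨measurable_fst.comp measurable_snd, hπ.2.1⟩

theorem integral_comp_of_measurePreserving {α β : Type*} [MeasurableSpace α] [MeasurableSpace β]
    {P : Measure α} {P' : Measure β} {T : α → β} (hT : MeasurePreserving T P P') {f : β → ℝ}
    (hf : EssBdd f P') : ∫ p, f (T p) ∂P = ∫ x, f x ∂P' := by
  rw [← hT.map_eq, integral_map hT.measurable.aemeasurable (by rw [hT.map_eq]; exact hf.1)]

/-- θ is the projection of π to the plane, and κ = exp C with C an essential bound for |w|: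
integrating out z keeps the density between exp(-C) and exp C. -/
theorem exists_equivCoupling {ρ : Measure ℝ} [IsProbabilityMeasure μ] [IsProbabilityMeasure ν]
    [IsProbabilityMeasure ρ] {A B : ℝ} (hA : ∀ᵐ x ∂μ, |x| ≤ A) (hB : ∀ᵐ y ∂ν, |y| ≤ B)
    {π : ProbabilityMeasure (ℝ × ℝ × ℝ)} (hπ : π ∈ martingaleCouplings μ ν)
    {w : ℝ × ℝ × ℝ → ℝ} (hw : MemLp w ∞ (base μ ν ρ))
    (hd : (π : Measure (ℝ × ℝ × ℝ)) =
      (base μ ν ρ).withDensity fun p => ENNReal.ofReal (Real.exp (-w p))) :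
    ∃ (θ : Measure (ℝ × ℝ)) (κ : ℝ), IsProbabilityMeasure θ ∧ EquivCoupling μ ν θ κ := by
  have hw' : EssBdd w (base μ ν ρ) := essBdd_iff.2 hw
  obtain ⟨C, hC⟩ := hw'.2
  set T : ℝ × ℝ × ℝ → ℝ × ℝ := fun p => (p.1, p.2.1) with hT
  have hTm : Measurable T := by fun_prop
  set θ := (π : Measure (ℝ × ℝ × ℝ)).map T with hθ
  have hθp : IsProbabilityMeasure θ := Measure.isProbabilityMeasure_map hTm.aemeasurable
  have hac' : (π : Measure (ℝ × ℝ × ℝ)) ≪ base μ ν ρ := by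
    rw [hd]; exact withDensity_absolutelyContinuous _ _
  have hac : θ ≪ μ.prod ν := by
    rw [← (measurePreserving_plane (μ := μ) (ν := ν) (ρ := ρ)).map_eq]
    exact hac'.map hTm
  have hpl := measurePreserving_plane (μ := μ) (ν := ν) (ρ := ρ)
  have hint : ∀ F : ℝ × ℝ → ℝ, EssBdd F (μ.prod ν) →
      ∫ p, F p ∂θ = ∫ p, Real.exp (-w p) * F (T p) ∂(base μ ν ρ) := by
    intro F hF
    rw [hθ, integral_map hTm.aemeasurable (hF.1.mono_ac hac), hd,
      integral_withDensity_eq_integral_toReal_smul₀ hw'.exp_neg.1.aemeasurable.ennreal_ofReal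
        (ae_of_all _ fun p => ENNReal.ofReal_lt_top)]
    congr 1; ext p
    rw [ENNReal.toReal_ofReal (Real.exp_pos _).le, smul_eq_mul]
  refine ⟨θ, Real.exp C, hθp, Real.exp_pos _, hac, ?_, ?_, ?_, ?_, ?_⟩
  · intro F hF hF0
    have hFT : EssBdd (fun p => F (T p)) (base μ ν ρ) := hF.comp_quasi hpl.quasiMeasurePreserving
    rw [hint F hF, ← integral_comp_of_measurePreserving hpl hF, ← integral_const_mul]
    refine integral_mono_essBdd (hw'.exp_neg.mul hFT) ((EssBdd.const _).mul hFT) ?_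
    filter_upwards [hC] with p hp
    exact mul_le_mul_of_nonneg_right (Real.exp_le_exp.2 (by linarith [(abs_le.1 hp).1])) (hF0 _)
  · intro F hF hF0
    have hFT : EssBdd (fun p => F (T p)) (base μ ν ρ) := hF.comp_quasi hpl.quasiMeasurePreserving
    rw [hint F hF, ← integral_comp_of_measurePreserving hpl hF, ← integral_const_mul]
    refine integral_mono_essBdd hFT ((EssBdd.const _).mul (hw'.exp_neg.mul hFT)) ?_
    filter_upwards [hC] with p hp
    rw [← mul_assoc, ← Real.exp_add]
    exact le_mul_of_one_le_left (hF0 _) (Real.one_le_exp (by linarith [(abs_le.1 hp).2]))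
  · intro f hf
    rw [← integral_comp_of_measurePreserving (measurePreserving_left hπ) hf, hθ,
      integral_map hTm.aemeasurable ((hf.fst (ν := ν)).1.mono_ac hac)]
  · intro g hg
    rw [← integral_comp_of_measurePreserving (measurePreserving_right hπ) hg, hθ,
      integral_map hTm.aemeasurable ((hg.snd (ν := μ)).1.mono_ac hac)]
  · intro h hh
    have hx : EssBdd (fun p : ℝ × ℝ => h p.1 * (p.2 - p.1)) (μ.prod ν) := by
      refine hh.fst.mul (EssBdd.sub (EssBdd.snd (f := fun y => y) ?_)
        (EssBdd.fst (f := fun x => x) ?_))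
      · exact ⟨aestronglyMeasurable_id, B, hB⟩
      · exact ⟨aestronglyMeasurable_id, A, hA⟩
    rw [hθ, integral_map hTm.aemeasurable (hx.1.mono_ac hac)]
    refine integral_martingale hπ ?_
    exact (EssBdd.of_ac (hx.comp_quasi hpl.quasiMeasurePreserving) hac').integrable

end Martingale

/-! ### The standing assumptions in the plane -/

namespace Standing

variable {μ ν ρ : Measure ℝ} [IsProbabilityMeasure μ] [IsProbabilityMeasure ν]
  [IsProbabilityMeasure ρ] {c : ℝ × ℝ × ℝ → ℝ} {φ₀ : Potentials}

theorem exists_bound_of_compact {σ : Measure ℝ} (h : ∃ K : Set ℝ, IsCompact K ∧ σ Kᶜ = 0) :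
    ∃ A : ℝ, ∀ᵐ x ∂σ, |x| ≤ A := by
  obtain ⟨K, hK, h0⟩ := h
  obtain ⟨A, hA⟩ := hK.isBounded.exists_norm_le
  refine ⟨A, ?_⟩
  filter_upwards [mem_ae_iff.2 h0] with x hx
  exact hA x hx

variable (D : Standing μ ν ρ c φ₀)
include D

theorem setting {A B K : ℝ} (hA : ∀ᵐ x ∂μ, |x| ≤ A) (hB : ∀ᵐ y ∂ν, |y| ≤ B)
    (hK : ∀ᵐ p ∂(base μ ν ρ), |c p| ≤ K) : Setting μ ν (flatCost ρ c) A B K :=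
  have h := flatCost_spec D.cost_smooth.continuous hK
  ⟨hA, hB, h.1, h.2.mono fun _ hp => hp.1, D.mean_left, D.mean_right⟩

theorem exists_setting : ∃ A B K : ℝ, Setting μ ν (flatCost ρ c) A B K ∧
    ∀ᵐ p ∂(base μ ν ρ), |c p| ≤ K := by
  obtain ⟨A, hA⟩ := exists_bound_of_compact D.compact_left
  obtain ⟨B, hB⟩ := exists_bound_of_compact D.compact_right
  obtain ⟨K, hK⟩ := D.cost_bounded
  exact ⟨A, B, K, D.setting hA hB hK, hK⟩

theorem exists_planar_coupling : ∃ (θ : Measure (ℝ × ℝ)) (κ : ℝ), IsProbabilityMeasure θ ∧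
    EquivCoupling μ ν θ κ := by
  obtain ⟨A, hA⟩ := exists_bound_of_compact D.compact_left
  obtain ⟨B, hB⟩ := exists_bound_of_compact D.compact_right
  obtain ⟨π, hπ, w, hw, hd⟩ := D.equivalent_coupling
  exact exists_equivCoupling hA hB hπ hw hd

theorem variance_eq : variance (fun y : ℝ => y) ν = ∫ y, y ^ 2 ∂ν :=
  variance_of_integral_eq_zero aemeasurable_id D.mean_right

theorem secondMoment_pos : 0 < ∫ y, y ^ 2 ∂ν := by
  obtain ⟨A, B, K, S, -⟩ := D.exists_setting
  refine lt_of_le_of_ne (integral_nonneg fun y => sq_nonneg y) fun h => ?_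
  have h1 := (integral_eq_zero_iff_of_nonneg (fun y => sq_nonneg y)
    S.id_right.sq.integrable).1 h.symm
  have h2 : (fun y : ℝ => y) =ᵐ[ν] fun _ => 0 := h1.mono fun y hy => by simpa using hy
  refine D.not_dirac 0 ?_
  have h3 : ν.map (fun y => y) = ν.map fun _ => (0 : ℝ) := Measure.map_congr h2
  rw [Measure.map_id', Measure.map_const] at h3
  simpa using h3

theorem isRoot_iff_of_bounded {φ : Potentials} (hφ : φ.Bounded μ ν) : ∀ᵐ x ∂μ, ∀ t,
    IsRoot ν ρ c φ x t ↔ rootFun ν (flatCost ρ c) φ.g x t = 0 := by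
  obtain ⟨A, B, K, S, hK⟩ := D.exists_setting
  exact isRoot_iff D.cost_smooth.continuous hK S hφ.g_bdd

theorem existsUnique_isRoot {φ : Potentials} (hφ : φ.Bounded μ ν) :
    ∀ᵐ x ∂μ, ∃! t, IsRoot ν ρ c φ x t := by
  obtain ⟨A, B, K, S, hK⟩ := D.exists_setting
  obtain ⟨θ, κ, hθ, E⟩ := D.exists_planar_coupling
  obtain ⟨b, hb, hbb⟩ := S.exists_twoSided E D.secondMoment_pos le_rfl
  filter_upwards [D.isRoot_iff_of_bounded hφ,
    S.existsUnique_root D.secondMoment_pos le_rfl hb hbb hφ.g_bdd] with x h1 h2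
  simpa only [h1] using h2

theorem isRawStep_rawStep {φ : Potentials} (hφ : φ.Bounded μ ν) :
    IsRawStep μ ν (flatCost ρ c) φ.g (rawStep μ ν ρ c φ) := by
  obtain ⟨A, B, K, S, hK⟩ := D.exists_setting
  obtain ⟨θ, κ, hθ, E⟩ := D.exists_planar_coupling
  obtain ⟨b, hb, hbb⟩ := S.exists_twoSided E D.secondMoment_pos le_rfl
  have hc := D.cost_smooth.continuous
  refine S.isRawStep_of_root D.secondMoment_pos le_rfl hb hbb hφ.g_bdd ?_
    (fUpdate_eq hc hK S hφ.g_bdd) fun hf hh => gUpdate_eq hc hK S hf hh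
  filter_upwards [D.isRoot_iff_of_bounded hφ, D.existsUnique_isRoot hφ] with x h1 h2
  exact (h1 _).1 (Classical.epsilon_spec h2.exists)

theorem sinkhorn_bounded (n : ℕ) : (sinkhorn μ ν ρ c φ₀ n).Bounded μ ν := by
  obtain ⟨A, B, K, S, hK⟩ := D.exists_setting
  induction n with
  | zero => exact D.initial_bounded
  | succ n ih => exact S.bounded_normalize (D.isRawStep_rawStep ih).bounded

theorem isSinkhornSeq : IsSinkhornSeq μ ν (flatCost ρ c) (sinkhorn μ ν ρ c φ₀) :=
  ⟨D.initial_bounded, fun n => ⟨_, D.isRawStep_rawStep (D.sinkhorn_bounded n), rfl⟩⟩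

theorem dual_eq {φ : Potentials} (hφ : φ.Bounded μ ν) :
    dual μ ν ρ c φ = planarDual μ ν (flatCost ρ c) φ := by
  obtain ⟨A, B, K, S, hK⟩ := D.exists_setting
  exact dual_eq_planarDual D.cost_smooth.continuous hK S hφ

end Standing
/-! ### The primal problem -/

namespace Standing

variable {μ ν ρ : Measure ℝ} [IsProbabilityMeasure μ] [IsProbabilityMeasure ν]
  [IsProbabilityMeasure ρ] {c : ℝ × ℝ × ℝ → ℝ} {φ₀ Φ : Potentials}
  (D : Standing μ ν ρ c φ₀) (hΦ : Φ.Bounded μ ν) (hs : IsRawStep μ ν (flatCost ρ c) Φ.g Φ)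

/-- The logarithm of the density of the induced measure with respect to the reference measure. -/
def logDensity (Φ : Potentials) (p : ℝ × ℝ × ℝ) : ℝ :=
  -(Φ.f p.1 + Φ.g p.2.1 + Φ.h p.1 * (p.2.1 - p.1))

theorem reference_ac : reference μ ν ρ c ≪ base μ ν ρ := withDensity_absolutelyContinuous _ _

include D hΦ

theorem planar_logDensity_bdd : EssBdd (fun p : ℝ × ℝ => Φ.f p.1 + Φ.g p.2 + Φ.h p.1 * (p.2 - p.1))
    (μ.prod ν) := by
  obtain ⟨A, B, K, S, hK⟩ := D.exists_setting
  exact (hΦ.f_bdd.fst.add hΦ.g_bdd.snd).add (hΦ.h_bdd.fst.mul S.diff_bdd)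

theorem logDensity_bdd : EssBdd (logDensity Φ) (base μ ν ρ) :=
  ((D.planar_logDensity_bdd hΦ).comp_quasi measurePreserving_plane.quasiMeasurePreserving).neg

theorem induced_eq_withDensity : induced μ ν ρ c Φ =
    (reference μ ν ρ c).withDensity fun p => ENNReal.ofReal (Real.exp (logDensity Φ p)) := by
  have hc : AEMeasurable (fun p => ENNReal.ofReal (Real.exp (-c p))) (base μ ν ρ) :=
    (Real.measurable_exp.comp D.cost_smooth.continuous.measurable.neg).ennreal_ofReal.aemeasurable
  have hd : AEMeasurable (fun p => ENNReal.ofReal (Real.exp (logDensity Φ p))) (base μ ν ρ) :=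
    (D.logDensity_bdd hΦ).exp.1.aemeasurable.ennreal_ofReal
  unfold reference induced
  rw [← withDensity_mul₀ hc hd]
  congr 1; ext p
  rw [Pi.mul_apply, ← ENNReal.ofReal_mul (Real.exp_pos _).le, ← Real.exp_add]
  congr 2
  simp only [logDensity]
  ring

include hs

theorem isProbabilityMeasure_induced : IsProbabilityMeasure (induced μ ν ρ c Φ) := by
  obtain ⟨A, B, K, S, hK⟩ := D.exists_setting
  have hc := D.cost_smooth.continuous
  have := isFiniteMeasure_induced hc hK S hΦ
  have h1 := integral_induced hc hK S hΦ (EssBdd.const 1)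
  simp only [integral_const, smul_eq_mul, mul_one, one_mul, S.mass_of_yOpt hΦ hs.yOpt] at h1
  exact isProbabilityMeasure_iff_real.2 h1

theorem map_induced_left : (induced μ ν ρ c Φ).map (fun p => p.1) = μ := by
  obtain ⟨A, B, K, S, hK⟩ := D.exists_setting
  have := D.isProbabilityMeasure_induced hΦ hs
  ext s hs'
  have h1 : EssBdd (s.indicator (1 : ℝ → ℝ)) μ := essBdd_indicator_one hs'
  have h2 := integral_induced D.cost_smooth.continuous hK S hΦ (h1.fst (ν := ν))
  have h3 := S.integral_of_xOpt hΦ hs.xOpt h1 (EssBdd.const 0)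
  simp only [zero_mul, add_zero, mul_comm (Real.exp _)] at h3
  rw [h3, integral_indicator_one hs'] at h2
  rw [Measure.map_apply measurable_fst hs', ← measureReal_eq_measureReal_iff, ← h2,
    ← integral_indicator_one (measurable_fst hs')]
  rfl

theorem map_induced_right : (induced μ ν ρ c Φ).map (fun p => p.2.1) = ν := by
  obtain ⟨A, B, K, S, hK⟩ := D.exists_setting
  have := D.isProbabilityMeasure_induced hΦ hs
  have hm : Measurable fun p : ℝ × ℝ × ℝ => p.2.1 := measurable_fst.comp measurable_snd
  ext s hs'
  have h1 : EssBdd (s.indicator (1 : ℝ → ℝ)) ν := essBdd_indicator_one hs'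
  have h2 := integral_induced D.cost_smooth.continuous hK S hΦ (h1.snd (ν := μ))
  have h3 := S.integral_of_yOpt hΦ hs.yOpt h1
  simp only [mul_comm (Real.exp _)] at h3
  rw [h3, integral_indicator_one hs'] at h2
  rw [Measure.map_apply hm hs', ← measureReal_eq_measureReal_iff, ← h2,
    ← integral_indicator_one (hm hs')]
  rfl

theorem exists_induced_mem : ∃ π ∈ martingaleCouplings μ ν,
    (π : Measure (ℝ × ℝ × ℝ)) = induced μ ν ρ c Φ := by
  obtain ⟨A, B, K, S, hK⟩ := D.exists_setting
  have hp := D.isProbabilityMeasure_induced hΦ hs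
  refine ⟨⟨induced μ ν ρ c Φ, hp⟩, ⟨D.map_induced_left hΦ hs, D.map_induced_right hΦ hs, ?_⟩, rfl⟩
  refine ae_martingale (π := induced μ ν ρ c Φ) (D.map_induced_left hΦ hs) ?_ fun s hs' => ?_
  · have h1 : EssBdd (fun p : ℝ × ℝ × ℝ => p.2.1 - p.1) (base μ ν ρ) :=
      S.diff_bdd.comp_quasi measurePreserving_plane.quasiMeasurePreserving
    have h2 : induced μ ν ρ c Φ ≪ base μ ν ρ := withDensity_absolutelyContinuous _ _
    exact (h1.of_ac h2).integrable
  · have h1 : EssBdd (s.indicator (1 : ℝ → ℝ)) μ := essBdd_indicator_one hs'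
    have h2 := integral_induced D.cost_smooth.continuous hK S hΦ (h1.fst.mul S.diff_bdd)
    have h3 := S.integral_of_xOpt hΦ hs.xOpt (EssBdd.const 0) h1
    simp only [zero_add, mul_comm (Real.exp _), integral_zero] at h3
    exact h2.trans h3

theorem integral_exp_logDensity :
    ∫ p, Real.exp (logDensity Φ p) ∂(reference μ ν ρ c) = 1 := by
  have hp := (D.isProbabilityMeasure_induced hΦ hs).measure_univ
  rw [D.induced_eq_withDensity hΦ, withDensity_apply _ MeasurableSet.univ,
    Measure.restrict_univ] at hp
  rw [integral_eq_lintegral_of_nonneg_ae (ae_of_all _ fun _ => (Real.exp_pos _).le)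
    ((D.logDensity_bdd hΦ).of_ac reference_ac).exp.1, hp]
  simp

/-- The normalizing constant of the tilt is one because the induced measure already has unit mass.
-/
theorem induced_eq_tilted : induced μ ν ρ c Φ = (reference μ ν ρ c).tilted (logDensity Φ) := by
  rw [D.induced_eq_withDensity hΦ, Measure.tilted, D.integral_exp_logDensity hΦ hs]
  simp only [div_one]

omit hs in
-- The log density is a sum of a function of x, a function of y and a martingale term, so its
-- integral depends on π only through the constraints. This is the source of strong duality.
theorem integral_logDensity {π : ProbabilityMeasure (ℝ × ℝ × ℝ)}
    (hπ : π ∈ martingaleCouplings μ ν)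
    (hac : (π : Measure (ℝ × ℝ × ℝ)) ≪ reference μ ν ρ c) :
    ∫ p, logDensity Φ p ∂(π : Measure (ℝ × ℝ × ℝ)) = -∫ x, Φ.f x ∂μ - ∫ y, Φ.g y ∂ν := by
  obtain ⟨A, B, K, S, hK⟩ := D.exists_setting
  have hl := measurePreserving_left hπ
  have hr := measurePreserving_right hπ
  have h1 : EssBdd (fun p : ℝ × ℝ × ℝ => Φ.h p.1 * (p.2.1 - p.1))
      (π : Measure (ℝ × ℝ × ℝ)) :=
    ((hΦ.h_bdd.fst.mul S.diff_bdd).comp_quasi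
      measurePreserving_plane.quasiMeasurePreserving).of_ac (hac.trans reference_ac)
  have hf := hΦ.f_bdd.comp_quasi hl.quasiMeasurePreserving
  have hg := hΦ.g_bdd.comp_quasi hr.quasiMeasurePreserving
  unfold logDensity
  rw [integral_neg, integral_add (hf.add hg).integrable h1.integrable,
    integral_add hf.integrable hg.integrable, integral_martingale hπ h1.integrable,
    integral_comp_of_measurePreserving hl hΦ.f_bdd, integral_comp_of_measurePreserving hr hΦ.g_bdd]
  ring

/-- The relative entropy with respect to the reference measure, compared with the one with respect
to the induced measure. -/
theorem klDiv_reference {π : ProbabilityMeasure (ℝ × ℝ × ℝ)} (hπ : π ∈ martingaleCouplings μ ν)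
    (hfin : klDiv (π : Measure (ℝ × ℝ × ℝ)) (reference μ ν ρ c) ≠ ∞) :
    klDiv (π : Measure (ℝ × ℝ × ℝ)) (induced μ ν ρ c Φ) ≠ ∞ ∧
      (klDiv (π : Measure (ℝ × ℝ × ℝ)) (reference μ ν ρ c)).toReal =
        (klDiv (π : Measure (ℝ × ℝ × ℝ)) (induced μ ν ρ c Φ)).toReal +
          (-∫ x, Φ.f x ∂μ - ∫ y, Φ.g y ∂ν) := by
  have := D.reference_prob
  have hp := D.isProbabilityMeasure_induced hΦ hs
  obtain ⟨hac, hint⟩ := klDiv_ne_top_iff.1 hfin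
  have hQ := (D.logDensity_bdd hΦ).of_ac (reference_ac (c := c))
  have hF := (hQ.of_ac hac).integrable
  have he := hQ.exp.integrable
  have e := D.induced_eq_tilted hΦ hs
  have hac' : (π : Measure (ℝ × ℝ × ℝ)) ≪ induced μ ν ρ c Φ := by
    rw [e]; exact hac.trans (absolutelyContinuous_tilted he)
  refine ⟨klDiv_ne_top hac' (by rw [e]; exact integrable_llr_tilted_right hac hF hint he), ?_⟩
  rw [toReal_klDiv_of_measure_eq hac (by simp), toReal_klDiv_of_measure_eq hac' (by simp), e,
    integral_llr_tilted_right hac hF he hint, D.integral_exp_logDensity hΦ hs, Real.log_one,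
    D.integral_logDensity hΦ hπ hac]
  ring

theorem klDiv_induced_ne_top : klDiv (induced μ ν ρ c Φ) (reference μ ν ρ c) ≠ ∞ := by
  have := D.reference_prob
  have hp := D.isProbabilityMeasure_induced hΦ hs
  have hQ := (D.logDensity_bdd hΦ).of_ac (reference_ac (c := c))
  have e := D.induced_eq_tilted hΦ hs
  have hac : induced μ ν ρ c Φ ≪ reference μ ν ρ c := by
    rw [e]; exact tilted_absolutelyContinuous _ _
  refine klDiv_ne_top hac ?_
  refine (hQ.of_ac hac).integrable.congr (hac.ae_le ?_)
  have h1 := llr_tilted_left (Measure.AbsolutelyContinuous.refl (reference μ ν ρ c))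
    hQ.exp.integrable hQ.1.aemeasurable
  rw [← e, D.integral_exp_logDensity hΦ hs] at h1
  filter_upwards [h1, llr_self (reference μ ν ρ c)] with p h2 h3
  rw [h2, h3]
  simp

/-- The induced measure of an optimal triple is the unique solution of the primal problem. -/
theorem primal : ∃ π ∈ martingaleCouplings μ ν,
    (π : Measure (ℝ × ℝ × ℝ)) = induced μ ν ρ c Φ ∧
    klDiv (π : Measure (ℝ × ℝ × ℝ)) (reference μ ν ρ c) = primalValue μ ν ρ c ∧
    (∀ π' ∈ martingaleCouplings μ ν,
      klDiv (π' : Measure (ℝ × ℝ × ℝ)) (reference μ ν ρ c) = primalValue μ ν ρ c → π' = π) ∧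
    (primalValue μ ν ρ c : EReal) = ((1 + dual μ ν ρ c Φ : ℝ) : EReal) := by
  have hp := D.isProbabilityMeasure_induced hΦ hs
  obtain ⟨π, hπ, e⟩ := D.exists_induced_mem hΦ hs
  have hfin : klDiv (π : Measure (ℝ × ℝ × ℝ)) (reference μ ν ρ c) ≠ ∞ := by
    rw [e]; exact D.klDiv_induced_ne_top hΦ hs
  have hval := (D.klDiv_reference hΦ hs hπ hfin).2
  rw [← e, klDiv_self, ENNReal.toReal_zero, zero_add] at hval
  -- For π' of finite entropy, H(π'|Q) exceeds H(π*|Q) exactly by H(π'|π*) ≥ 0.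
  have hprimal : primalValue μ ν ρ c = klDiv (π : Measure (ℝ × ℝ × ℝ)) (reference μ ν ρ c) := by
    refine le_antisymm (iInf₂_le π hπ) (le_iInf₂ fun π' hπ' => ?_)
    by_cases h : klDiv (π' : Measure (ℝ × ℝ × ℝ)) (reference μ ν ρ c) = ∞
    · rw [h]; exact le_top
    · rw [← ENNReal.toReal_le_toReal hfin h, hval, (D.klDiv_reference hΦ hs hπ' h).2]
      exact le_add_of_nonneg_left ENNReal.toReal_nonneg
  refine ⟨π, hπ, e, hprimal.symm, fun π' hπ' h => ?_, ?_⟩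
  · rw [hprimal] at h
    have h1 := D.klDiv_reference hΦ hs hπ' (by rw [h]; exact hfin)
    have h2 : (klDiv (π' : Measure (ℝ × ℝ × ℝ)) (induced μ ν ρ c Φ)).toReal = 0 := by
      have := h1.2
      rw [h, hval] at this
      linarith
    have h3 := (ENNReal.toReal_eq_zero_iff _).1 h2
    have h4 := klDiv_eq_zero_iff.1 (h3.resolve_right h1.1)
    exact Subtype.ext (h4.trans e.symm)
  · have h1 : 1 + dual μ ν ρ c Φ = -∫ x, Φ.f x ∂μ - ∫ y, Φ.g y ∂ν := by
      unfold dual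
      rw [probReal_univ]
      ring
    rw [hprimal, h1, ← hval, EReal.coe_ennreal_toReal hfin]

end Standing

/-! ### Norms of bounded functions -/

section Norms

variable {σ : Measure ℝ} [IsProbabilityMeasure σ]

theorem eLpNorm_le_ofReal {F : ℝ → ℝ} {β : ℝ} {p : ℝ≥0∞} (h : ∀ᵐ x ∂σ, |F x| ≤ β) :
    eLpNorm F p σ ≤ ENNReal.ofReal β := by
  simpa using eLpNorm_le_of_ae_bound (p := p) (μ := σ) (f := F) h

theorem eLpNorm_sq_le {F : ℝ → ℝ} {β : ℝ} {p : ℝ≥0∞} (hβ : 0 ≤ β) (h : ∀ᵐ x ∂σ, |F x| ≤ β) :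
    eLpNorm F p σ ^ 2 ≤ ENNReal.ofReal (β ^ 2) := by
  rw [ENNReal.ofReal_pow hβ]
  gcongr
  exact eLpNorm_le_ofReal h

theorem tendsto_eLpNorm_top {F : ℕ → ℝ → ℝ} {C r : ℝ} (hr : 0 < r)
    (h : ∀ n : ℕ, ∃ β, 0 ≤ β ∧ (∀ᵐ x ∂σ, |F n x| ≤ β) ∧ β ^ 2 ≤ C * Real.exp (-(n : ℝ) * r)) :
    Tendsto (fun n => eLpNorm (F n) ∞ σ) atTop (𝓝 0) := by
  have h1 : Tendsto (fun n : ℕ => ENNReal.ofReal √(C * Real.exp (-(n : ℝ) * r))) atTop (𝓝 0) := by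
    have h2 : Tendsto (fun n : ℕ => (n : ℝ) * r) atTop atTop :=
      tendsto_natCast_atTop_atTop.atTop_mul_const hr
    have h3 := ((Real.tendsto_exp_neg_atTop_nhds_zero.comp h2).const_mul C).sqrt
    have h4 := ENNReal.tendsto_ofReal h3
    simpa using h4
  refine tendsto_of_tendsto_of_tendsto_of_le_of_le tendsto_const_nhds h1
    (fun _ => zero_le) fun n => ?_
  obtain ⟨β, -, h2, h3⟩ := h n
  exact (eLpNorm_le_ofReal h2).trans (ENNReal.ofReal_le_ofReal (Real.le_sqrt_of_sq_le h3))

end Norms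

end EMOT

end

/-! ### Assembly of the main theorem -/

theorem mainTheorem1 :
    -- The rate: a function of bounds for |x|, |y|, |c|, Var(ν), and the iterates f, g, h.
    ∃ rate : ℝ → ℝ → ℝ → ℝ → ℝ → ℝ → ℝ → ℝ,
      (∀ A B K v Cf Cg Ch : ℝ, 0 < v → 0 < rate A B K v Cf Cg Ch) ∧
      ∀ (μ ν ρ : Measure ℝ) [IsProbabilityMeasure μ] [IsProbabilityMeasure ν]
        [IsProbabilityMeasure ρ] (c : ℝ × ℝ × ℝ → ℝ) (φ₀ : EMOT.Potentials),
        EMOT.Standing μ ν ρ c φ₀ →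
        -- The algorithm is well defined.
        (∀ n : ℕ, (EMOT.sinkhorn μ ν ρ c φ₀ n).Bounded μ ν ∧
          ∀ᵐ x ∂μ, ∃! t : ℝ, EMOT.IsRoot ν ρ c (EMOT.sinkhorn μ ν ρ c φ₀ n) x t) ∧
        -- Constants bounding the iterates exist.
        (∃ Cf Cg Ch : ℝ, EMOT.UniformBound μ ν (EMOT.sinkhorn μ ν ρ c φ₀) Cf Cg Ch) ∧
        ∃ φ : EMOT.Potentials,
          -- Exponential convergence of the dual values and of the potentials.
          (∀ A B K v Cf Cg Ch : ℝ, 0 < v →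
            (∀ᵐ x ∂μ, |x| ≤ A) → (∀ᵐ y ∂ν, |y| ≤ B) →
            (∀ᵐ p ∂(EMOT.base μ ν ρ), |c p| ≤ K) →
            v ≤ variance (fun y : ℝ => y) ν →
            EMOT.UniformBound μ ν (EMOT.sinkhorn μ ν ρ c φ₀) Cf Cg Ch →
            (∀ n : ℕ,
              EMOT.dualSup μ ν ρ c - EMOT.dual μ ν ρ c (EMOT.sinkhorn μ ν ρ c φ₀ n) ≤
                Real.exp (-(n : ℝ) * rate A B K v Cf Cg Ch) *
                  (EMOT.dualSup μ ν ρ c - EMOT.dual μ ν ρ c φ₀)) ∧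
            ∃ C₀ : ℝ, 0 ≤ C₀ ∧ ∀ n : ℕ,
              eLpNorm ((EMOT.sinkhorn μ ν ρ c φ₀ n).f - φ.f) ∞ μ ^ 2 +
                eLpNorm ((EMOT.sinkhorn μ ν ρ c φ₀ n).g - φ.g) ∞ ν ^ 2 +
                eLpNorm ((EMOT.sinkhorn μ ν ρ c φ₀ n).h - φ.h) 2 μ ^ 2 ≤
                ENNReal.ofReal (C₀ * Real.exp (-(n : ℝ) * rate A B K v Cf Cg Ch))) ∧
          -- Uniform convergence to the unique normalized maximizer of the dual problem.
          (φ.Bounded μ ν ∧ φ.Normalized μ ν ∧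
            Tendsto (fun n => eLpNorm ((EMOT.sinkhorn μ ν ρ c φ₀ n).f - φ.f) ∞ μ) atTop (𝓝 0) ∧
            Tendsto (fun n => eLpNorm ((EMOT.sinkhorn μ ν ρ c φ₀ n).g - φ.g) ∞ ν) atTop (𝓝 0) ∧
            Tendsto (fun n => eLpNorm ((EMOT.sinkhorn μ ν ρ c φ₀ n).h - φ.h) ∞ μ) atTop (𝓝 0) ∧
            IsLUB (EMOT.dualValues μ ν ρ c) (EMOT.dualSup μ ν ρ c) ∧
            EMOT.dual μ ν ρ c φ = EMOT.dualSup μ ν ρ c ∧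
            ∀ ψ : EMOT.Potentials, ψ.Bounded μ ν → ψ.Normalized μ ν →
              EMOT.dual μ ν ρ c ψ = EMOT.dualSup μ ν ρ c → ψ.AEEq φ μ ν) ∧
          -- The induced measure is the unique primal minimizer; there is no duality gap.
          (∃ π ∈ EMOT.martingaleCouplings μ ν,
            (π : Measure (ℝ × ℝ × ℝ)) = EMOT.induced μ ν ρ c φ ∧
            klDiv (π : Measure (ℝ × ℝ × ℝ)) (EMOT.reference μ ν ρ c) =
              EMOT.primalValue μ ν ρ c ∧
            (∀ π' ∈ EMOT.martingaleCouplings μ ν,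
              klDiv (π' : Measure (ℝ × ℝ × ℝ)) (EMOT.reference μ ν ρ c) =
                EMOT.primalValue μ ν ρ c → π' = π) ∧
            (EMOT.primalValue μ ν ρ c : EReal) = ((1 + EMOT.dualSup μ ν ρ c : ℝ) : EReal)) := by
  refine ⟨EMOT.sinkhornRate, fun A B K v Cf Cg Ch hv => EMOT.sinkhornRate_pos hv, ?_⟩
  intro μ ν ρ _ _ _ c φ₀ D
  obtain ⟨A, B, K, S, hK⟩ := D.exists_setting
  obtain ⟨θ, κ, hθ, E⟩ := D.exists_planar_coupling
  have Q := D.isSinkhornSeq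
  have hv := D.secondMoment_pos
  obtain ⟨C, hC, hQ⟩ := Q.exists_bound S E hv le_rfl
  have hbd : EMOT.UniformBound μ ν (EMOT.sinkhorn μ ν ρ c φ₀) C C C := fun n _ => (hQ n).1
  obtain ⟨φ, hφ, nφ, hs⟩ := Q.exists_optimal S E hv le_rfl
  -- The supremum is attained, which also settles that the set of values is bounded above, so that
  -- `sSup` has its intended meaning.
  have hgreatest : IsGreatest (EMOT.dualValues μ ν ρ c) (EMOT.dual μ ν ρ c φ) := by
    refine ⟨⟨φ, hφ, rfl⟩, ?_⟩
    rintro _ ⟨ψ, hψ, rfl⟩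
    rw [D.dual_eq hφ, D.dual_eq hψ]
    exact S.planarDual_le_of_opt hφ hψ hs.xOpt hs.yOpt
  have hsup : EMOT.dualSup μ ν ρ c = EMOT.dual μ ν ρ c φ := hgreatest.csSup_eq
  refine ⟨fun n => ⟨D.sinkhorn_bounded n, D.existsUnique_isRoot (D.sinkhorn_bounded n)⟩,
    ⟨C, C, C, hbd⟩, φ, ?_, ?_, ?_⟩
  · intro A B K v Cf Cg Ch hv hA hB hK hvar hbd
    rw [D.variance_eq] at hvar
    -- The limit φ and the coupling are fixed beforehand; only the bounds entering the rate are
    -- replaced by the given ones.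
    obtain ⟨h1, C₀, hC₀, h2⟩ := Q.converges (D.setting hA hB hK) E hv hvar hφ nφ hs hbd
    -- Each of the three squared norms is at most β²; for h the L² norm is bounded by the essential
    -- bound since μ is a probability measure.
    refine ⟨fun n => ?_, 3 * C₀, by positivity, fun n => ?_⟩
    · rw [hsup, D.dual_eq hφ, D.dual_eq (D.sinkhorn_bounded n), D.dual_eq D.initial_bounded]
      exact h1 n
    · obtain ⟨β, hβ, hb, hle⟩ := h2 n
      have e1 := EMOT.eLpNorm_sq_le (p := ∞) hβ hb.1
      have e2 := EMOT.eLpNorm_sq_le (p := ∞) hβ hb.2.1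
      have e3 := EMOT.eLpNorm_sq_le (p := 2) hβ hb.2.2
      refine (add_le_add (add_le_add e1 e2) e3).trans ?_
      rw [← ENNReal.ofReal_add (by positivity) (by positivity),
        ← ENNReal.ofReal_add (by positivity) (by positivity)]
      exact ENNReal.ofReal_le_ofReal (by linarith)
  · obtain ⟨-, C₀, hC₀, h2⟩ := Q.converges S E hv le_rfl hφ nφ hs hbd
    have hr := EMOT.sinkhornRate_pos (A := A) (B := B) (K := K) (Cf := C) (Cg := C) (Ch := C) hv
    refine ⟨hφ, nφ, EMOT.tendsto_eLpNorm_top (C := C₀) hr fun n => ?_,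
      EMOT.tendsto_eLpNorm_top (C := C₀) hr fun n => ?_, EMOT.tendsto_eLpNorm_top (C := C₀) hr fun n => ?_,
      hsup ▸ hgreatest.isLUB, hsup.symm, fun ψ hψ nψ h => ?_⟩
    · obtain ⟨β, hβ, hb, hle⟩ := h2 n
      exact ⟨β, hβ, hb.1, hle⟩
    · obtain ⟨β, hβ, hb, hle⟩ := h2 n
      exact ⟨β, hβ, hb.2.1, hle⟩
    · obtain ⟨β, hβ, hb, hle⟩ := h2 n
      exact ⟨β, hβ, hb.2.2, hle⟩
    · rw [hsup, D.dual_eq hφ, D.dual_eq hψ] at h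
      exact S.aeEq_of_planarDual_le hφ nφ hs hψ nψ hv le_rfl h.ge
  · rw [hsup]
    exact D.primal hφ hs
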